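/- **Classical analytic stationary phase.** *Conventions.* Let $\Omega\subset\mathbb C^d$ be open. A *formal classical analytic amplitude* on $\Omega$ is a sequence $\underline q=(q_k)_{k\in\mathbb N}$ of holomorphic functions on $\Omega$ such that for every compact $K\subset\Omega$ there are $M,C>0$, independent of $k$, with $$\sup_K|q_k|\le M C^k k!\qquad(k\in\mathbb N).\tag{1}$$ It is *elliptic* on $\Omega$ if $q_0\neq0$ everywhere on $\Omega$. A *finite realization* of $\underline q$ on a compact $K\subset\Omega$ is a function $q(x;\lambda)=\sum_{0\le k\le\lambda/R}\lambda^{-k}q_k(x)$ ($x\in K$, $\lambda\ge1$), where $R>eC$ for some $C>0$ that satisfies (1) on $K$ with some $M>0$. For open sets $A'\subset A\subset\mathbb R^N$ with $\operatorname{dist}(A',\mathbb R^N\setminus A)>0$, a *sequence of Ehrenpreis cut-offs relative to $(A,A')$ with constant $C>0$* is a sequence $\chi_j\in C_c^\infty(A)$, $j\in\mathbb N$, with $0\le\chi_j\le1$, $\chi_j=1$ on $A'$, $|\partial^\alpha\chi_j|\le(Cj)^{|\alpha|}$ for all $j$ and $|\alpha|\le j$, and, for every $\alpha$, $\sup_j\sup_A|\partial^\alpha\chi_j|<\infty$.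 *Hypotheses.* Let $A_0\subset\mathbb R^N$, $B_0\subset\mathbb R^{N'}$ be open, $(\hat a,\hat b)\in A_0\times B_0$, and let $A_0^{\mathbb C}\supset A_0$, $B_0^{\mathbb C}\supset B_0$ be open in $\mathbb C^N$, $\mathbb C^{N'}$. Let $\underline q=(q_k)$ be a formal classical analytic amplitude on $A_0^{\mathbb C}\times B_0^{\mathbb C}$, and let $\Phi$ be holomorphic on $A_0^{\mathbb C}\times B_0^{\mathbb C}$ with $$\nabla_a\Phi(\hat a,\hat b)=0,\qquad \det\partial_a^2\Phi(\hat a,\hat b)\ne0,\qquad \operatorname{Im}\Phi\ge0\ \text{ on } A_0\times B_0 .$$ *Conclusion.* There are open complex neighbourhoods $A^{\mathbb C}\subset A_0^{\mathbb C}$ of $\hat a$ and $B^{\mathbb C}\subset B_0^{\mathbb C}$ of $\hat b$ and a holomorphic map $\mathbf a\colon B^{\mathbb C}\to A^{\mathbb C}$ with $\mathbf a(\hat b)=\hat a$ such that, for $(a,b)\in A^{\mathbb C}\times B^{\mathbb C}$, $\nabla_a\Phi(a,b)=0$ if and only if $a=\mathbf a(b)$. Moreover, there is an open neighbourhood $A_1$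 of $\hat a$, relatively compact in $A_0$, such that for all open $A'\subset A\subset A_1$ with $\hat a\in A'$ and $\operatorname{dist}(A',\mathbb R^N\setminus A)>0$ there are an open neighbourhood $B$ of $\hat b$, relatively compact in $B_0$, and an open $\Omega\subset B^{\mathbb C}$ containing $\overline B$ with the following property. For every $C>0$ there is $\vartheta_0>0$ such that, for every $0<\vartheta<\vartheta_0$, every $\tau\colon\mathbb R\to\mathbb N$ with $\vartheta\lambda/2\le\tau(\lambda)\le\vartheta\lambda$ for all sufficiently large $\lambda$, and every sequence $(\chi_j)$ of Ehrenpreis cut-offs relative to $(A,A')$ with constant $C$, there is a formal classical analytic amplitude $\underline{q^\sharp}=(q_k^\sharp)$ on $\Omega$, independent of $\lambda$, such that: 1. If $q(a,b;\lambda)$ is any finite realization of $\underline q$ on a compact subset of $A_0^{\mathbb C}\times B_0^{\mathbb C}$ that contains $A\times B$, and $q^\sharp(b;\lambda)$ is any finite realization of $\underline{q^\sharp}$ on a compact subset of $\Omega$ that contains $B$, then for some $\varepsilon>0$ $$\lambda^{-N/2}e^{i\lambda\Phi(\mathbf a(b),b)}\,q^\sharp(b;\lambda)=\int e^{i\lambda\Phi(a,b)}\chi_{\tau(\lambda)}(a)\,q(a,b;\lambda)\,da+\mathcal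 O(e^{-\varepsilon\lambda})$$ for all sufficiently large $\lambda\ge 1$, uniformly in $b\in B$. 2. If $q_0(\hat a,\hat b)\ne0$, then $\underline{q^\sharp}$ is elliptic on $\Omega$. -/

import Mathlib

open Filter Topology

/-- The inclusion of `ℝⁿ` into `ℂⁿ`. -/
def toComplex {n : ℕ} (x : Fin n → ℝ) : Fin n → ℂ := fun i => (x i : ℂ)

/-- The sequence `q = (q_k)` consists of holomorphic functions on `Ω` (holomorphic means locally given
by a convergent complex power series) and, on every compact `K ⊆ Ω`, satisfies
`sup_K |q_k| ≤ M C ^ k k!` with `M, C > 0` independent of `k`. -/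
structure IsFormalAnalyticAmplitude {E : Type*} [NormedAddCommGroup E] [NormedSpace ℂ E]
    (Ω : Set E) (q : ℕ → E → ℂ) : Prop where
  holomorphic : ∀ k, AnalyticOnNhd ℂ (q k) Ω
  bound : ∀ K : Set E, IsCompact K → K ⊆ Ω → ∃ M C : ℝ, 0 < M ∧ 0 < C ∧
    ∀ k : ℕ, ∀ x ∈ K, ‖q k x‖ ≤ M * C ^ k * (k.factorial : ℝ)

/-- Ellipticity of a formal amplitude: the leading term does not vanish on `Ω`. -/
def IsEllipticOn {E : Type*} (Ω : Set E) (q : ℕ → E → ℂ) : Prop :=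
  ∀ x ∈ Ω, q 0 x ≠ 0

/-- The parameters `R` that are allowed in finite realizations on `K`: those with `R > e C`, where
`sup_K |q_k| ≤ M C ^ k k!` for all `k`. -/
def IsRealizationParameter {E : Type*} (q : ℕ → E → ℂ) (K : Set E) (R : ℝ) : Prop :=
  ∃ M C : ℝ, 0 < M ∧ 0 < C ∧
    (∀ k : ℕ, ∀ x ∈ K, ‖q k x‖ ≤ M * C ^ k * (k.factorial : ℝ)) ∧ Real.exp 1 * C < R

/-- The finite realization `q(x; lam) = ∑_{0 ≤ k ≤ lam / R} lam ^ (-k) q_k(x)`. -/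
noncomputable def finiteRealization {E : Type*} (q : ℕ → E → ℂ) (R lam : ℝ) (x : E) : ℂ :=
  ∑ k ∈ Finset.range (⌊lam / R⌋₊ + 1), ((lam : ℂ) ^ k)⁻¹ * q k x

/-- The partial derivative `∂_{σ 0} ⋯ ∂_{σ (k-1)} f (x)` of order `k`. As `σ` runs over all maps
`Fin k → Fin n`, these are all the `∂^α f (x)` with `|α| = k`. -/
noncomputable def partialDeriv {n k : ℕ} (σ : Fin k → Fin n) (f : (Fin n → ℝ) → ℝ)
    (x : Fin n → ℝ) : ℝ :=
  iteratedFDeriv ℝ k f x (fun i => Pi.single (σ i) (1 : ℝ))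

/-- `χ = (χ_j)` is a sequence of Ehrenpreis cut-offs relative to `(U, U')` with growth constant `C`. -/
structure IsEhrenpreisCutoff {n : ℕ} (U U' : Set (Fin n → ℝ)) (C : ℝ)
    (χ : ℕ → (Fin n → ℝ) → ℝ) : Prop where
  smooth : ∀ j, ContDiff ℝ ((⊤ : ℕ∞) : WithTop ℕ∞) (χ j)
  eq_one : ∀ j, ∀ x ∈ U', χ j x = 1
  hasCompactSupport : ∀ j, HasCompactSupport (χ j)
  tsupport_subset : ∀ j, tsupport (χ j) ⊆ U
  nonneg : ∀ j x, 0 ≤ χ j x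
  le_one : ∀ j x, χ j x ≤ 1
  growth : ∀ j k : ℕ, k ≤ j → ∀ (σ : Fin k → Fin n) (x : Fin n → ℝ),
    |partialDeriv σ (χ j) x| ≤ (C * j) ^ k
  bounded : ∀ (k : ℕ) (σ : Fin k → Fin n), ∃ D : ℝ, ∀ (j : ℕ), ∀ x ∈ U,
    |partialDeriv σ (χ j) x| ≤ D

/-- The gradient in `a` of `Φ(a, b)`, as a complex linear form. -/
noncomputable def phaseGrad {N N' : ℕ} (Φ : (Fin N → ℂ) × (Fin N' → ℂ) → ℂ)
    (a : Fin N → ℂ) (b : Fin N' → ℂ) : (Fin N → ℂ) →L[ℂ] ℂ :=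
  fderiv ℂ (fun x => Φ (x, b)) a

/-- The complex Hessian matrix in `a` of `Φ(a, b)`. -/
noncomputable def phaseHessian {N N' : ℕ} (Φ : (Fin N → ℂ) × (Fin N' → ℂ) → ℂ)
    (a : Fin N → ℂ) (b : Fin N' → ℂ) : Matrix (Fin N) (Fin N) ℂ :=
  Matrix.of fun i j =>
    fderiv ℂ (fun x => phaseGrad Φ x b (Pi.single j 1)) a (Pi.single i 1)

/-- `acrit : BC → AC` is holomorphic, `acrit b₀ = a₀`, and for `(a, b) ∈ AC × BC` the point `a` is
critical for `Φ(·, b)` if and only if `a = acrit b`. -/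
structure IsCriticalPointMap {N N' : ℕ} (Φ : (Fin N → ℂ) × (Fin N' → ℂ) → ℂ)
    (a₀ : Fin N → ℂ) (b₀ : Fin N' → ℂ) (AC : Set (Fin N → ℂ)) (BC : Set (Fin N' → ℂ))
    (acrit : (Fin N' → ℂ) → (Fin N → ℂ)) : Prop where
  holomorphic : AnalyticOnNhd ℂ acrit BC
  mapsTo : ∀ b ∈ BC, acrit b ∈ AC
  base : acrit b₀ = a₀
  critical_iff : ∀ a ∈ AC, ∀ b ∈ BC, phaseGrad Φ a b = 0 ↔ a = acrit b

/-- The oscillatory integral `∫ exp(i lam Φ(a, b)) χ(a) u(a, b) da` over real `a`, for real `b`. -/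
noncomputable def oscIntegral {N N' : ℕ} (Φ : (Fin N → ℂ) × (Fin N' → ℂ) → ℂ)
    (χ : (Fin N → ℝ) → ℝ) (u : (Fin N → ℂ) × (Fin N' → ℂ) → ℂ) (lam : ℝ)
    (b : Fin N' → ℝ) : ℂ :=
  ∫ a : Fin N → ℝ, Complex.exp (Complex.I * (lam : ℂ) * Φ (toComplex a, toComplex b)) *
    (χ a : ℂ) * u (toComplex a, toComplex b)

/-! If `Im Φ` is positive at the base point, both sides of the asserted identity are exponentially
small near it, and any elliptic amplitude will do. The substance is the case in which the critical
value at the base point is real.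

There the contour of integration is moved into the complex domain. Let `D` be the Hessian of the
phase at the base point and `L` be `i` times its conjugate. Then `Im Φ` grows along the linear flow
`a₀ + exp(sL)(x - a₀)` at a rate at least a multiple of `|x - a₀|²` (`exists_deformation`). At time
`δ` the contour is `a₀ + Tℝᴺ` with `T = exp(δL)`, and a small translation makes it pass through
`acrit b`. On the new contour `Im (Φ(acrit b + hTy, b) - Φ(acrit b, b)) / h² ≥ κ|y|²`, even for
small complex `h` (`exists_gaussian_bound`).

With `h = λ^(-1/2)` the rescaled integrand is holomorphic in `h`, bounded near `h = 0`, and has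
uniform Gaussian decay. Its Taylor coefficients in `h`, estimated by Cauchy on circles of radius
about `1/(1+|y|)`, are polynomials in `|y|` times Gaussians, so their integrals grow like `C^k k!`.
Odd coefficients integrate to zero by the symmetry `(h, y) ↦ (-h, -y)`, and even powers of `h` are
powers of `λ⁻¹`. Truncating at order about `λ/R` leaves an exponentially small remainder
(`IsGaussianPhase.exists_expansion`). The leading coefficient is a Jacobian times the amplitude at
the critical point times a nondegenerate complex Gaussian integral, which gives ellipticity.

The cut-off is not holomorphic, so it has to be carried along with the contour. If `W` is the field
generating the flow, `exp(s tr L) ∫ G(s,x) φ(x) dx` has derivative `-exp(s tr L) ∫ G(s,x) Wφ(x) dx`.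
Replacing `φ` by the Taylor polynomial `∑ sᵏ Wᵏφ / k!` up to order `m` therefore leaves only an
error with `s^m W^(m+1) φ / m!`. For an Ehrenpreis cut-off of index `m + 1` this is at most
`e^(-(m+1))` when `s` is small. The transported cut-off has size `e^(sk(m+1))`, while away from `a₀`
the integrand is of size `e^(-scλ)`; taking `m + 1` proportional to `λ` with a small factor makes
both errors exponentially small (`exists_norm_contour_sub_cutoff_le`).

Errors relative to the critical value are harmless because `Im Φ(acrit b, b) ≥ 0` for real `b`
(`im_critical_value_nonneg`): otherwise the expansion would force a bounded integral to grow
exponentially. -/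

/-! ### Finite realizations of formal amplitudes -/

/-- In the admitted range `k! ≤ k^k ≤ (lam/R)^k`, so the term is at most `M (C/R)^k`, and `R > eC`
turns this into a geometric sequence of ratio `e⁻¹`. -/
theorem norm_realization_term_le {E : Type*} {q : ℕ → E → ℂ} {M C R lam : ℝ} {x : E} {k : ℕ}
    (hM : 0 < M) (hC : 0 < C) (hR : Real.exp 1 * C < R) (hlam : 0 < lam)
    (hq : ‖q k x‖ ≤ M * C ^ k * (k.factorial : ℝ)) (hk : (k : ℝ) ≤ lam / R) :
    ‖((lam : ℂ) ^ k)⁻¹ * q k x‖ ≤ M * Real.exp (-1) ^ k := by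
  have hR0 : 0 < R := lt_trans (by positivity) hR
  have h1 : (k.factorial : ℝ) ≤ (lam / R) ^ k := by
    calc (k.factorial : ℝ) ≤ (k : ℝ) ^ k := by exact_mod_cast Nat.factorial_le_pow k
      _ ≤ _ := pow_le_pow_left₀ (by positivity) hk k
  have h2 : C / R ≤ Real.exp (-1) := by
    rw [Real.exp_neg, div_le_iff₀ hR0, inv_mul_eq_div, le_div_iff₀ (Real.exp_pos 1), mul_comm]
    exact hR.le
  rw [norm_mul, norm_inv, norm_pow, Complex.norm_real, Real.norm_of_nonneg hlam.le]
  calc (lam ^ k)⁻¹ * ‖q k x‖ ≤ (lam ^ k)⁻¹ * (M * C ^ k * (lam / R) ^ k) := by gcongr; exact hq.trans (by gcongr)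
    _ = M * (C / R) ^ k := by rw [div_pow, div_pow]; field_simp
    _ ≤ _ := by gcongr

theorem sum_Ico_exp_neg_one_pow_le (a b : ℕ) :
    ∑ k ∈ Finset.Ico a b, Real.exp (-1) ^ k ≤ 2 * Real.exp (-1) ^ a := by
  have h1 : Real.exp (-1) ≤ 1 / 2 := by
    rw [Real.exp_neg, one_div]
    exact inv_anti₀ (by norm_num) (by linarith [Real.add_one_le_exp 1])
  refine (geom_sum_Ico_le_of_lt_one (Real.exp_pos _).le (by linarith)).trans ?_
  rw [div_le_iff₀ (by linarith)]
  nlinarith [pow_pos (Real.exp_pos (-1)) a]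

/-- Finite realizations are bounded uniformly in the large parameter. -/
theorem IsRealizationParameter.exists_bound {E : Type*} {q : ℕ → E → ℂ} {K : Set E} {R : ℝ}
    (h : IsRealizationParameter q K R) :
    ∃ Q : ℝ, 0 < Q ∧ ∀ lam : ℝ, 1 ≤ lam → ∀ x ∈ K, ‖finiteRealization q R lam x‖ ≤ Q := by
  obtain ⟨M, C, hM, hC, hq, hR⟩ := h
  have hR0 : 0 < R := lt_trans (by positivity) hR
  refine ⟨M * 2, by positivity, fun lam hlam x hx => ?_⟩
  have hlam0 : 0 < lam := by linarith
  unfold finiteRealization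
  calc _ ≤ ∑ k ∈ Finset.range (⌊lam / R⌋₊ + 1), M * Real.exp (-1) ^ k := by
        refine norm_sum_le_of_le _ fun k hk => ?_
        refine norm_realization_term_le hM hC hR hlam0 (hq k x hx) ?_
        exact (Nat.le_floor_iff (by positivity)).1 (Nat.lt_succ_iff.1 (Finset.mem_range.1 hk))
    _ ≤ _ := by
        rw [← Finset.mul_sum, Finset.range_eq_Ico]
        simpa using mul_le_mul_of_nonneg_left
          (sum_Ico_exp_neg_one_pow_le 0 (⌊lam / R⌋₊ + 1)) hM.le

/-- The two sums differ by the terms with `lam/R' < k ≤ lam/R`. All of them lie in the range where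
the geometric bound for `R` holds, and the first index already exceeds `lam/R'`. -/
theorem IsRealizationParameter.exists_sub_le_of_le {E : Type*} {q : ℕ → E → ℂ} {K : Set E} {R R' : ℝ}
    (h : IsRealizationParameter q K R) (hRR : R ≤ R') :
    ∃ M : ℝ, 0 < M ∧ ∀ lam : ℝ, 1 ≤ lam → ∀ x ∈ K,
      ‖finiteRealization q R lam x - finiteRealization q R' lam x‖ ≤
        M * Real.exp (-(1 / R') * lam) := by
  obtain ⟨M, C, hM, hC, hq, hR⟩ := h
  have hR0 : 0 < R := lt_trans (by positivity) hR
  have hR'0 : 0 < R' := by linarith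
  refine ⟨M * 2, by positivity, fun lam hlam x hx => ?_⟩
  have hlam0 : 0 < lam := by linarith
  have hle : ⌊lam / R'⌋₊ + 1 ≤ ⌊lam / R⌋₊ + 1 := by gcongr
  unfold finiteRealization
  rw [← Finset.sum_range_add_sum_Ico _ hle, add_sub_cancel_left]
  calc _ ≤ ∑ k ∈ Finset.Ico (⌊lam / R'⌋₊ + 1) (⌊lam / R⌋₊ + 1), M * Real.exp (-1) ^ k := by
        refine norm_sum_le_of_le _ fun k hk => ?_
        refine norm_realization_term_le hM hC hR hlam0 (hq k x hx) ?_
        exact (Nat.le_floor_iff (by positivity)).1 (Nat.lt_succ_iff.1 (Finset.mem_Ico.1 hk).2)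
    _ ≤ M * (2 * Real.exp (-1) ^ (⌊lam / R'⌋₊ + 1)) := by
        rw [← Finset.mul_sum]
        exact mul_le_mul_of_nonneg_left (sum_Ico_exp_neg_one_pow_le _ _) hM.le
    _ ≤ M * (2 * Real.exp (-(1 / R') * lam)) := by
        rw [← Real.exp_nat_mul]
        have := Nat.lt_floor_add_one (lam / R')
        have h3 : lam / R' = 1 / R' * lam := by ring
        have h4 := Real.exp_le_exp.2 (show ((⌊lam / R'⌋₊ + 1 : ℕ) : ℝ) * (-1) ≤ -(1 / R') * lam by
          push_cast; linarith)
        gcongr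
    _ = _ := by ring

/-- Two finite realizations of the same amplitude differ by an exponentially small term. -/
theorem IsRealizationParameter.exists_sub_le {E : Type*} {q : ℕ → E → ℂ} {K K' : Set E} {R R' : ℝ}
    (h : IsRealizationParameter q K R) (h' : IsRealizationParameter q K' R') :
    ∃ M ε : ℝ, 0 < M ∧ 0 < ε ∧ ∀ lam : ℝ, 1 ≤ lam → ∀ x ∈ K ∩ K',
      ‖finiteRealization q R lam x - finiteRealization q R' lam x‖ ≤ M * Real.exp (-ε * lam) := by
  have pos : ∀ {K R}, IsRealizationParameter q K R → 0 < R := by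
    rintro K R ⟨M, C, hM, hC, -, hR⟩
    exact lt_trans (by positivity) hR
  rcases le_total R R' with hRR | hRR
  · obtain ⟨M, hM, H⟩ := h.exists_sub_le_of_le hRR
    exact ⟨M, 1 / R', hM, by have := pos h'; positivity, fun lam hlam x hx => H lam hlam x hx.1⟩
  · obtain ⟨M, hM, H⟩ := h'.exists_sub_le_of_le hRR
    refine ⟨M, 1 / R, hM, by have := pos h; positivity, fun lam hlam x hx => ?_⟩
    rw [norm_sub_rev]
    exact H lam hlam x hx.2

/-! ### Cauchy's formula on polydiscs and analyticity of parameter integrals -/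

open MeasureTheory Metric Set in
/-- The Cauchy integral formula on a polydisc. -/
theorem torusIntegral_prod_sub_inv_mul {n : ℕ} {R : ℝ} (f : (Fin n → ℂ) → ℂ) (c b : Fin n → ℂ)
    (hf : DifferentiableOn ℂ f (closedBall c R)) (hb : b ∈ ball c R) :
    torusIntegral (fun ζ => (∏ i, (ζ i - b i)⁻¹) * f ζ) c (fun _ => R) =
      (2 * Real.pi * Complex.I) ^ n * f b := by
  have hR : 0 < R := pos_of_mem_ball hb
  induction n with
  | zero =>
    simp only [torusIntegral_dim0, Finset.univ_eq_empty, Finset.prod_empty, pow_zero, one_mul]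
    rw [Subsingleton.elim c b]
  | succ n ih =>
    have hbi : ∀ i, b i ∈ ball (c i) R := fun i => (dist_pi_lt_iff hR).1 hb i
    have hmem : ∀ θ : Fin (n + 1) → ℝ, torusMap c (fun _ => R) θ ∈ closedBall c R := by
      intro θ
      refine (dist_pi_le_iff hR.le).2 fun i => ?_
      simp [torusMap, dist_eq_norm, abs_of_pos hR]
    have hne : ∀ (θ : Fin (n + 1) → ℝ) i, torusMap c (fun _ => R) θ i - b i ≠ 0 := by
      intro θ i h
      have h1 := hbi i
      rw [← sub_eq_zero.1 h] at h1
      simp [torusMap, dist_eq_norm, abs_of_pos hR] at h1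
    have hcont : Continuous fun θ : Fin (n + 1) → ℝ => torusMap c (fun _ => R) θ := by
      unfold torusMap; fun_prop
    have hint : TorusIntegrable (fun ζ => (∏ i, (ζ i - b i)⁻¹) * f ζ) c (fun _ => R) := by
      refine ContinuousOn.integrableOn_compact isCompact_Icc (Continuous.continuousOn ?_)
      refine Continuous.mul ?_ (hf.continuousOn.comp_continuous hcont hmem)
      refine continuous_finsetProd _ fun i _ => Continuous.inv₀ ?_ (fun θ => hne θ i)
      exact ((continuous_apply i).comp hcont).sub continuous_const
    rw [torusIntegral_succ hint]
    -- The inner variables are handled by induction for each fixed first coordinate on the circle;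
    -- the one-variable Cauchy formula then treats that coordinate.
    have hin : ∀ x ∈ sphere (c 0) R,
        torusIntegral (fun y => (∏ i, ((Fin.cons x y : Fin (n + 1) → ℂ) i - b i)⁻¹) *
          f (Fin.cons x y)) (c ∘ Fin.succ) ((fun _ => R) ∘ Fin.succ) =
        (x - b 0)⁻¹ • ((2 * Real.pi * Complex.I) ^ n * f (Fin.cons x (b ∘ Fin.succ))) := by
      intro x hx
      have := ih (fun y => f (Fin.cons x y)) (c ∘ Fin.succ) (b ∘ Fin.succ) ?_ ?_
      · rw [← this, smul_eq_mul, ← torusIntegral_const_mul]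
        congr 1
        ext y
        simp only [Fin.prod_univ_succ, Fin.cons_zero, Fin.cons_succ, Function.comp_apply]
        ring
      · refine hf.comp (Differentiable.differentiableOn ?_) ?_
        · refine differentiable_pi.2 fun i => ?_
          refine Fin.cases ?_ (fun j => ?_) i
          · simp
          · simpa using differentiable_apply j
        · intro y hy
          refine (dist_pi_le_iff hR.le).2 fun i => ?_
          refine Fin.cases ?_ (fun j => ?_) i
          · simpa using (mem_sphere.1 hx).le
          · simpa using (dist_pi_le_iff hR.le).1 hy j
      · exact (dist_pi_lt_iff hR).2 fun i => hbi _
    have h2 := circleIntegral.integral_congr hR.le hin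
    refine h2.trans ?_
    have hd : DifferentiableOn ℂ (fun x => (2 * Real.pi * Complex.I) ^ n *
        f (Fin.cons x (b ∘ Fin.succ))) (closedBall (c 0) R) := by
      refine DifferentiableOn.const_mul (hf.comp (Differentiable.differentiableOn ?_) ?_) _
      · refine differentiable_pi.2 fun i => ?_
        refine Fin.cases ?_ (fun j => ?_) i
        · simp
        · simp
      · intro y hy
        refine (dist_pi_le_iff hR.le).2 fun i => ?_
        refine Fin.cases ?_ (fun j => ?_) i
        · simpa using hy
        · simpa using (mem_ball.1 (hbi j.succ)).le
    rw [hd.circleIntegral_sub_inv_smul (hbi 0)]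
    have : (Fin.cons (b 0) (b ∘ Fin.succ) : Fin (n + 1) → ℂ) = b := by
      ext i; refine Fin.cases ?_ (fun j => ?_) i <;> simp
    rw [this, smul_eq_mul]; ring

open BoundedContinuousFunction in
/-- The Cauchy kernel of a polydisc, as a bounded continuous function on the torus depending
analytically on the point of the polydisc. -/
theorem exists_analytic_cauchyKernel {n : ℕ} {R : ℝ} (c : Fin n → ℂ) :
    ∃ k : (Fin n → ℂ) → ((Fin n → ℝ) →ᵇ ℂ), AnalyticOnNhd ℂ k (Metric.ball c R) ∧
      ∀ b ∈ Metric.ball c R, ∀ θ, k b θ = ∏ i, (torusMap c (fun _ => R) θ i - b i)⁻¹ := by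
  let Z : Fin n → ((Fin n → ℝ) →ᵇ ℂ) := fun i =>
    BoundedContinuousFunction.ofNormedAddCommGroup
      (fun θ => torusMap c (fun _ => R) θ i) (by unfold torusMap; fun_prop) (‖c i‖ + |R|) (by
        intro θ
        refine (norm_add_le _ _).trans ?_
        simp)
  let u : Fin n → (Fin n → ℂ) → ((Fin n → ℝ) →ᵇ ℂ) := fun i b =>
    Z i - algebraMap ℂ _ (b i)
  have hu : ∀ i b θ, u i b θ = torusMap c (fun _ => R) θ i - b i := fun i b θ => by
    simp only [u, Z, BoundedContinuousFunction.sub_apply]; rfl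
  have hunit : ∀ i, ∀ b ∈ Metric.ball c R, ∃ v : ((Fin n → ℝ) →ᵇ ℂ)ˣ, (v : _ →ᵇ ℂ) = u i b ∧
      ∀ θ, (↑(v⁻¹) : (Fin n → ℝ) →ᵇ ℂ) θ = (torusMap c (fun _ => R) θ i - b i)⁻¹ := by
    intro i b hb
    have hR : 0 < R := Metric.pos_of_mem_ball hb
    have hbi : ‖b i - c i‖ < R := by
      simpa [dist_eq_norm] using (dist_pi_lt_iff hR).1 hb i
    have hlow : ∀ θ : Fin n → ℝ, R - ‖b i - c i‖ ≤ ‖torusMap c (fun _ => R) θ i - b i‖ := by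
      intro θ
      have h1 : ‖torusMap c (fun _ => R) θ i - c i‖ = R := by
        simp [torusMap, abs_of_pos hR]
      have h2 := norm_sub_norm_le (torusMap c (fun _ => R) θ i - c i) (b i - c i)
      rw [h1] at h2
      simpa using h2
    have hne : ∀ θ : Fin n → ℝ, torusMap c (fun _ => R) θ i - b i ≠ 0 := fun θ h => by
      have := hlow θ
      rw [h, norm_zero] at this
      linarith
    let w : (Fin n → ℝ) →ᵇ ℂ := BoundedContinuousFunction.ofNormedAddCommGroup
      (fun θ => (torusMap c (fun _ => R) θ i - b i)⁻¹)
      (Continuous.inv₀ (by unfold torusMap; fun_prop) hne) ((R - ‖b i - c i‖)⁻¹) (by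
        intro θ
        rw [norm_inv]
        exact inv_anti₀ (by linarith) (hlow θ))
    have hw : ∀ θ, w θ = (torusMap c (fun _ => R) θ i - b i)⁻¹ := fun θ => rfl
    refine ⟨⟨u i b, w, ?_, ?_⟩, rfl, hw⟩
    · ext θ
      rw [BoundedContinuousFunction.mul_apply, hu, hw, mul_inv_cancel₀ (hne θ)]; rfl
    · ext θ
      rw [BoundedContinuousFunction.mul_apply, hu, hw, inv_mul_cancel₀ (hne θ)]; rfl
  -- Bounded continuous functions form a Banach algebra, where inversion is analytic at units. This
  -- gives analyticity of the kernel in the sup norm, uniformly on the torus.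
  refine ⟨fun b => ∏ i, Ring.inverse (u i b), ?_, ?_⟩
  · intro b hb
    refine Finset.analyticAt_fun_prod _ fun i _ => ?_
    obtain ⟨v, hv, -⟩ := hunit i b hb
    have h1 : AnalyticAt ℂ (u i) b := by
      have h2 : AnalyticAt ℂ (fun b : Fin n → ℂ => b i) b :=
        (ContinuousLinearMap.proj (R := ℂ) (φ := fun _ : Fin n => ℂ) i).analyticAt b
      have h3 : AnalyticAt ℂ (fun z : ℂ => algebraMap ℂ ((Fin n → ℝ) →ᵇ ℂ) z) (b i) :=
        (Algebra.linearMap ℂ ((Fin n → ℝ) →ᵇ ℂ)).toContinuousLinearMap.analyticAt _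
      exact analyticAt_const.sub (AnalyticAt.comp (g := fun z : ℂ => algebraMap ℂ ((Fin n → ℝ) →ᵇ ℂ) z) h3 h2)
    refine AnalyticAt.fun_comp ?_ h1
    rw [← hv]
    exact analyticAt_inverse v
  · intro b hb θ
    have : ∀ s : Finset (Fin n), (∏ i ∈ s, Ring.inverse (u i b)) θ =
        ∏ i ∈ s, (torusMap c (fun _ => R) θ i - b i)⁻¹ := by
      intro s
      induction s using Finset.induction_on with
      | empty => simp
      | insert i s his ih =>
        obtain ⟨v, hv, hv2⟩ := hunit i b hb
        rw [Finset.prod_insert his, Finset.prod_insert his, BoundedContinuousFunction.mul_apply,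
          ih, ← hv, Ring.inverse_unit, hv2]
    exact this _

open MeasureTheory Metric Set BoundedContinuousFunction in
/-- Integrals of holomorphic functions of several variables depending on a parameter are analytic. -/
theorem analyticOnNhd_ball_integral {n : ℕ} {R : ℝ} {Y : Type*} [MeasurableSpace Y] (μ : Measure Y)
    [SFinite μ] (f : Y → (Fin n → ℂ) → ℂ) (c : Fin n → ℂ) (g : Y → ℝ)
    (hf : ∀ y, DifferentiableOn ℂ (f y) (closedBall c R))
    (hmeas : AEStronglyMeasurable
      (fun z : Y × (Fin n → ℝ) => f z.1 (torusMap c (fun _ => R) z.2))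
      (μ.prod (volume.restrict (Icc 0 fun _ => 2 * Real.pi))))
    (hg : Integrable g μ) (hfg : ∀ y, ∀ b ∈ closedBall c R, ‖f y b‖ ≤ g y) :
    AnalyticOnNhd ℂ (fun b => ∫ y, f y b ∂μ) (ball c R) := by
  rcases le_or_gt R 0 with hR | hR
  · rw [ball_eq_empty.2 hR]; exact fun x hx => hx.elim
  obtain ⟨k, hk, hkb⟩ := exists_analytic_cauchyKernel (R := R) c
  set ν : Measure (Fin n → ℝ) := volume.restrict (Icc 0 fun _ => 2 * Real.pi) with hν
  have : IsFiniteMeasure ν := ⟨by simp [hν, measure_Icc_lt_top]⟩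
  have hmem : ∀ θ : Fin n → ℝ, torusMap c (fun _ => R) θ ∈ closedBall c R := by
    intro θ
    refine (dist_pi_le_iff hR.le).2 fun i => ?_
    simp [torusMap, dist_eq_norm, abs_of_pos hR]
  let w : (Fin n → ℝ) → ℂ := fun θ => ∏ i, R * Complex.exp (θ i * Complex.I) * Complex.I
  let G : Y × (Fin n → ℝ) → ℂ := fun z => w z.2 * f z.1 (torusMap c (fun _ => R) z.2)
  have hwm : Continuous w := by fun_prop
  have hGm : AEStronglyMeasurable G (μ.prod ν) :=
    (hwm.aestronglyMeasurable.comp_measurable measurable_snd).mul hmeas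
  have hG : Integrable G (μ.prod ν) := by
    refine ((hg.mul_prod (integrable_const (μ := ν) (R ^ n))).mono' hGm ?_)
    refine Filter.Eventually.of_forall fun z => ?_
    have h1 : ‖w z.2‖ = R ^ n := by simp [w, norm_prod, abs_of_pos hR]
    rw [norm_mul, h1, mul_comm]
    exact mul_le_mul_of_nonneg_right (hfg _ _ (hmem _)) (by positivity)
  have hGk : ∀ φ : (Fin n → ℝ) →ᵇ ℂ, Integrable (fun z => G z * φ z.2) (μ.prod ν) := by
    intro φ
    refine hG.mul_bdd (c := ‖φ‖)
      (φ.continuous.aestronglyMeasurable.comp_measurable measurable_snd) ?_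
    exact Filter.Eventually.of_forall fun z => φ.norm_coe_le_norm z.2
  -- The parameter enters only through the Cauchy kernel, and pairing with `G` is a bounded linear
  -- functional of the kernel; analyticity follows by composition.
  let Λ : ((Fin n → ℝ) →ᵇ ℂ) →L[ℂ] ℂ := LinearMap.mkContinuous
    { toFun := fun φ => ∫ z, G z * φ z.2 ∂(μ.prod ν)
      map_add' := fun φ ψ => by
        rw [← integral_add (hGk φ) (hGk ψ)]
        simp [mul_add]
      map_smul' := fun a φ => by
        rw [RingHom.id_apply, smul_eq_mul, ← integral_const_mul]
        congr 1; ext z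
        simp; ring } (∫ z, ‖G z‖ ∂(μ.prod ν)) (by
      intro φ
      simp only [LinearMap.coe_mk, AddHom.coe_mk]
      rw [← integral_mul_const]
      refine norm_integral_le_of_norm_le (hG.norm.mul_const _) (Filter.Eventually.of_forall ?_)
      intro z
      rw [norm_mul]
      exact mul_le_mul_of_nonneg_left (φ.norm_coe_le_norm z.2) (norm_nonneg _))
  have hΛ : ∀ φ, Λ φ = ∫ z, G z * φ z.2 ∂(μ.prod ν) := fun φ => rfl
  have key : ∀ b ∈ ball c R, ((2 * Real.pi * Complex.I) ^ n)⁻¹ * Λ (k b) = ∫ y, f y b ∂μ := by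
    intro b hb
    rw [hΛ, integral_prod _ (hGk _), ← integral_const_mul]
    congr 1
    ext y
    have h1 := torusIntegral_prod_sub_inv_mul (f y) c b (hf y) hb
    rw [inv_mul_eq_iff_eq_mul₀ (by simp [Real.pi_ne_zero]), ← h1, torusIntegral]
    congr 1
    ext θ
    simp only [G, w, hkb b hb, smul_eq_mul]
    ring
  intro b hb
  have h2 : AnalyticAt ℂ (fun b => ((2 * Real.pi * Complex.I) ^ n)⁻¹ * Λ (k b)) b :=
    analyticAt_const.mul ((Λ.analyticAt _).comp (hk b hb))
  refine h2.congr ?_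
  filter_upwards [isOpen_ball.mem_nhds hb] with b' hb' using key b' hb'

/-! ### Iterated derivatives along affine complex vector fields -/

/-- The partial derivative of a complex valued function of several real variables. -/
noncomputable def pd {n : ℕ} (i : Fin n) (φ : (Fin n → ℝ) → ℂ) (x : Fin n → ℝ) : ℂ :=
  fderiv ℝ φ x (Pi.single i 1)

/-- Iterated partial derivatives; the head of the list is the innermost one. -/
noncomputable def iterPd {n : ℕ} : List (Fin n) → ((Fin n → ℝ) → ℂ) → (Fin n → ℝ) → ℂ
  | [], φ => φ
  | i :: σ, φ => iterPd σ (pd i φ)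

/-- The complex vector field `∑ W_i ∂_i`, acting on functions of real variables. -/
noncomputable def vecField {n : ℕ} (W : (Fin n → ℝ) → Fin n → ℂ) (φ : (Fin n → ℝ) → ℂ)
    (x : Fin n → ℝ) : ℂ :=
  ∑ i, W x i * pd i φ x

/-- `W` is an affine complex vector field with linear part `L`. -/
def IsAffineField {n : ℕ} (W : (Fin n → ℝ) → Fin n → ℂ) (L : Fin n → Fin n → ℂ) : Prop :=
  ∃ w : Fin n → ℂ, ∀ x i, W x i = w i + ∑ l, (x l : ℂ) * L l i

open scoped ContDiff

section SmoothFunctions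

variable {n : ℕ} {φ ψ : (Fin n → ℝ) → ℂ} {W : (Fin n → ℝ) → Fin n → ℂ} {L : Fin n → Fin n → ℂ}

theorem ContDiff.pd (hφ : ContDiff ℝ ∞ φ) (i : Fin n) : ContDiff ℝ ∞ (pd i φ) := by
  have h : ContDiff ℝ ∞ (fderiv ℝ φ) := hφ.fderiv_right (by simp)
  exact h.clm_apply contDiff_const

theorem IsAffineField.contDiff (hW : IsAffineField W L) (i : Fin n) : ContDiff ℝ ∞ fun x => W x i := by
  obtain ⟨w, hw⟩ := hW
  simp only [hw]
  refine contDiff_const.add (ContDiff.sum fun l _ => ContDiff.mul ?_ contDiff_const)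
  exact Complex.ofRealCLM.contDiff.comp (contDiff_apply ℝ ℝ l)

theorem IsAffineField.pd (hW : IsAffineField W L) (i l : Fin n) (x : Fin n → ℝ) :
    pd l (fun x => W x i) x = L l i := by
  obtain ⟨w, hw⟩ := hW
  simp only [hw]
  have h : HasFDerivAt (fun x : Fin n → ℝ => w i + ∑ l, (x l : ℂ) * L l i)
      (∑ l, (L l i • Complex.ofRealCLM.comp (ContinuousLinearMap.proj (R := ℝ) (φ := fun _ : Fin n => ℝ) l))) x := by
    refine HasFDerivAt.const_add _ (HasFDerivAt.fun_sum fun l _ => ?_)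
    exact (Complex.ofRealCLM.hasFDerivAt.comp x (hasFDerivAt_apply l x)).mul_const (L l i)
  unfold _root_.pd
  rw [h.fderiv]
  simp only [sum_apply, smul_apply, ContinuousLinearMap.comp_apply,
    ContinuousLinearMap.proj_apply, Complex.ofRealCLM_apply, smul_eq_mul]
  rw [Finset.sum_eq_single l (fun j _ hj => by simp [hj]) (by simp)]
  simp

theorem contDiff_vecField (hW : IsAffineField W L) (hφ : ContDiff ℝ ∞ φ) : ContDiff ℝ ∞ (vecField W φ) :=
  ContDiff.sum fun i _ => (hW.contDiff i).mul (hφ.pd i)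

theorem contDiff_iterate_vecField (hW : IsAffineField W L) (hφ : ContDiff ℝ ∞ φ) (k : ℕ) :
    ContDiff ℝ ∞ ((vecField W)^[k] φ) := by
  induction k with
  | zero => exact hφ
  | succ k ih => rw [Function.iterate_succ_apply']; exact contDiff_vecField hW ih

theorem tsupport_pd_subset (i : Fin n) (φ : (Fin n → ℝ) → ℂ) : tsupport (pd i φ) ⊆ tsupport φ := by
  refine (closure_mono ?_).trans (tsupport_fderiv_subset ℝ (f := φ))
  intro x hx h
  exact hx (by simp [pd, h])

theorem tsupport_vecField_subset (W : (Fin n → ℝ) → Fin n → ℂ) (φ : (Fin n → ℝ) → ℂ) :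
    tsupport (vecField W φ) ⊆ tsupport φ := by
  refine closure_minimal (fun x hx => ?_) (isClosed_tsupport φ)
  by_contra h
  refine hx (Finset.sum_eq_zero fun i _ => ?_)
  rw [image_eq_zero_of_notMem_tsupport (f := pd i φ) (fun h' => h (tsupport_pd_subset i φ h')), mul_zero]

theorem tsupport_iterate_vecField_subset (W : (Fin n → ℝ) → Fin n → ℂ) (φ : (Fin n → ℝ) → ℂ) (k : ℕ) :
    tsupport ((vecField W)^[k] φ) ⊆ tsupport φ := by
  induction k with
  | zero => exact subset_rfl
  | succ k ih =>
    rw [Function.iterate_succ_apply']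
    exact (tsupport_vecField_subset W _).trans ih

theorem pd_comm (hφ : ContDiff ℝ ∞ φ) (i l : Fin n) : pd l (pd i φ) = pd i (pd l φ) := by
  ext x
  have h : ContDiff ℝ ∞ (fderiv ℝ φ) := hφ.fderiv_right (by simp)
  have hd : DifferentiableAt ℝ (fderiv ℝ φ) x := h.differentiable (by simp) x
  have h1 : ∀ i l : Fin n, pd l (pd i φ) x =
      fderiv ℝ (fderiv ℝ φ) x (Pi.single l 1) (Pi.single i 1) := by
    intro i l
    have := hd.hasFDerivAt.clm_apply (hasFDerivAt_const (Pi.single i (1 : ℝ)) x)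
    unfold pd
    rw [this.fderiv]
    simp
  rw [h1, h1]
  exact (hφ.contDiffAt.isSymmSndFDerivAt
    (by simpa using WithTop.coe_le_coe.2 (le_top (a := (2 : ℕ∞))))).eq _ _

theorem pd_add (hφ : ContDiff ℝ ∞ φ) (hψ : ContDiff ℝ ∞ ψ) (i : Fin n) :
    pd i (fun x => φ x + ψ x) = fun x => pd i φ x + pd i ψ x := by
  ext x
  unfold pd
  rw [fderiv_fun_add (hφ.differentiable (by simp) x) (hψ.differentiable (by simp) x)]
  simp

theorem pd_mul (hφ : ContDiff ℝ ∞ φ) (hψ : ContDiff ℝ ∞ ψ) (i : Fin n) :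
    pd i (fun x => φ x * ψ x) = fun x => pd i φ x * ψ x + φ x * pd i ψ x := by
  ext x
  unfold pd
  rw [fderiv_fun_mul (hφ.differentiable (by simp) x) (hψ.differentiable (by simp) x)]
  simp; ring

theorem pd_sum {ι : Type*} (s : Finset ι) {f : ι → (Fin n → ℝ) → ℂ} (hf : ∀ j, ContDiff ℝ ∞ (f j))
    (i : Fin n) : pd i (fun x => ∑ j ∈ s, f j x) = fun x => ∑ j ∈ s, pd i (f j) x := by
  ext x
  unfold pd
  rw [fderiv_fun_sum fun j _ => (hf j).differentiable (by simp) x]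
  simp

theorem pd_const_mul (hφ : ContDiff ℝ ∞ φ) (a : ℂ) (i : Fin n) :
    pd i (fun x => a * φ x) = fun x => a * pd i φ x := by
  ext x
  unfold pd
  rw [fderiv_const_mul (hφ.differentiable (by simp) x)]
  simp

/-- Since `W` has affine coefficients, its commutator with `∂_l` is a field with constant
coefficients, so differentiating powers of `W` produces no higher derivatives of the coefficients.
-/
theorem pd_vecField (hW : IsAffineField W L) (hφ : ContDiff ℝ ∞ φ) (l : Fin n) :
    pd l (vecField W φ) = fun x => vecField W (pd l φ) x + ∑ i, L l i * pd i φ x := by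
  unfold vecField
  rw [pd_sum Finset.univ (fun i => (hW.contDiff i).mul (hφ.pd i)) l]
  ext x
  rw [← Finset.sum_add_distrib]
  refine Finset.sum_congr rfl fun i _ => ?_
  rw [pd_mul (hW.contDiff i) (hφ.pd i) l]
  simp only [hW.pd]
  rw [pd_comm hφ i l]
  ring

theorem iterPd_add (hφ : ContDiff ℝ ∞ φ) (hψ : ContDiff ℝ ∞ ψ) (σ : List (Fin n)) :
    iterPd σ (fun x => φ x + ψ x) = fun x => iterPd σ φ x + iterPd σ ψ x := by
  induction σ generalizing φ ψ with
  | nil => rfl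
  | cons i σ ih => simp only [iterPd]; rw [pd_add hφ hψ]; exact ih (hφ.pd i) (hψ.pd i)

theorem iterPd_const_mul (hφ : ContDiff ℝ ∞ φ) (a : ℂ) (σ : List (Fin n)) :
    iterPd σ (fun x => a * φ x) = fun x => a * iterPd σ φ x := by
  induction σ generalizing φ with
  | nil => rfl
  | cons i σ ih => simp only [iterPd]; rw [pd_const_mul hφ]; exact ih (hφ.pd i)

theorem iterPd_sum {ι : Type*} (s : Finset ι) {f : ι → (Fin n → ℝ) → ℂ} (hf : ∀ j, ContDiff ℝ ∞ (f j))
    (σ : List (Fin n)) :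
    iterPd σ (fun x => ∑ j ∈ s, f j x) = fun x => ∑ j ∈ s, iterPd σ (f j) x := by
  induction σ generalizing f with
  | nil => rfl
  | cons i σ ih => simp only [iterPd]; rw [pd_sum s hf]; exact ih fun j => (hf j).pd i

theorem iterPd_append_singleton (φ : (Fin n → ℝ) → ℂ) (σ : List (Fin n)) (i : Fin n) :
    iterPd (σ ++ [i]) φ = pd i (iterPd σ φ) := by
  induction σ generalizing φ with
  | nil => rfl
  | cons l σ ih => simp only [List.cons_append, iterPd]; exact ih _

/-- Iterated partial derivatives of a real function, in terms of `partialDeriv`. -/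
theorem exists_iterPd_ofReal_eq {χ : (Fin n → ℝ) → ℝ} (hχ : ContDiff ℝ ∞ χ) (σ : List (Fin n)) :
    ∃ τ : Fin σ.length → Fin n, iterPd σ (fun x => (χ x : ℂ)) = fun x => (partialDeriv τ χ x : ℂ) := by
  induction σ using List.reverseRecOn with
  | nil => exact ⟨fun i => i.elim0, by ext x; simp [iterPd, partialDeriv]⟩
  | append_singleton σ i ih =>
    obtain ⟨τ, hτ⟩ := ih
    rw [iterPd_append_singleton, hτ]
    -- The length of `σ ++ [i]` is only propositionally `σ.length + 1`, hence the generalization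
    -- over `m`.
    have key : ∀ m (h : m = σ.length + 1), ∃ τ' : Fin m → Fin n,
        pd i (fun x => (partialDeriv τ χ x : ℂ)) = fun x => (partialDeriv τ' χ x : ℂ) := by
      rintro m rfl
      refine ⟨Fin.cons i τ, ?_⟩
      ext x
      have hd : DifferentiableAt ℝ (iteratedFDeriv ℝ σ.length χ) x :=
        hχ.differentiable_iteratedFDeriv (by exact_mod_cast WithTop.coe_lt_top _) x
      have h1 := hd.hasFDerivAt
      have h2 := (ContinuousMultilinearMap.apply ℝ (fun _ : Fin σ.length => Fin n → ℝ) ℝ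
        (fun j => Pi.single (τ j) (1 : ℝ))).hasFDerivAt.comp x h1
      have h3 := Complex.ofRealCLM.hasFDerivAt.comp x h2
      have h4 : fderiv ℝ (fun x => (partialDeriv τ χ x : ℂ)) x = _ := h3.fderiv
      unfold pd
      rw [h4]
      simp only [partialDeriv, iteratedFDeriv_succ_apply_left]
      simp only [ContinuousLinearMap.comp_apply, Complex.ofRealCLM_apply, Fin.cons_zero]
      rfl
    exact key _ (by simp)

/-- One application of an affine vector field, at the level of bounds for all derivatives. -/
theorem norm_iterPd_vecField_le (hW : IsAffineField W L) {x : Fin n → ℝ} {a ℓ : ℝ}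
    (ha : ∑ i, ‖W x i‖ ≤ a) (hℓ : ∀ l, ∑ i, ‖L l i‖ ≤ ℓ) (m : ℕ) (c : ℕ → ℝ) (hc : ∀ k, 0 ≤ c k)
    (hφ : ContDiff ℝ ∞ φ)
    (h : ∀ σ : List (Fin n), σ.length ≤ m + 1 → ‖iterPd σ φ x‖ ≤ c σ.length)
    (σ : List (Fin n)) (hσ : σ.length = m) :
    ‖iterPd σ (vecField W φ) x‖ ≤ a * c (m + 1) + m * ℓ * c m := by
  induction m generalizing φ c σ with
  | zero =>
    rw [List.length_eq_zero_iff] at hσ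
    subst hσ
    simp only [iterPd, vecField]
    calc ‖∑ i, W x i * pd i φ x‖ ≤ ∑ i, ‖W x i‖ * c 1 := by
          refine norm_sum_le_of_le _ fun i _ => ?_
          rw [norm_mul]
          exact mul_le_mul_of_nonneg_left (h [i] (by simp)) (norm_nonneg _)
      _ = (∑ i, ‖W x i‖) * c 1 := by rw [Finset.sum_mul]
      _ ≤ _ := by
        simp only [Nat.cast_zero, zero_mul, add_zero, zero_add]
        exact mul_le_mul_of_nonneg_right ha (hc 1)
  | succ m ih =>
    obtain ⟨l, σ, rfl⟩ := List.exists_cons_of_length_eq_add_one hσ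
    have hσ' : σ.length = m := by simpa using hσ
    simp only [iterPd]
    rw [pd_vecField hW hφ, iterPd_add (contDiff_vecField hW (hφ.pd l))
      (ContDiff.sum fun i _ => contDiff_const.mul (hφ.pd i)),
      iterPd_sum Finset.univ (fun i => contDiff_const.mul (hφ.pd i))]
    -- The induction hypothesis is applied to `pd l φ`, whose bounds are those of `φ` shifted by
    -- one; each derivative moved past `W` adds one commutator of size `ℓ`.
    have h1 := ih (fun k => c (k + 1)) (fun k => hc _) (hφ.pd l)
      (fun σ hσ => h (l :: σ) (by simpa using hσ)) σ hσ'
    have h2 : ‖∑ i, iterPd σ (fun x => L l i * pd i φ x) x‖ ≤ ℓ * c (m + 1) := by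
      calc _ ≤ ∑ i, ‖L l i‖ * c (m + 1) := by
            refine norm_sum_le_of_le _ fun i _ => ?_
            rw [iterPd_const_mul (hφ.pd i), norm_mul]
            refine mul_le_mul_of_nonneg_left ?_ (norm_nonneg _)
            simpa [hσ', iterPd] using h (i :: σ) (by simp [hσ'])
        _ ≤ _ := by rw [← Finset.sum_mul]; exact mul_le_mul_of_nonneg_right (hℓ l) (hc _)
    refine (norm_add_le _ _).trans ((add_le_add h1 h2).trans (le_of_eq ?_))
    push_cast; ring

/-- Powers of an affine vector field applied to a function with Ehrenpreis type bounds. -/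
theorem norm_iterPd_iterate_vecField_le (hW : IsAffineField W L) {x : Fin n → ℝ} {a ℓ B : ℝ} {j : ℕ}
    (ha : ∑ i, ‖W x i‖ ≤ a) (hℓ : ∀ l, ∑ i, ‖L l i‖ ≤ ℓ) (hℓ0 : 0 ≤ ℓ) (hB : 0 ≤ B) (hφ : ContDiff ℝ ∞ φ)
    (h : ∀ σ : List (Fin n), σ.length ≤ j → ‖iterPd σ φ x‖ ≤ B ^ σ.length) (k : ℕ)
    (σ : List (Fin n)) (hσ : σ.length + k ≤ j) :
    ‖iterPd σ ((vecField W)^[k] φ) x‖ ≤ B ^ σ.length * (a * B + j * ℓ) ^ k := by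
  have ha0 : 0 ≤ a := (Finset.sum_nonneg fun _ _ => norm_nonneg _).trans ha
  induction k generalizing σ with
  | zero => simpa using h σ (by omega)
  | succ k ih =>
    rw [Function.iterate_succ_apply']
    have hm : (σ.length : ℝ) ≤ j := by exact_mod_cast (by omega : σ.length ≤ j)
    -- Each factor `W` costs one further derivative, giving `a * B`, and at most `j` commutators,
    -- giving `j * ℓ`.
    refine (norm_iterPd_vecField_le hW ha hℓ σ.length
      (fun m => B ^ m * (a * B + j * ℓ) ^ k) (fun m => by positivity) (contDiff_iterate_vecField hW hφ k)
      (fun τ hτ => ih τ (by omega)) σ rfl).trans ?_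
    have h1 : (σ.length : ℝ) * ℓ * (B ^ σ.length * (a * B + j * ℓ) ^ k) ≤
        j * ℓ * (B ^ σ.length * (a * B + j * ℓ) ^ k) := by gcongr
    refine (add_le_add le_rfl h1).trans (le_of_eq ?_)
    ring

end SmoothFunctions

/-! ### Derivative of an integral along a complex deformation -/

section Flow

open MeasureTheory Set Metric

variable {n : ℕ} {φ : (Fin n → ℝ) → ℂ} {W : (Fin n → ℝ) → Fin n → ℂ} {L : Fin n → Fin n → ℂ}

/-- `P` is constant along the complexified flow of the vector field `∂_s - W`. -/
def IsTransported {n : ℕ} (W : (Fin n → ℝ) → Fin n → ℂ) (V : Set (ℝ × (Fin n → ℝ)))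
    (G : ℝ × (Fin n → ℝ) → ℂ) : Prop :=
  ∀ p ∈ V, fderiv ℝ G p (1, 0) = ∑ i, W p.2 i * fderiv ℝ G p (0, Pi.single i 1)

/-- Integration by parts: the transpose of `W` is `-W - div W`, and the divergence of an affine
field is the constant trace of `L`. -/
theorem integral_sum_field_mul_eq (hW : IsAffineField W L) (hφ : ContDiff ℝ ∞ φ)
    (hφc : HasCompactSupport φ) {U : Set (Fin n → ℝ)} (hU : IsOpen U) (hφU : tsupport φ ⊆ U)
    {P : (Fin n → ℝ) → ℂ} (hP : ContDiffOn ℝ 1 P U) :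
    ∫ x, (∑ i, W x i * fderiv ℝ P x (Pi.single i 1)) * φ x =
      -∫ x, P x * (vecField W φ x + (∑ i, L i i) * φ x) := by
  have hc : ∀ i, ContDiff ℝ ∞ fun x => W x i * φ x := fun i => (hW.contDiff i).mul hφ
  have hs : ∀ i, tsupport (fun x => W x i * φ x) ⊆ tsupport φ := fun i => tsupport_mul_subset_right
  have hcont : ∀ {u v : (Fin n → ℝ) → ℂ}, ContinuousOn u U → Continuous v → tsupport v ⊆ tsupport φ →
      Integrable fun x => u x * v x := by
    intro u v hu hv hvs
    have h1 : tsupport (fun x => u x * v x) ⊆ tsupport φ := (tsupport_mul_subset_right).trans hvs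
    refine Continuous.integrable_of_hasCompactSupport ?_ (hφc.of_isClosed_subset (isClosed_tsupport _) h1)
    refine ContinuousOn.continuous_of_tsupport_subset (hu.mul hv.continuousOn) hU (h1.trans hφU)
  have hP' : ∀ i : Fin n, ContinuousOn (fun x => fderiv ℝ P x (Pi.single i 1)) U := fun i =>
    (hP.continuousOn_fderiv_of_isOpen hU (by simp)).clm_apply continuousOn_const
  have hpd : ∀ i, tsupport (pd i (fun x => W x i * φ x)) ⊆ tsupport φ := fun i =>
    (tsupport_pd_subset i _).trans (hs i)
  have key : ∀ i, ∫ x, P x * pd i (fun x => W x i * φ x) x =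
      -∫ x, fderiv ℝ P x (Pi.single i 1) * (W x i * φ x) := by
    intro i
    refine integral_mul_fderiv_eq_neg_fderiv_mul_of_integrable ?_ ?_ ?_ ?_ ?_
    · exact hcont (hP' i) (hc i).continuous (hs i)
    · exact hcont hP.continuousOn ((hc i).pd i).continuous (hpd i)
    · exact hcont hP.continuousOn (hc i).continuous (hs i)
    · intro x hx
      exact (hP.differentiableOn (by simp)).differentiableAt (hU.mem_nhds (hφU (hs i hx)))
    · intro x _
      exact (hc i).differentiable (by simp) x
  calc ∫ x, (∑ i, W x i * fderiv ℝ P x (Pi.single i 1)) * φ x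
      = ∑ i, ∫ x, fderiv ℝ P x (Pi.single i 1) * (W x i * φ x) := by
        rw [← integral_finsetSum _ fun i _ => hcont (hP' i) (hc i).continuous (hs i)]
        congr 1; ext x
        rw [Finset.sum_mul]
        exact Finset.sum_congr rfl fun i _ => by ring
    _ = -∑ i, ∫ x, P x * pd i (fun x => W x i * φ x) x := by
        simp only [key, Finset.sum_neg_distrib, neg_neg]
    _ = _ := by
        rw [← integral_finsetSum _ fun i _ => hcont hP.continuousOn ((hc i).pd i).continuous (hpd i)]
        congr 2; ext x
        rw [← Finset.mul_sum, Finset.sum_mul]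
        unfold vecField
        rw [← Finset.sum_add_distrib]
        congr 1
        refine Finset.sum_congr rfl fun i _ => ?_
        rw [pd_mul (hW.contDiff i) hφ]
        simp only [hW.pd]
        ring

/-- Compactness of the support of `φ` supplies a whole tube of parameters around `s₀` on which `G`
is defined and its derivative bounded, so differentiation under the integral is justified although
`V` need not be a product. -/
theorem hasDerivAt_integral_of_contDiffOn (hφ : ContDiff ℝ ∞ φ)
    (hφc : HasCompactSupport φ) {V : Set (ℝ × (Fin n → ℝ))} (hV : IsOpen V)
    {G : ℝ × (Fin n → ℝ) → ℂ} (hG : ContDiffOn ℝ 1 G V) {s₀ : ℝ}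
    (hs₀ : ∀ x ∈ tsupport φ, (s₀, x) ∈ V) :
    HasDerivAt (fun s => ∫ x, G (s, x) * φ x) (∫ x, fderiv ℝ G (s₀, x) (1, 0) * φ x) s₀ := by
  obtain ⟨u, v, hu, hv, hsu, htv, huv⟩ := generalized_tube_lemma (isCompact_singleton (x := s₀))
    hφc.isCompact hV (by rintro ⟨s, x⟩ ⟨hs, hx⟩; obtain rfl : s = s₀ := hs; exact hs₀ x hx)
  obtain ⟨ε, hε, hεu⟩ := nhds_basis_closedBall.mem_iff.1 (hu.mem_nhds (hsu rfl))
  have hmem : ∀ s ∈ closedBall s₀ ε, ∀ x ∈ v, (s, x) ∈ V := fun s hs x hx => huv ⟨hεu hs, hx⟩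
  have hcont : ∀ {H : ℝ × (Fin n → ℝ) → ℂ}, ContinuousOn H V → ∀ s ∈ closedBall s₀ ε,
      Continuous fun x => H (s, x) * φ x := by
    intro H hH s hs
    refine ContinuousOn.continuous_of_tsupport_subset (s := v) ?_ hv
      ((tsupport_mul_subset_right).trans htv)
    exact (hH.comp (by fun_prop) (fun x hx => hmem s hs x hx)).mul hφ.continuous.continuousOn
  have hcs : ∀ (H : ℝ × (Fin n → ℝ) → ℂ) s, HasCompactSupport fun x => H (s, x) * φ x :=
    fun H s => hφc.of_isClosed_subset (isClosed_tsupport _) tsupport_mul_subset_right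
  have hG' : ContinuousOn (fun p => fderiv ℝ G p (1, 0)) V :=
    (hG.continuousOn_fderiv_of_isOpen hV (by simp)).clm_apply continuousOn_const
  have hs₀m : s₀ ∈ closedBall s₀ ε := mem_closedBall_self hε.le
  have hK : IsCompact (closedBall s₀ ε ×ˢ tsupport φ) :=
    (isCompact_closedBall s₀ ε).prod hφc.isCompact
  have hKV : closedBall s₀ ε ×ˢ tsupport φ ⊆ V := fun p hp => hmem p.1 hp.1 p.2 (htv hp.2)
  obtain ⟨D, hD⟩ := hK.exists_bound_of_continuousOn
    ((hG'.mono hKV).mul (hφ.continuous.comp continuous_snd).continuousOn)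
  refine (hasDerivAt_integral_of_dominated_loc_of_deriv_le (s := closedBall s₀ ε)
    (bound := (tsupport φ).indicator fun _ => D) (F' := fun s x => fderiv ℝ G (s, x) (1, 0) * φ x)
    (closedBall_mem_nhds s₀ hε) ?_ ?_ ?_ ?_ ?_ ?_).2
  · filter_upwards [closedBall_mem_nhds s₀ hε] with s hs
    exact (hcont hG.continuousOn s hs).aestronglyMeasurable
  · exact (hcont hG.continuousOn s₀ hs₀m).integrable_of_hasCompactSupport (hcs G s₀)
  · exact (hcont hG' s₀ hs₀m).aestronglyMeasurable
  · refine Eventually.of_forall fun x s hs => ?_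
    by_cases hx : x ∈ tsupport φ
    · rw [indicator_of_mem hx]
      exact hD (s, x) ⟨hs, hx⟩
    · rw [indicator_of_notMem hx, image_eq_zero_of_notMem_tsupport hx]
      simp
  · exact (integrable_indicator_iff (isClosed_tsupport φ).measurableSet).2
      (integrableOn_const hφc.isCompact.measure_lt_top.ne)
  · refine Eventually.of_forall fun x s hs => ?_
    by_cases hx : x ∈ tsupport φ
    · have h1 : HasFDerivAt G (fderiv ℝ G (s, x)) (s, x) :=
        ((hG.differentiableOn (by simp)).differentiableAt
          (hV.mem_nhds (hmem s hs x (htv hx)))).hasFDerivAt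
      have h2 : HasDerivAt (fun s : ℝ => (s, x)) ((1 : ℝ), (0 : Fin n → ℝ)) s :=
        (hasDerivAt_id s).prodMk (hasDerivAt_const s x)
      exact (h1.comp_hasDerivAt s h2).mul_const _
    · rw [image_eq_zero_of_notMem_tsupport hx]
      simpa using hasDerivAt_const s (0 : ℂ)

/-- The derivative of an oscillatory integral along a complex deformation of the contour. -/
theorem hasDerivAt_exp_mul_integral (hW : IsAffineField W L) (hφ : ContDiff ℝ ∞ φ)
    (hφc : HasCompactSupport φ) {V : Set (ℝ × (Fin n → ℝ))} (hV : IsOpen V)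
    {G : ℝ × (Fin n → ℝ) → ℂ} (hG : ContDiffOn ℝ 1 G V) (hGW : IsTransported W V G) {s₀ : ℝ}
    (hs₀ : ∀ x ∈ tsupport φ, (s₀, x) ∈ V) :
    HasDerivAt (fun s : ℝ => Complex.exp (s * ∑ i, L i i) * ∫ x, G (s, x) * φ x)
      (-(Complex.exp (s₀ * ∑ i, L i i) * ∫ x, G (s₀, x) * vecField W φ x)) s₀ := by
  set t := ∑ i, L i i with ht
  have h1 := hasDerivAt_integral_of_contDiffOn hφ hφc hV hG hs₀
  -- The exponential is the Jacobian of the deformation; its derivative cancels the divergence term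
  -- from the integration by parts.
  have h2 : HasDerivAt (fun s : ℝ => Complex.exp (s * t)) (Complex.exp (s₀ * t) * t) s₀ := by
    have h3 : HasDerivAt (fun s : ℝ => (s : ℂ) * t) t s₀ := by
      simpa using (Complex.ofRealCLM.hasDerivAt (x := s₀)).mul_const t
    exact h3.cexp
  refine (h2.mul h1).congr_deriv ?_
  have hU : IsOpen {x | (s₀, x) ∈ V} := hV.preimage (by fun_prop)
  have hP : ContDiffOn ℝ 1 (fun x => G (s₀, x)) {x | (s₀, x) ∈ V} :=
    hG.comp (by fun_prop) (fun x hx => hx)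
  have h4 := integral_sum_field_mul_eq hW hφ hφc hU hs₀ hP
  have h5 : ∫ x, fderiv ℝ G (s₀, x) (1, 0) * φ x =
      ∫ x, (∑ i, W x i * fderiv ℝ (fun x => G (s₀, x)) x (Pi.single i 1)) * φ x := by
    congr 1; ext x
    by_cases hx : x ∈ tsupport φ
    · have hg : HasFDerivAt G (fderiv ℝ G (s₀, x)) (s₀, x) :=
        ((hG.differentiableOn (by simp)).differentiableAt (hV.mem_nhds (hs₀ x hx))).hasFDerivAt
      have h6 : HasFDerivAt (fun x => G (s₀, x)) _ x := hg.comp x (hasFDerivAt_prodMk_right s₀ x)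
      rw [h6.fderiv, hGW _ (hs₀ x hx)]
      simp
    · rw [image_eq_zero_of_notMem_tsupport hx]; simp
  have hint : ∀ {v : (Fin n → ℝ) → ℂ}, Continuous v → tsupport v ⊆ tsupport φ →
      Integrable fun x => G (s₀, x) * v x := by
    intro v hv hvs
    have h1 : tsupport (fun x => G (s₀, x) * v x) ⊆ tsupport φ := (tsupport_mul_subset_right).trans hvs
    refine Continuous.integrable_of_hasCompactSupport ?_ (hφc.of_isClosed_subset (isClosed_tsupport _) h1)
    exact ContinuousOn.continuous_of_tsupport_subset (hP.continuousOn.mul hv.continuousOn) hU (h1.trans hs₀)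
  rw [h5, h4, ← ht]
  have h7 : ∫ x, G (s₀, x) * (vecField W φ x + t * φ x) =
      (∫ x, G (s₀, x) * vecField W φ x) + t * ∫ x, G (s₀, x) * φ x := by
    rw [← integral_const_mul, ← integral_add (hint (contDiff_vecField hW hφ).continuous
      (tsupport_vecField_subset W φ)) ((hint hφ.continuous subset_rfl).const_mul t)]
    congr 1; ext x; ring
  rw [h7]; ring

end Flow

/-! ### Transport of Ehrenpreis cut-offs -/

section FlowBounds

open MeasureTheory Set Metric

variable {n : ℕ} {φ : (Fin n → ℝ) → ℂ} {W : (Fin n → ℝ) → Fin n → ℂ} {L : Fin n → Fin n → ℂ}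

theorem norm_integral_le_of_norm_le_const_of_eq_zero {X : Type*} [MeasurableSpace X] {μ : Measure X}
    {A : Set X} (hA : μ A < ⊤) {f : X → ℂ} {c : ℝ} (h : ∀ x ∈ A, ‖f x‖ ≤ c)
    (h0 : ∀ x ∉ A, f x = 0) : ‖∫ x, f x ∂μ‖ ≤ c * μ.real A := by
  rw [← setIntegral_eq_integral_of_forall_compl_eq_zero h0]
  exact norm_setIntegral_le_of_norm_le_const hA h

/-- Comparison of two contours joined by a complex deformation. -/
theorem norm_exp_mul_integral_sub_le (hW : IsAffineField W L) (hφ : ContDiff ℝ ∞ φ)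
    (hφc : HasCompactSupport φ) {V : Set (ℝ × (Fin n → ℝ))} (hV : IsOpen V)
    {G : ℝ × (Fin n → ℝ) → ℂ} (hG : ContDiffOn ℝ 1 G V) (hGW : IsTransported W V G) {s₀ s₁ D : ℝ}
    (hs : s₀ ≤ s₁) (hmem : ∀ s ∈ Icc s₀ s₁, ∀ x ∈ tsupport φ, (s, x) ∈ V)
    (hD : ∀ s ∈ Icc s₀ s₁, ‖Complex.exp (s * ∑ i, L i i) * ∫ x, G (s, x) * vecField W φ x‖ ≤ D) :
    ‖Complex.exp (s₁ * ∑ i, L i i) * (∫ x, G (s₁, x) * φ x) -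
      Complex.exp (s₀ * ∑ i, L i i) * ∫ x, G (s₀, x) * φ x‖ ≤ D * (s₁ - s₀) := by
  refine norm_image_sub_le_of_norm_deriv_le_segment' (f := fun s : ℝ =>
    Complex.exp (s * ∑ i, L i i) * ∫ x, G (s, x) * φ x) (f' := fun s : ℝ =>
    -(Complex.exp (s * ∑ i, L i i) * ∫ x, G (s, x) * vecField W φ x))
    (fun s hs => ?_) (fun s hs => ?_) s₁ (right_mem_Icc.2 hs)
  · exact (hasDerivAt_exp_mul_integral hW hφ hφc hV hG hGW (hmem s hs)).hasDerivWithinAt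
  · rw [norm_neg]; exact hD s (Ico_subset_Icc_self hs)

/-- The Taylor polynomial in `s` of the cut-off function transported by the field `W`. -/
noncomputable def transportedCutoff (W : (Fin n → ℝ) → Fin n → ℂ) (φ : (Fin n → ℝ) → ℂ) (j : ℕ)
    (s : ℝ) (x : Fin n → ℝ) : ℂ :=
  ∑ k ∈ Finset.range j, ((s : ℂ) ^ k / k.factorial) * (vecField W)^[k] φ x

/-- With `F k` the weighted integral against `W^k φ`, one has `F k' = -F (k+1)`. Hence the
derivative of `∑ s^k/k! F k` telescopes to the single term `-s^m/m! F (m+1)`, and the mean value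
inequality applies. -/
theorem norm_exp_mul_integral_transportedCutoff_sub_le (hW : IsAffineField W L)
    (hφ : ContDiff ℝ ∞ φ) (hφc : HasCompactSupport φ) {V : Set (ℝ × (Fin n → ℝ))} (hV : IsOpen V)
    {G : ℝ × (Fin n → ℝ) → ℂ} (hG : ContDiffOn ℝ 1 G V) (hGW : IsTransported W V G) {s₁ D : ℝ}
    (hs₁ : 0 ≤ s₁) (hmem : ∀ s ∈ Icc 0 s₁, ∀ x ∈ tsupport φ, (s, x) ∈ V) (m : ℕ)
    (hD : ∀ s ∈ Icc 0 s₁,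
      ‖Complex.exp (s * ∑ i, L i i) * ∫ x, G (s, x) * (vecField W)^[m + 1] φ x‖ ≤ D) :
    ‖Complex.exp (s₁ * ∑ i, L i i) * (∫ x, G (s₁, x) * transportedCutoff W φ (m + 1) s₁ x) -
      ∫ x, G (0, x) * φ x‖ ≤ s₁ ^ m / m.factorial * D * s₁ := by
  set F : ℕ → ℝ → ℂ := fun k s =>
    Complex.exp (s * ∑ i, L i i) * ∫ x, G (s, x) * (vecField W)^[k] φ x with hF
  have hsupp := tsupport_iterate_vecField_subset W φ
  have hFd : ∀ k, ∀ s ∈ Icc 0 s₁, HasDerivAt (F k) (-(F (k + 1) s)) s := by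
    intro k s hs
    have := hasDerivAt_exp_mul_integral hW (contDiff_iterate_vecField hW hφ k)
      (hφc.of_isClosed_subset (isClosed_tsupport _) (hsupp k)) hV hG hGW
      (fun x hx => hmem s hs x (hsupp k hx))
    simp only [hF, Function.iterate_succ_apply']
    exact this
  have hUd : ∀ (N : ℕ), ∀ s ∈ Icc 0 s₁, HasDerivAt
      (fun s : ℝ => ∑ k ∈ Finset.range (N + 1), ((s : ℂ) ^ k / k.factorial) * F k s)
      (-(((s : ℂ) ^ N / N.factorial) * F (N + 1) s)) s := by
    intro N s hs
    induction N with
    | zero => simpa using hFd 0 s hs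
    | succ N ih =>
      simp_rw [Finset.sum_range_succ _ (N + 1)]
      have h1 : HasDerivAt (fun s : ℝ => (s : ℂ) ^ (N + 1) / (N + 1).factorial)
          ((s : ℂ) ^ N / N.factorial) s := by
        have h2 : HasDerivAt (fun s : ℝ => (s : ℂ)) 1 s := Complex.ofRealCLM.hasDerivAt
        refine ((h2.fun_pow (N + 1)).div_const _).congr_deriv ?_
        rw [Nat.factorial_succ]
        have h3 : ((N.factorial : ℕ) : ℂ) ≠ 0 := by exact_mod_cast N.factorial_ne_zero
        have h4 : ((N : ℂ) + 1) ≠ 0 := by exact_mod_cast N.succ_ne_zero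
        push_cast
        field_simp
      refine (ih.add (h1.mul (hFd (N + 1) s hs))).congr_deriv ?_
      ring
  have hval : ∀ s ∈ Icc 0 s₁, ∑ k ∈ Finset.range (m + 1), ((s : ℂ) ^ k / k.factorial) * F k s =
      Complex.exp (s * ∑ i, L i i) * ∫ x, G (s, x) * transportedCutoff W φ (m + 1) s x := by
    intro s hs
    have hU : IsOpen {x | (s, x) ∈ V} := hV.preimage (by fun_prop)
    have hint : ∀ k, Integrable fun x => G (s, x) * (vecField W)^[k] φ x := by
      intro k
      have h1 : tsupport (fun x => G (s, x) * (vecField W)^[k] φ x) ⊆ tsupport φ :=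
        (tsupport_mul_subset_right).trans (hsupp k)
      refine Continuous.integrable_of_hasCompactSupport ?_
        (hφc.of_isClosed_subset (isClosed_tsupport _) h1)
      refine ContinuousOn.continuous_of_tsupport_subset (s := {x | (s, x) ∈ V}) ?_ hU
        (h1.trans (hmem s hs))
      exact (hG.continuousOn.comp (t := V) (by fun_prop : ContinuousOn (fun x => (s, x)) _)
        (fun x hx => hx)).mul (contDiff_iterate_vecField hW hφ k).continuous.continuousOn
    simp only [hF, transportedCutoff, Finset.mul_sum]
    rw [integral_finsetSum, Finset.mul_sum]
    · refine Finset.sum_congr rfl fun k _ => ?_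
      rw [mul_left_comm, ← integral_const_mul]
      congr 2; ext x; ring
    · intro k _
      refine ((hint k).const_mul ((s : ℂ) ^ k / k.factorial)).congr (Eventually.of_forall fun x => ?_)
      simp only; ring
  have h0 : ∑ k ∈ Finset.range (m + 1), (((0 : ℝ) : ℂ) ^ k / k.factorial) * F k 0 =
      ∫ x, G (0, x) * φ x := by
    rw [Finset.sum_range_succ']
    simp [hF]
  rw [← hval s₁ (right_mem_Icc.2 hs₁), ← h0]
  have := norm_image_sub_le_of_norm_deriv_le_segment' (f := fun s : ℝ =>
    ∑ k ∈ Finset.range (m + 1), ((s : ℂ) ^ k / k.factorial) * F k s) (f' := fun s : ℝ =>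
    -(((s : ℂ) ^ m / m.factorial) * F (m + 1) s)) (a := 0) (b := s₁)
    (C := s₁ ^ m / m.factorial * D)
    (fun s hs => (hUd m s hs).hasDerivWithinAt) (fun s hs => ?_) s₁ (right_mem_Icc.2 hs₁)
  · simpa using this
  · rw [norm_neg, norm_mul, norm_div, norm_pow, Complex.norm_real, Complex.norm_natCast,
      Real.norm_of_nonneg hs.1]
    have h5 := hD s (Ico_subset_Icc_self hs)
    have h6 := hs.1
    have h7 := hs.2.le
    gcongr

/-- Deformation of the contour in an integral with an Ehrenpreis cut-off. -/
theorem norm_integral_cutoff_sub_le (hW : IsAffineField W L) {V : Set (ℝ × (Fin n → ℝ))}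
    (hV : IsOpen V) {G : ℝ × (Fin n → ℝ) → ℂ} (hG : ContDiffOn ℝ 1 G V)
    (hGW : IsTransported W V G) {A A' : Set (Fin n → ℝ)} {C : ℝ} {χ : ℕ → (Fin n → ℝ) → ℝ}
    (hχ : IsEhrenpreisCutoff A A' C χ) (hA : volume A < ⊤) (hA' : IsOpen A')
    {s₁ a ℓ Q Q' r : ℝ} {a₀ : Fin n → ℝ} (hs₁ : 0 ≤ s₁) (hC : 0 ≤ C) (hℓ0 : 0 ≤ ℓ) (ha0 : 0 ≤ a)
    (ha : ∀ x ∈ A, ∑ i, ‖W x i‖ ≤ a) (hℓ : ∀ l, ∑ i, ‖L l i‖ ≤ ℓ)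
    (hmem : ∀ s ∈ Icc 0 s₁, ∀ x ∈ A, (s, x) ∈ V)
    (hQ : ∀ s ∈ Icc 0 s₁, ∀ x ∈ A \ A', ‖G (s, x)‖ ≤ Q) (hQ0 : 0 ≤ Q)
    (hQ' : ∀ x ∈ A, r ≤ dist x a₀ → ‖G (s₁, x)‖ ≤ Q') (hQ'0 : 0 ≤ Q')
    {ψ : (Fin n → ℝ) → ℂ} (hψc : Continuous ψ) (hψ : ∀ x, ‖ψ x‖ ≤ 1) (hψ1 : ∀ x, dist x a₀ < r → ψ x = 1)
    (hψA : tsupport ψ ⊆ A') (hA'A : A' ⊆ A) (hr : ball a₀ r ⊆ A') (m : ℕ) :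
    ‖Complex.exp (s₁ * ∑ i, L i i) * (∫ x, G (s₁, x) * ψ x) -
      ∫ x, G (0, x) * (χ (m + 1) x : ℂ)‖ ≤
      Real.exp (s₁ * ‖∑ i, L i i‖) * volume.real A *
        (Q * (s₁ ^ m / m.factorial * ((a * C + ℓ) * (m + 1)) ^ (m + 1) * s₁) +
          Q' * (Real.exp (s₁ * ((a * C + ℓ) * (m + 1))) + 1)) := by
  set t := ∑ i, L i i with ht
  set φ : (Fin n → ℝ) → ℂ := fun x => (χ (m + 1) x : ℂ) with hφdef
  set κ := (a * C + ℓ) * ((m : ℝ) + 1) with hκ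
  have hκ0 : 0 ≤ κ := by positivity
  have hφ : ContDiff ℝ ∞ φ := Complex.ofRealCLM.contDiff.comp (hχ.smooth (m + 1))
  have hts : tsupport φ ⊆ tsupport (χ (m + 1)) := by
    refine closure_mono fun x hx h => hx ?_
    simp [hφdef, h]
  have hφc : HasCompactSupport φ :=
    (hχ.hasCompactSupport (m + 1)).of_isClosed_subset (isClosed_tsupport _) hts
  have htA : tsupport φ ⊆ A := hts.trans (hχ.tsupport_subset _)
  have hsupp := tsupport_iterate_vecField_subset W φ
  have hzero : ∀ k, ∀ x ∉ A, (vecField W)^[k] φ x = 0 := fun k x hx =>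
    image_eq_zero_of_notMem_tsupport fun h => hx (htA (hsupp k h))
  -- The cut-off is constant on `A'`, so the remainder lives on `A \ A'`, the only region in which
  -- `G` is bounded for all intermediate times.
  have hone : ∀ k, ∀ x ∈ A', (vecField W)^[k + 1] φ x = 0 := by
    intro k
    induction k with
    | zero =>
      intro x hx
      have h1 : φ =ᶠ[𝓝 x] fun _ => 1 := by
        filter_upwards [hA'.mem_nhds hx] with y hy
        simp [hφdef, hχ.eq_one _ y hy]
      simp [vecField, pd, h1.fderiv_eq]
    | succ k ih =>
      intro x hx
      have h1 : (vecField W)^[k + 1] φ =ᶠ[𝓝 x] fun _ => 0 := by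
        filter_upwards [hA'.mem_nhds hx] with y hy using ih y hy
      rw [Function.iterate_succ_apply']
      refine Finset.sum_eq_zero fun i _ => ?_
      rw [pd, h1.fderiv_eq]
      simp
  -- The cut-off of index `m + 1` controls exactly the `m + 1` derivatives occurring in the
  -- remainder.
  have hbd : ∀ k ≤ m + 1, ∀ x ∈ A, ‖(vecField W)^[k] φ x‖ ≤ κ ^ k := by
    intro k hk x hx
    have h1 := norm_iterPd_iterate_vecField_le (j := m + 1) (B := C * ((m + 1 : ℕ) : ℝ)) (φ := φ)
      hW (ha x hx) hℓ hℓ0 (by positivity) hφ ?_ k [] (by simpa using hk)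
    · simp only [iterPd, List.length_nil, pow_zero, one_mul] at h1
      refine h1.trans (le_of_eq ?_)
      rw [hκ]; push_cast; ring
    · intro σ hσ
      obtain ⟨τ, hτ⟩ := exists_iterPd_ofReal_eq (hχ.smooth (m + 1)) σ
      have h2 : iterPd σ φ = _ := hτ
      rw [h2, Complex.norm_real]
      exact hχ.growth (m + 1) σ.length hσ τ x
  have hexp : ∀ s ∈ Icc 0 s₁, ‖Complex.exp (s * t)‖ ≤ Real.exp (s₁ * ‖t‖) := by
    intro s hs
    rw [Complex.norm_exp]
    refine Real.exp_le_exp.2 ((Complex.re_le_norm _).trans ?_)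
    rw [norm_mul, Complex.norm_real, Real.norm_of_nonneg hs.1]
    exact mul_le_mul_of_nonneg_right hs.2 (norm_nonneg _)
  have step1 := norm_exp_mul_integral_transportedCutoff_sub_le hW hφ hφc hV hG hGW hs₁
    (fun s hs x hx => hmem s hs x (htA hx)) m
    (D := Real.exp (s₁ * ‖t‖) * ((Q * κ ^ (m + 1)) * volume.real A)) (by
      intro s hs
      rw [norm_mul]
      refine mul_le_mul (hexp s hs) ?_ (norm_nonneg _) (Real.exp_pos _).le
      refine norm_integral_le_of_norm_le_const_of_eq_zero hA (fun x hx => ?_) (fun x hx => ?_)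
      · by_cases hx' : x ∈ A'
        · rw [hone m x hx', mul_zero, norm_zero]; positivity
        · rw [norm_mul]
          exact mul_le_mul (hQ s hs x ⟨hx, hx'⟩) (hbd _ le_rfl x hx) (norm_nonneg _) hQ0
      · rw [hzero _ x hx, mul_zero])
  have hu : ∀ x ∈ A, ‖transportedCutoff W φ (m + 1) s₁ x‖ ≤ Real.exp (s₁ * κ) := by
    intro x hx
    refine le_trans ?_ (Real.sum_le_exp_of_nonneg (by positivity : 0 ≤ s₁ * κ) (m + 1))
    refine norm_sum_le_of_le _ fun k hk => ?_
    rw [norm_mul, norm_div, norm_pow, Complex.norm_real, Complex.norm_natCast,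
      Real.norm_of_nonneg hs₁, mul_pow, mul_div_right_comm]
    exact mul_le_mul_of_nonneg_left (hbd k (Finset.mem_range.1 hk).le x hx) (by positivity)
  have hu1 : ∀ x ∈ A', transportedCutoff W φ (m + 1) s₁ x = 1 := by
    intro x hx
    unfold transportedCutoff
    rw [Finset.sum_range_succ', Finset.sum_eq_zero fun k _ => by rw [hone k x hx, mul_zero]]
    simp [hφdef, hχ.eq_one _ x hx]
  have hu0 : ∀ x ∉ A, transportedCutoff W φ (m + 1) s₁ x = 0 := by
    intro x hx
    exact Finset.sum_eq_zero fun k _ => by rw [hzero k x hx, mul_zero]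
  -- The transported cut-off and `ψ` are both `1` on the ball of radius `r`. Outside it the
  -- integrand at time `s₁` is at most `Q'`, against a cut-off of size at most `exp (s₁ κ)`.
  have step2 : ‖Complex.exp (s₁ * t) * (∫ x, G (s₁, x) * ψ x) -
      Complex.exp (s₁ * t) * ∫ x, G (s₁, x) * transportedCutoff W φ (m + 1) s₁ x‖ ≤
      Real.exp (s₁ * ‖t‖) * ((Q' * (Real.exp (s₁ * κ) + 1)) * volume.real A) := by
    have hs₁m : s₁ ∈ Icc 0 s₁ := right_mem_Icc.2 hs₁
    have hU : IsOpen {x | (s₁, x) ∈ V} := hV.preimage (by fun_prop)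
    have hint : ∀ {v : (Fin n → ℝ) → ℂ}, Continuous v → HasCompactSupport v → tsupport v ⊆ A →
        Integrable fun x => G (s₁, x) * v x := by
      intro v hv hvc hvs
      have h1 : tsupport (fun x => G (s₁, x) * v x) ⊆ tsupport v := tsupport_mul_subset_right
      refine Continuous.integrable_of_hasCompactSupport ?_
        (hvc.of_isClosed_subset (isClosed_tsupport _) h1)
      refine ContinuousOn.continuous_of_tsupport_subset (s := {x | (s₁, x) ∈ V}) ?_ hU
        (h1.trans fun x hx => hmem s₁ hs₁m x (hvs hx))
      exact (hG.continuousOn.comp (t := V) (by fun_prop : ContinuousOn (fun x => (s₁, x)) _)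
        (fun x hx => hx)).mul hv.continuousOn
    have hut : tsupport (transportedCutoff W φ (m + 1) s₁) ⊆ tsupport φ := by
      refine closure_minimal (fun x hx => ?_) (isClosed_tsupport φ)
      by_contra h
      exact hx (Finset.sum_eq_zero fun k _ => by
        rw [image_eq_zero_of_notMem_tsupport (f := (vecField W)^[k] φ) fun h' => h (hsupp k h'),
          mul_zero])
    have hψcs : tsupport ψ ⊆ tsupport φ := by
      refine closure_minimal (fun x hx => subset_tsupport φ ?_) (isClosed_tsupport φ)
      simp [hφdef, hχ.eq_one _ x (hψA (subset_tsupport ψ hx))]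
    have hucont : Continuous (transportedCutoff W φ (m + 1) s₁) :=
      continuous_finsetSum _ fun k _ =>
        continuous_const.mul (contDiff_iterate_vecField hW hφ k).continuous
    rw [← mul_sub, norm_mul, ← integral_sub
      (hint hψc (hφc.of_isClosed_subset (isClosed_tsupport _) hψcs) (hψcs.trans htA))
      (hint hucont (hφc.of_isClosed_subset (isClosed_tsupport _) hut) (hut.trans htA))]
    refine mul_le_mul (hexp s₁ hs₁m) ?_ (norm_nonneg _) (Real.exp_pos _).le
    refine norm_integral_le_of_norm_le_const_of_eq_zero hA (fun x hx => ?_) (fun x hx => ?_)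
    · rw [← mul_sub]
      by_cases hxr : dist x a₀ < r
      · rw [hψ1 x hxr, hu1 x (hr hxr), sub_self, mul_zero, norm_zero]
        positivity
      · rw [norm_mul]
        refine mul_le_mul (hQ' x hx (not_lt.1 hxr)) ?_ (norm_nonneg _) hQ'0
        refine (norm_sub_le _ _).trans ?_
        linarith [hψ x, hu x hx]
    · rw [hu0 x hx, image_eq_zero_of_notMem_tsupport fun h => hx (hA'A (hψA h)), sub_self]
  calc _ ≤ _ := norm_sub_le_norm_sub_add_norm_sub _ (Complex.exp (s₁ * t) *
        ∫ x, G (s₁, x) * transportedCutoff W φ (m + 1) s₁ x) _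
    _ ≤ _ := add_le_add step2 step1
    _ = _ := by ring

end FlowBounds

/-! ### Complex Gaussian integrals -/

section Gaussian

open Matrix MeasureTheory

theorem Matrix.IsHermitian.exists_transpose_mul_mul_eq_diagonal {n : ℕ}
    {B : Matrix (Fin n) (Fin n) ℝ} (hB : B.IsHermitian) :
    ∃ V : Matrix (Fin n) (Fin n) ℝ, Vᵀ * V = 1 ∧ Vᵀ * B * V = diagonal hB.eigenvalues := by
  refine ⟨(hB.eigenvectorUnitary).1, ?_, ?_⟩
  · have := (Matrix.mem_unitaryGroup_iff'.1 hB.eigenvectorUnitary.2)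
    simpa [star_eq_conjTranspose, conjTranspose_eq_transpose_of_trivial] using this
  · have := hB.conjStarAlgAut_star_eigenvectorUnitary
    rw [Unitary.conjStarAlgAut_star_apply] at this
    simpa [star_eq_conjTranspose, conjTranspose_eq_transpose_of_trivial] using this

/-- Simultaneous diagonalization of a positive definite and a symmetric real matrix. -/
theorem Matrix.PosDef.exists_simultaneous_diagonalization {n : ℕ} {A B : Matrix (Fin n) (Fin n) ℝ}
    (hA : A.PosDef) (hB : B.IsHermitian) :
    ∃ (P : Matrix (Fin n) (Fin n) ℝ) (d : Fin n → ℝ), P.det ≠ 0 ∧ Pᵀ * A * P = 1 ∧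
      Pᵀ * B * P = diagonal d := by
  obtain ⟨U, hUU, hUA⟩ := hA.isHermitian.exists_transpose_mul_mul_eq_diagonal
  have hpos := hA.eigenvalues_pos
  generalize hA.isHermitian.eigenvalues = e at hUA hpos
  -- `U * E` reduces `A` to the identity; the orthogonal matrix that then diagonalizes the
  -- transformed `B` preserves the identity.
  set E : Matrix (Fin n) (Fin n) ℝ := diagonal fun i => (Real.sqrt (e i))⁻¹ with hE
  have hB' : ((U * E)ᵀ * B * (U * E)).IsHermitian := by
    have := isHermitian_conjTranspose_mul_mul (U * E) hB
    simpa [conjTranspose_eq_transpose_of_trivial] using this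
  obtain ⟨V, hVV, hVB⟩ := hB'.exists_transpose_mul_mul_eq_diagonal
  have hEE : Eᵀ * diagonal e * E = 1 := by
    rw [hE, diagonal_transpose, diagonal_mul_diagonal, diagonal_mul_diagonal, ← diagonal_one]
    congr 1; ext i
    have h1 := Real.sq_sqrt (hpos i).le
    have h2 := Real.sqrt_pos.2 (hpos i)
    field_simp
    exact h1.symm
  have hP : (U * E * V)ᵀ * A * (U * E * V) = 1 := by
    calc _ = Vᵀ * (Eᵀ * (Uᵀ * A * U) * E) * V := by
          simp only [transpose_mul, Matrix.mul_assoc]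
      _ = 1 := by rw [hUA, hEE, Matrix.mul_one, hVV]
  refine ⟨U * E * V, hB'.eigenvalues, ?_, hP, ?_⟩
  · intro h
    have h2 := congrArg Matrix.det hP
    rw [det_mul, h, mul_zero, det_one] at h2
    exact zero_ne_one h2
  · rw [← hVB]
    simp only [transpose_mul, Matrix.mul_assoc]

/-- A Gaussian integral with a complex quadratic form in the exponent does not vanish. -/
theorem integral_cexp_neg_quadratic_ne_zero {n : ℕ} (S : Matrix (Fin n) (Fin n) ℂ)
    (hS : ∀ y : Fin n → ℝ, y ≠ 0 → 0 < (∑ i, ∑ j, S i j * y i * y j).re) :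
    ∫ y : Fin n → ℝ, Complex.exp (-∑ i, ∑ j, S i j * y i * y j) ≠ 0 := by
  -- `S` need not be symmetric, so its real and imaginary parts are symmetrized, which leaves the
  -- quadratic form unchanged. In diagonalizing coordinates the integral is a product of
  -- one-dimensional Gaussians with parameters `1 + i d`.
  set A : Matrix (Fin n) (Fin n) ℝ := fun i j => ((S i j).re + (S j i).re) / 2 with hA
  set B : Matrix (Fin n) (Fin n) ℝ := fun i j => ((S i j).im + (S j i).im) / 2 with hB
  have hsym : ∀ (s : Fin n → Fin n → ℝ) (y : Fin n → ℝ),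
      y ⬝ᵥ ((fun i j => (s i j + s j i) / 2 : Matrix (Fin n) (Fin n) ℝ) *ᵥ y) =
        ∑ i, ∑ j, s i j * y i * y j := by
    intro s y
    have h1 : ∑ i, ∑ j, s j i * y i * y j = ∑ i, ∑ j, s i j * y i * y j := by
      rw [Finset.sum_comm]
      exact Finset.sum_congr rfl fun i _ => Finset.sum_congr rfl fun j _ => by ring
    calc _ = ∑ i, ∑ j, ((s i j * y i * y j) / 2 + (s j i * y i * y j) / 2) := by
          simp only [dotProduct, mulVec, Finset.mul_sum]
          exact Finset.sum_congr rfl fun i _ => Finset.sum_congr rfl fun j _ => by ring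
      _ = (∑ i, ∑ j, s i j * y i * y j) / 2 + (∑ i, ∑ j, s j i * y i * y j) / 2 := by
          simp only [Finset.sum_add_distrib, Finset.sum_div]
      _ = _ := by rw [h1]; ring
  have hre : ∀ y : Fin n → ℝ, (∑ i, ∑ j, S i j * y i * y j).re = y ⬝ᵥ (A *ᵥ y) := by
    intro y
    rw [hA, hsym fun i j => (S i j).re]
    simp
  have him : ∀ y : Fin n → ℝ, (∑ i, ∑ j, S i j * y i * y j).im = y ⬝ᵥ (B *ᵥ y) := by
    intro y
    rw [hB, hsym fun i j => (S i j).im]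
    simp
  have hBh : B.IsHermitian := by
    ext i j
    show ((S j i).im + (S i j).im) / 2 = ((S i j).im + (S j i).im) / 2
    ring
  have hAp : A.PosDef := by
    refine PosDef.of_dotProduct_mulVec_pos ?_ ?_
    · ext i j
      show ((S j i).re + (S i j).re) / 2 = ((S i j).re + (S j i).re) / 2
      ring
    · intro y hy
      have := hS y hy
      rw [hre] at this
      simpa using this
  obtain ⟨P, d, hP, hPA, hPB⟩ := hAp.exists_simultaneous_diagonalization hBh
  set f : (Fin n → ℝ) → ℂ := fun y => Complex.exp (-∑ i, ∑ j, S i j * y i * y j) with hf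
  have hfc : Continuous f := by fun_prop
  have hquad : ∀ y : Fin n → ℝ, ∑ i, ∑ j, S i j * (P *ᵥ y) i * (P *ᵥ y) j =
      ∑ i, (1 + d i * Complex.I) * (y i : ℂ) ^ 2 := by
    intro y
    have hq : ∀ M : Matrix (Fin n) (Fin n) ℝ, (P *ᵥ y) ⬝ᵥ (M *ᵥ (P *ᵥ y)) =
        y ⬝ᵥ ((Pᵀ * M * P) *ᵥ y) := by
      intro M
      rw [← mulVec_mulVec, ← mulVec_mulVec, dotProduct_mulVec y, vecMul_transpose]
    apply Complex.ext
    · rw [hre, hq, hPA]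
      simp [dotProduct, pow_two]
    · rw [him, hq, hPB]
      simp only [mulVec_diagonal, dotProduct, Complex.im_sum]
      refine Finset.sum_congr rfl fun i _ => ?_
      simp [pow_two]
      ring
  have hmap := Real.map_matrix_volume_pi_eq_smul_volume_pi (M := P) hP
  have h1 : ∫ y, f (P *ᵥ y) = |P.det⁻¹| • ∫ y, f y := by
    have h2 : ∫ y, f y ∂(Measure.map (Matrix.toLin' P) volume) = ∫ y, f (P *ᵥ y) := by
      rw [integral_map (by
        exact (LinearMap.continuous_of_finiteDimensional (Matrix.toLin' P)).measurable.aemeasurable)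
        hfc.aestronglyMeasurable]
      simp
    rw [← h2, hmap, integral_smul_measure, ENNReal.toReal_ofReal (abs_nonneg _)]
  have h3 : ∫ y, f (P *ᵥ y) ≠ 0 := by
    have h4 := GaussianFourier.integral_cexp_neg_sum_mul_add (ι := Fin n)
      (b := fun i => 1 + d i * Complex.I) (by intro i; simp) 0
    simp only [hf, hquad]
    simp only [Pi.zero_apply, zero_mul, Finset.sum_const_zero, add_zero] at h4
    rw [h4]
    refine Finset.prod_ne_zero_iff.2 fun i _ => ?_
    have h5 : (1 + d i * Complex.I : ℂ) ≠ 0 := by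
      intro h
      simpa using congrArg Complex.re h
    simp [Complex.cpow_eq_zero_iff, Real.pi_ne_zero, h5]
  intro h
  rw [h1, h, smul_zero] at h3
  exact h3 rfl

end Gaussian

/-! ### Quantitative Taylor expansion in one complex variable -/

section TaylorCoeff

open Metric Set MeasureTheory

/-- The `m`-th Taylor coefficient at the origin, as a mean value over the circle of radius `η`. -/
noncomputable def taylorCoeff (g : ℂ → ℂ) (η : ℝ) (m : ℕ) : ℂ :=
  (2 * Real.pi : ℂ)⁻¹ * ∫ θ in (0 : ℝ)..2 * Real.pi, g (circleMap 0 η θ) * (circleMap 0 η θ ^ m)⁻¹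

theorem norm_taylorCoeff_le {g : ℂ → ℂ} {η Q : ℝ} (hη : 0 < η)
    (hQ : ∀ z, ‖z‖ = η → ‖g z‖ ≤ Q) (m : ℕ) : ‖taylorCoeff g η m‖ ≤ Q * (η ^ m)⁻¹ := by
  have h1 : ‖∫ θ in (0 : ℝ)..2 * Real.pi, g (circleMap 0 η θ) * (circleMap 0 η θ ^ m)⁻¹‖ ≤
      Q * (η ^ m)⁻¹ * |2 * Real.pi - 0| := by
    refine intervalIntegral.norm_integral_le_of_norm_le_const fun θ _ => ?_
    have h2 : ‖circleMap 0 η θ‖ = η := by simp [abs_of_pos hη]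
    rw [norm_mul, norm_inv, norm_pow, h2]
    exact mul_le_mul_of_nonneg_right (hQ _ h2) (by positivity)
  rw [sub_zero, abs_of_pos Real.two_pi_pos] at h1
  unfold taylorCoeff
  rw [norm_mul, norm_inv]
  have h3 : ‖(2 * Real.pi : ℂ)‖ = 2 * Real.pi := by
    simp [abs_of_pos Real.pi_pos]
  rw [h3, inv_mul_le_iff₀ Real.two_pi_pos]
  linarith

/-- Half a turn of the circle, `θ ↦ θ + π`, together with periodicity of the integrand. -/
theorem taylorCoeff_comp_neg (g : ℂ → ℂ) (η : ℝ) (m : ℕ) :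
    taylorCoeff (fun z => g (-z)) η m = (-1) ^ m * taylorCoeff g η m := by
  set F : ℝ → ℂ := fun θ => g (circleMap 0 η θ) * (circleMap 0 η θ ^ m)⁻¹ with hF
  have hneg : ∀ θ, circleMap 0 η (θ + Real.pi) = -circleMap 0 η θ := by
    intro θ
    simp [circleMap, add_mul, Complex.exp_add]
  have h1 : ∀ θ, g (-circleMap 0 η θ) * (circleMap 0 η θ ^ m)⁻¹ = (-1) ^ m * F (θ + Real.pi) := by
    intro θ
    simp only [hF, hneg]
    rcases Nat.even_or_odd m with h | h
    · simp [h.neg_pow]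
    · simp [h.neg_pow]
  have hper : Function.Periodic F (2 * Real.pi) := by
    intro θ
    simp [hF, periodic_circleMap 0 η θ]
  unfold taylorCoeff
  simp only [h1]
  rw [intervalIntegral.integral_const_mul, intervalIntegral.integral_comp_add_right, zero_add,
    add_comm (2 * Real.pi), hper.intervalIntegral_add_eq Real.pi 0, zero_add]
  ring

variable {g : ℂ → ℂ} {η η' Q : ℝ}

/-- The functions expanded later contain a division by `h ^ 2` and have no prescribed value at `0`.
Boundedness makes the singularity removable, and the mean values over the circle do not see the
centre. -/
theorem hasSum_taylorCoeff (hη : 0 < η) (hηη : η < η')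
    (hg : DifferentiableOn ℂ g (ball 0 η' \ {0})) (hQ : ∀ z ∈ ball (0 : ℂ) η' \ {0}, ‖g z‖ ≤ Q)
    {h : ℂ} (h0 : h ≠ 0) (hh : ‖h‖ < η) : HasSum (fun m => h ^ m * taylorCoeff g η m) (g h) := by
  have hη' : 0 < η' := hη.trans hηη
  have hd := Complex.differentiableOn_update_limUnder_of_bddAbove (ball_mem_nhds (0 : ℂ) hη') hg
    ⟨Q, by rintro _ ⟨z, hz, rfl⟩; exact hQ z hz⟩
  set G := Function.update g 0 (limUnder (𝓝[≠] 0) g)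
  have hG : ∀ z, z ≠ 0 → G z = g z := fun z hz => Function.update_of_ne hz _ _
  lift η to NNReal using hη.le
  have hps := (hd.mono (closedBall_subset_ball hηη)).hasFPowerSeriesOnBall (by exact_mod_cast hη)
  have hs := hps.hasSum (y := h) (by simpa [Metric.mem_eball] using hh)
  rw [zero_add, hG h h0] at hs
  have hm : ∀ m, h ^ m * taylorCoeff g η m = cauchyPowerSeries G 0 η m fun _ => h := by
    intro m
    rw [cauchyPowerSeries_apply, circleIntegral, taylorCoeff, smul_eq_mul,
      ← intervalIntegral.integral_const_mul, ← intervalIntegral.integral_const_mul,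
      ← intervalIntegral.integral_const_mul]
    congr 1; ext θ
    have hc : circleMap 0 η θ ≠ 0 := circleMap_ne_center (by exact_mod_cast hη.ne')
    rw [hG _ hc, deriv_circleMap]
    simp only [sub_zero, smul_eq_mul, div_pow]
    field_simp [Complex.I_ne_zero]
  simpa only [hm] using hs

/-- Cauchy's estimates bound the tail by a geometric series of ratio `‖h‖/η ≤ 1/2`, whence the
factor `2`. -/
theorem norm_sub_sum_taylorCoeff_le (hη : 0 < η) (hηη : η < η')
    (hg : DifferentiableOn ℂ g (ball 0 η' \ {0})) (hQ : ∀ z ∈ ball (0 : ℂ) η' \ {0}, ‖g z‖ ≤ Q)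
    {h : ℂ} (h0 : h ≠ 0) (hh : ‖h‖ ≤ η / 2) (n : ℕ) :
    ‖g h - ∑ m ∈ Finset.range n, h ^ m * taylorCoeff g η m‖ ≤ 2 * Q * (‖h‖ / η) ^ n := by
  have hs := hasSum_taylorCoeff hη hηη hg hQ h0 (by linarith : ‖h‖ < η)
  have hQ0 : 0 ≤ Q := (norm_nonneg _).trans (hQ h ⟨by simpa using by linarith, h0⟩)
  have hx : ‖h‖ / η ≤ 1 / 2 := by rw [div_le_iff₀ hη]; linarith
  have hx0 : 0 ≤ ‖h‖ / η := by positivity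
  have ht : HasSum (fun m => h ^ (m + n) * taylorCoeff g η (m + n))
      (g h - ∑ m ∈ Finset.range n, h ^ m * taylorCoeff g η m) :=
    (hasSum_nat_add_iff' n).2 hs
  rw [← ht.tsum_eq]
  have hgeo := (hasSum_geometric_of_lt_one hx0 (by linarith)).mul_left (Q * (‖h‖ / η) ^ n)
  refine (tsum_of_norm_bounded hgeo fun m => ?_).trans ?_
  · have h1 := norm_taylorCoeff_le (g := g) (Q := Q) hη (fun z hz => hQ z ⟨by simpa [hz] using hηη, by
      rintro rfl; simp at hz; linarith⟩) (m + n)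
    rw [norm_mul, norm_pow]
    calc ‖h‖ ^ (m + n) * ‖taylorCoeff g η (m + n)‖ ≤ ‖h‖ ^ (m + n) * (Q * (η ^ (m + n))⁻¹) := by
          gcongr
      _ = _ := by rw [mul_assoc, ← pow_add, add_comm n m, div_pow]; field_simp
  · have h2 : (1 - ‖h‖ / η)⁻¹ ≤ 2 := by
      rw [inv_le_comm₀ (by linarith) (by norm_num)]; linarith
    calc _ ≤ Q * (‖h‖ / η) ^ n * 2 := by gcongr
      _ = _ := by ring

/-- This later identifies the leading term of the expansion with a pointwise limit as the scaling
parameter tends to zero. -/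
theorem tendsto_taylorCoeff_zero (hη : 0 < η) (hηη : η < η')
    (hg : DifferentiableOn ℂ g (ball 0 η' \ {0})) (hQ : ∀ z ∈ ball (0 : ℂ) η' \ {0}, ‖g z‖ ≤ Q) :
    Tendsto g (𝓝[≠] 0) (𝓝 (taylorCoeff g η 0)) := by
  rw [tendsto_iff_norm_sub_tendsto_zero]
  have h1 : Tendsto (fun z : ℂ => 2 * Q * (‖z‖ / η) ^ 1) (𝓝[≠] 0) (𝓝 0) := by
    have : Continuous fun z : ℂ => 2 * Q * (‖z‖ / η) ^ 1 := by fun_prop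
    simpa using (this.tendsto 0).mono_left nhdsWithin_le_nhds
  refine squeeze_zero' (Eventually.of_forall fun z => norm_nonneg _) ?_ h1
  have h2 : ∀ᶠ z : ℂ in 𝓝[≠] 0, ‖z‖ ≤ η / 2 := by
    refine nhdsWithin_le_nhds ?_
    filter_upwards [closedBall_mem_nhds (0 : ℂ) (half_pos hη)] with z hz using by simpa using hz
  filter_upwards [h2, self_mem_nhdsWithin] with z hz hz0
  simpa using norm_sub_sum_taylorCoeff_le hη hηη hg hQ hz0 hz 1

/-- A quantitative form of Taylor's formula at a double zero. -/
theorem norm_sub_sq_mul_taylorCoeff_le (hη : 0 < η) (hηη : η < η')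
    (hg : DifferentiableOn ℂ g (ball 0 η')) (hQ : ∀ z ∈ ball (0 : ℂ) η', ‖g z‖ ≤ Q)
    (hg0 : g 0 = 0) (hg1 : deriv g 0 = 0) {h : ℂ} (hh : ‖h‖ ≤ η / 2) :
    ‖g h‖ ≤ 2 * Q * (‖h‖ / η) ^ 2 ∧ ‖g h - h ^ 2 * taylorCoeff g η 2‖ ≤ 2 * Q * (‖h‖ / η) ^ 3 := by
  have hg' := hg.mono (sdiff_subset (t := {(0 : ℂ)}))
  have hQ' : ∀ z ∈ ball (0 : ℂ) η' \ {0}, ‖g z‖ ≤ Q := fun z hz => hQ z hz.1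
  have hda : DifferentiableAt ℂ g 0 := hg.differentiableAt (ball_mem_nhds 0 (hη.trans hηη))
  have c0 : taylorCoeff g η 0 = 0 := by
    refine tendsto_nhds_unique (tendsto_taylorCoeff_zero hη hηη hg' hQ') ?_
    have := hda.continuousAt.tendsto
    rw [hg0] at this
    exact this.mono_left nhdsWithin_le_nhds
  have c1 : taylorCoeff g η 1 = 0 := by
    have h1 : Tendsto (fun z => z⁻¹ * g z) (𝓝[≠] 0) (𝓝 0) := by
      have := hasDerivAt_iff_tendsto_slope_zero.1 hda.hasDerivAt
      simpa [hg0, hg1] using this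
    refine tendsto_nhds_unique ?_ h1
    rw [tendsto_iff_norm_sub_tendsto_zero]
    have h3 : Tendsto (fun z : ℂ => 2 * Q * (‖z‖ / η ^ 2)) (𝓝[≠] 0) (𝓝 0) := by
      have : Continuous fun z : ℂ => 2 * Q * (‖z‖ / η ^ 2) := by fun_prop
      simpa using (this.tendsto 0).mono_left nhdsWithin_le_nhds
    refine squeeze_zero' (Eventually.of_forall fun z => norm_nonneg _) ?_ h3
    have h2 : ∀ᶠ z : ℂ in 𝓝[≠] 0, ‖z‖ ≤ η / 2 := by
      refine nhdsWithin_le_nhds ?_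
      filter_upwards [closedBall_mem_nhds (0 : ℂ) (half_pos hη)] with z hz using by simpa using hz
    filter_upwards [h2, self_mem_nhdsWithin] with z hz hz0
    have h4 := norm_sub_sum_taylorCoeff_le hη hηη hg' hQ' hz0 hz 2
    rw [Finset.sum_range_succ, Finset.sum_range_one, c0] at h4
    have hz1 : z ≠ 0 := hz0
    have h5 : z⁻¹ * g z - taylorCoeff g η 1 =
        z⁻¹ * (g z - (z ^ 0 * 0 + z ^ 1 * taylorCoeff g η 1)) := by
      field_simp; ring
    rw [h5, norm_mul, norm_inv, inv_mul_le_iff₀ (norm_pos_iff.2 hz1)]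
    refine h4.trans (le_of_eq ?_)
    rw [div_pow]; ring
  rcases eq_or_ne h 0 with rfl | h0
  · simp [hg0]
  · have h2 := norm_sub_sum_taylorCoeff_le hη hηη hg' hQ' h0 hh 2
    have h3 := norm_sub_sum_taylorCoeff_le hη hηη hg' hQ' h0 hh 3
    simp only [Finset.sum_range_succ, Finset.sum_range_zero, c0, c1, mul_zero, zero_add, add_zero,
      sub_zero] at h2 h3
    exact ⟨h2, h3⟩

end TaylorCoeff

/-! ### Expansion of rescaled Gaussian integrals -/

section Expansion

open Metric Set MeasureTheory

variable {n : ℕ}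

theorem integrable_exp_neg_mul_norm_sq {c : ℝ} (hc : 0 < c) :
    Integrable fun y : Fin n → ℝ => Real.exp (-c * ‖y‖ ^ 2) := by
  -- The norm is the sup norm, for which `∑ y_i² ≤ n ‖y‖²`; the denominator `n + 1` also covers `n =
  -- 0`.
  have h1 := (GaussianFourier.integrable_cexp_neg_sum_mul_add (ι := Fin n)
    (b := fun _ => ((c / (n + 1) : ℝ) : ℂ)) (fun i => by
      rw [Complex.ofReal_re]; positivity) 0).norm
  refine h1.mono' (by fun_prop) (Eventually.of_forall fun y => ?_)
  rw [Real.norm_of_nonneg (Real.exp_pos _).le, Complex.norm_exp]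
  refine Real.exp_le_exp.2 ?_
  have h2 : (-∑ i : Fin n, ((c / (n + 1) : ℝ) : ℂ) * (y i : ℂ) ^ 2 + ∑ i, (0 : Fin n → ℂ) i * y i).re =
      -(c / (n + 1) * ∑ i, y i ^ 2) := by
    rw [Finset.mul_sum, ← Finset.sum_neg_distrib]
    simp only [Pi.zero_apply, zero_mul, Finset.sum_const_zero, add_zero, ← Complex.ofReal_pow,
      ← Complex.ofReal_mul, ← Complex.ofReal_sum, ← Complex.ofReal_neg, Complex.ofReal_re,
      Finset.sum_neg_distrib]
  rw [h2, neg_mul, neg_le_neg_iff]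
  have h3 : ∑ i, y i ^ 2 ≤ n * ‖y‖ ^ 2 := by
    calc ∑ i, y i ^ 2 ≤ ∑ _i : Fin n, ‖y‖ ^ 2 := by
          refine Finset.sum_le_sum fun i _ => ?_
          rw [← sq_abs, ← Real.norm_eq_abs]
          exact pow_le_pow_left₀ (norm_nonneg _) (norm_le_pi_norm y i) 2
      _ = _ := by simp
  calc c / (n + 1) * ∑ i, y i ^ 2 ≤ c / (n + 1) * ((n + 1) * ‖y‖ ^ 2) := by
        gcongr
        refine h3.trans ?_
        nlinarith [sq_nonneg ‖y‖]
    _ = _ := by field_simp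

/-- Half of the Gaussian is spent on the power: `u^K/K! ≤ e^u` with `u = (c/4)(1+t)²`, and `(1+t)² ≤
2 + 2t²`. -/
theorem one_add_pow_mul_exp_le {c t : ℝ} (hc : 0 < c) (ht : 0 ≤ t) (K : ℕ) :
    (1 + t) ^ (2 * K) * Real.exp (-c * t ^ 2) ≤
      Real.exp (c / 2) * (4 / c) ^ K * K.factorial * Real.exp (-(c / 2) * t ^ 2) := by
  have h1 := Real.pow_div_factorial_le_exp (c / 4 * (1 + t) ^ 2) (by positivity) K
  rw [div_le_iff₀ (by positivity)] at h1
  have h2 : Real.exp (c / 4 * (1 + t) ^ 2) ≤ Real.exp (c / 2) * Real.exp (c / 2 * t ^ 2) := by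
    rw [← Real.exp_add]
    refine Real.exp_le_exp.2 ?_
    nlinarith [sq_nonneg (1 - t)]
  have h3 : (1 + t) ^ (2 * K) = (4 / c) ^ K * (c / 4 * (1 + t) ^ 2) ^ K := by
    rw [pow_mul, ← mul_pow]; congr 1; field_simp
  have h4 : Real.exp (-(c / 2) * t ^ 2) = Real.exp (c / 2 * t ^ 2) * Real.exp (-c * t ^ 2) := by
    rw [← Real.exp_add]; congr 1; ring
  rw [h3, h4]
  calc _ ≤ (4 / c) ^ K * (Real.exp (c / 2) * Real.exp (c / 2 * t ^ 2) * K.factorial) *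
        Real.exp (-c * t ^ 2) := by gcongr; exact h1.trans (by gcongr)
    _ = _ := by ring

theorem integrable_one_add_norm_pow_mul_exp {c : ℝ} (hc : 0 < c) (m : ℕ) :
    Integrable fun y : Fin n → ℝ => (1 + ‖y‖) ^ m * Real.exp (-c * ‖y‖ ^ 2) := by
  refine (((integrable_exp_neg_mul_norm_sq (half_pos hc)).const_mul
    (Real.exp (c / 2) * (4 / c) ^ m * m.factorial)).mono' (by fun_prop)
    (Eventually.of_forall fun y => ?_))
  rw [Real.norm_of_nonneg (by positivity)]
  refine le_trans ?_ (one_add_pow_mul_exp_le hc (norm_nonneg y) m)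
  gcongr
  · linarith [norm_nonneg y]
  · omega

/-- Gaussian moments grow like `C ^ K * K!`. -/
theorem exists_integral_one_add_norm_pow_le (n : ℕ) {c : ℝ} (hc : 0 < c) :
    ∃ M C : ℝ, 0 < M ∧ 0 < C ∧ ∀ K : ℕ,
      ∫ y : Fin n → ℝ, (1 + ‖y‖) ^ (2 * K) * Real.exp (-c * ‖y‖ ^ 2) ≤ M * C ^ K * K.factorial := by
  have hI := integrable_exp_neg_mul_norm_sq (n := n) (half_pos hc)
  have h0 : 0 ≤ ∫ y : Fin n → ℝ, Real.exp (-(c / 2) * ‖y‖ ^ 2) :=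
    integral_nonneg fun y => (Real.exp_pos _).le
  refine ⟨Real.exp (c / 2) * ((∫ y : Fin n → ℝ, Real.exp (-(c / 2) * ‖y‖ ^ 2)) + 1), 4 / c,
    by positivity, by positivity, fun K => ?_⟩
  calc _ ≤ ∫ y : Fin n → ℝ, Real.exp (c / 2) * (4 / c) ^ K * K.factorial *
        Real.exp (-(c / 2) * ‖y‖ ^ 2) :=
        integral_mono (integrable_one_add_norm_pow_mul_exp hc _) (hI.const_mul _)
          fun y => one_add_pow_mul_exp_le hc (norm_nonneg y) K
    _ = Real.exp (c / 2) * (4 / c) ^ K * K.factorial *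
        ∫ y : Fin n → ℝ, Real.exp (-(c / 2) * ‖y‖ ^ 2) := integral_const_mul _ _
    _ ≤ Real.exp (c / 2) * (4 / c) ^ K * K.factorial *
        ((∫ y : Fin n → ℝ, Real.exp (-(c / 2) * ‖y‖ ^ 2)) + 1) := by gcongr; linarith
    _ = _ := by ring

/-- A family of integrands depending holomorphically on a scaling parameter `h`, with uniform
Gaussian decay where `|h| |y| < ρ`. -/
structure IsGaussianFamily (Ψ : ℂ → (Fin n → ℝ) → ℂ) (ρ c Q : ℝ) : Prop where
  continuousOn : ContinuousOn (fun p : ℂ × (Fin n → ℝ) => Ψ p.1 p.2) {p | p.1 ≠ 0 ∧ ‖p.1‖ * ‖p.2‖ < ρ}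
  differentiableOn : ∀ y, DifferentiableOn ℂ (fun h => Ψ h y) {h | h ≠ 0 ∧ ‖h‖ * ‖y‖ < ρ}
  bound : ∀ h y, h ≠ 0 → ‖h‖ * ‖y‖ < ρ → ‖Ψ h y‖ ≤ Q * Real.exp (-c * ‖y‖ ^ 2)
  neg : ∀ h y, Ψ (-h) y = Ψ h (-y)

/-- The radius of the circle on which Taylor coefficients in the scaling parameter are computed. -/
noncomputable def scaleRadius (ρ : ℝ) (y : Fin n → ℝ) : ℝ := ρ / (2 * (1 + ‖y‖))

/-- Taylor coefficients in the scaling parameter. -/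
noncomputable def scaleCoeff (Ψ : ℂ → (Fin n → ℝ) → ℂ) (ρ : ℝ) (m : ℕ) (y : Fin n → ℝ) : ℂ :=
  taylorCoeff (fun h => Ψ h y) (scaleRadius ρ y) m

theorem scaleRadius_pos {ρ : ℝ} (hρ : 0 < ρ) (y : Fin n → ℝ) : 0 < scaleRadius ρ y := by
  unfold scaleRadius; positivity

theorem mul_norm_lt_of_lt_two_mul_scaleRadius {ρ t : ℝ} (hρ : 0 < ρ) {y : Fin n → ℝ}
    (ht : t < 2 * scaleRadius ρ y) : t * ‖y‖ < ρ := by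
  have h0 : 0 < 1 + ‖y‖ := by positivity
  have h1 : 2 * scaleRadius ρ y = ρ / (1 + ‖y‖) := by unfold scaleRadius; field_simp
  rw [h1] at ht
  rcases le_or_gt t 0 with h | h
  · exact (mul_nonpos_of_nonpos_of_nonneg h (norm_nonneg y)).trans_lt hρ
  · rw [lt_div_iff₀ h0] at ht
    nlinarith [norm_nonneg y]

namespace IsGaussianFamily

variable {Ψ : ℂ → (Fin n → ℝ) → ℂ} {ρ c Q : ℝ}

theorem nonneg (hΨ : IsGaussianFamily Ψ ρ c Q) (hρ : 0 < ρ) : 0 ≤ Q := by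
  have := (norm_nonneg _).trans (hΨ.bound 1 0 one_ne_zero (by simpa using hρ))
  simpa using this

theorem differentiableOn_ball (hΨ : IsGaussianFamily Ψ ρ c Q) (hρ : 0 < ρ) (y : Fin n → ℝ) :
    DifferentiableOn ℂ (fun h => Ψ h y) (ball 0 (2 * scaleRadius ρ y) \ {0}) :=
  (hΨ.differentiableOn y).mono fun h hh => ⟨hh.2,
    mul_norm_lt_of_lt_two_mul_scaleRadius hρ (by simpa using hh.1)⟩

theorem norm_le_ball (hΨ : IsGaussianFamily Ψ ρ c Q) (hρ : 0 < ρ) (y : Fin n → ℝ) :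
    ∀ h ∈ ball (0 : ℂ) (2 * scaleRadius ρ y) \ {0}, ‖Ψ h y‖ ≤ Q * Real.exp (-c * ‖y‖ ^ 2) :=
  fun h hh => hΨ.bound h y hh.2 (mul_norm_lt_of_lt_two_mul_scaleRadius hρ (by simpa using hh.1))

theorem scaleRadius_lt (hρ : 0 < ρ) (y : Fin n → ℝ) : scaleRadius ρ y < 2 * scaleRadius ρ y := by
  linarith [scaleRadius_pos hρ y]

/-- Cauchy's estimate on the circle of radius `ρ/(2(1+‖y‖))`. Shrinking the radius with `y` keeps
the circle in the domain of holomorphy, at the price of a power of `1 + ‖y‖` that the Gaussian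
absorbs. -/
theorem norm_scaleCoeff_le (hΨ : IsGaussianFamily Ψ ρ c Q) (hρ : 0 < ρ) (m : ℕ) (y : Fin n → ℝ) :
    ‖scaleCoeff Ψ ρ m y‖ ≤ Q * (2 / ρ) ^ m * ((1 + ‖y‖) ^ m * Real.exp (-c * ‖y‖ ^ 2)) := by
  have hη := scaleRadius_pos hρ y
  refine (norm_taylorCoeff_le hη (fun z hz => hΨ.norm_le_ball hρ y z ⟨?_, ?_⟩) m).trans
    (le_of_eq ?_)
  · simpa [hz] using scaleRadius_lt hρ y
  · rintro rfl
    rw [norm_zero] at hz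
    exact hη.ne hz
  · unfold scaleRadius
    rw [div_pow, div_pow, mul_pow]
    field_simp

theorem continuous_scaleCoeff (hΨ : IsGaussianFamily Ψ ρ c Q) (hρ : 0 < ρ) (m : ℕ) :
    Continuous (scaleCoeff Ψ ρ m) := by
  have hr : Continuous fun y : Fin n → ℝ => scaleRadius ρ y := by
    unfold scaleRadius
    exact continuous_const.div (by fun_prop) fun y => by positivity
  have hcm : Continuous fun p : (Fin n → ℝ) × ℝ => circleMap 0 (scaleRadius ρ p.1) p.2 := by
    unfold circleMap
    have := hr.comp (continuous_fst (X := Fin n → ℝ) (Y := ℝ))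
    fun_prop
  have hne : ∀ p : (Fin n → ℝ) × ℝ, circleMap 0 (scaleRadius ρ p.1) p.2 ≠ 0 := fun p =>
    circleMap_ne_center (scaleRadius_pos hρ p.1).ne'
  refine continuous_const.mul
    (intervalIntegral.continuous_parametric_intervalIntegral_of_continuous' ?_ _ _)
  refine Continuous.mul ?_ ((hcm.pow m).inv₀ fun p => pow_ne_zero m (hne p))
  refine hΨ.continuousOn.comp_continuous (hcm.prodMk continuous_fst) fun p => ⟨hne p, ?_⟩
  refine mul_norm_lt_of_lt_two_mul_scaleRadius hρ ?_
  simpa [abs_of_pos (scaleRadius_pos hρ p.1)] using scaleRadius_lt hρ p.1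

theorem integrable_scaleCoeff (hΨ : IsGaussianFamily Ψ ρ c Q) (hρ : 0 < ρ) (hc : 0 < c) (m : ℕ) :
    Integrable (scaleCoeff Ψ ρ m) :=
  ((integrable_one_add_norm_pow_mul_exp hc m).const_mul _).mono'
    (hΨ.continuous_scaleCoeff hρ m).aestronglyMeasurable
    (Eventually.of_forall fun y => hΨ.norm_scaleCoeff_le hρ m y)

theorem scaleCoeff_neg (hΨ : IsGaussianFamily Ψ ρ c Q) (m : ℕ) (y : Fin n → ℝ) :
    scaleCoeff Ψ ρ m (-y) = (-1) ^ m * scaleCoeff Ψ ρ m y := by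
  unfold scaleCoeff
  rw [← taylorCoeff_comp_neg]
  have : scaleRadius ρ (-y) = scaleRadius ρ y := by simp [scaleRadius]
  rw [this]
  simp only [hΨ.neg]

/-- Odd coefficients are odd functions of `y`; this is why only integral powers of `lam⁻¹` survive
when `h = lam^(-1/2)`. -/
theorem integral_scaleCoeff_odd (hΨ : IsGaussianFamily Ψ ρ c Q) (k : ℕ) :
    ∫ y, scaleCoeff Ψ ρ (2 * k + 1) y = 0 := by
  have h1 := integral_neg_eq_self (scaleCoeff Ψ ρ (2 * k + 1)) volume
  simp only [hΨ.scaleCoeff_neg] at h1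
  rw [integral_const_mul] at h1
  have h2 : ((-1 : ℂ)) ^ (2 * k + 1) = -1 := by rw [pow_succ, pow_mul]; simp
  rw [h2] at h1
  have h3 : (2 : ℂ) * ∫ y, scaleCoeff Ψ ρ (2 * k + 1) y = 0 := by linear_combination -h1
  simpa using h3

theorem norm_integral_scaleCoeff_le (hΨ : IsGaussianFamily Ψ ρ c Q) (hρ : 0 < ρ) (hc : 0 < c)
    (m : ℕ) : ‖∫ y, scaleCoeff Ψ ρ m y‖ ≤
      Q * (2 / ρ) ^ m * ∫ y : Fin n → ℝ, (1 + ‖y‖) ^ m * Real.exp (-c * ‖y‖ ^ 2) := by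
  rw [← integral_const_mul]
  exact norm_integral_le_of_norm_le ((integrable_one_add_norm_pow_mul_exp hc m).const_mul _)
    (Eventually.of_forall fun y => hΨ.norm_scaleCoeff_le hρ m y)

/-- If `h(1+‖y‖) ≤ ρ/8`, the cut-off equals `1` and `h` is at most half the radius of the circle, so
Taylor's remainder applies. Otherwise `β = 16h(1+‖y‖)/ρ` exceeds `1`, and the function and each of
the `2K` Taylor terms are separately bounded by the Gaussian times `β^(2K)`. -/
theorem norm_sub_sum_scaleCoeff_le (hΨ : IsGaussianFamily Ψ ρ c Q) (hρ : 0 < ρ)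
    {ψ : (Fin n → ℝ) → ℂ} (hψ : ∀ x, ‖ψ x‖ ≤ 1) (hψ1 : ∀ x, ‖x‖ ≤ ρ / 8 → ψ x = 1)
    (hψ0 : ∀ x, ρ ≤ ‖x‖ → ψ x = 0) {h : ℝ} (hh : 0 < h) (K : ℕ) (y : Fin n → ℝ) :
    ‖ψ (h • y) * Ψ h y - ∑ m ∈ Finset.range (2 * K), (h : ℂ) ^ m * scaleCoeff Ψ ρ m y‖ ≤
      (2 * K + 2) * Q * (16 * h / ρ) ^ (2 * K) *
        ((1 + ‖y‖) ^ (2 * K) * Real.exp (-c * ‖y‖ ^ 2)) := by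
  have hQ := hΨ.nonneg hρ
  have hη := scaleRadius_pos hρ y
  have hh0 : (h : ℂ) ≠ 0 := by exact_mod_cast hh.ne'
  have hnh : ‖(h : ℂ)‖ = h := by rw [Complex.norm_real, Real.norm_of_nonneg hh.le]
  set q := Q * Real.exp (-c * ‖y‖ ^ 2) with hq
  have hq0 : 0 ≤ q := by positivity
  set β := 16 * h / ρ * (1 + ‖y‖) with hβ
  have hβ0 : 0 ≤ β := by positivity
  have hrhs : (2 * K + 2) * Q * (16 * h / ρ) ^ (2 * K) *
        ((1 + ‖y‖) ^ (2 * K) * Real.exp (-c * ‖y‖ ^ 2)) = (2 * K + 2) * (q * β ^ (2 * K)) := by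
    rw [hβ, mul_pow]; ring
  rw [hrhs]
  have hle : h / scaleRadius ρ y = β / 8 := by
    rw [hβ, scaleRadius]; field_simp; norm_num
  rcases le_or_gt (h * (1 + ‖y‖)) (ρ / 8) with hcase | hcase
  · have h1 : ψ (h • y) = 1 := by
      refine hψ1 _ ?_
      rw [norm_smul, Real.norm_of_nonneg hh.le]
      nlinarith [norm_nonneg y]
    rw [h1, one_mul]
    have h2 : ‖(h : ℂ)‖ ≤ scaleRadius ρ y / 2 := by
      rw [hnh, scaleRadius, div_div, le_div_iff₀ (by positivity)]
      nlinarith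
    have h3 := norm_sub_sum_taylorCoeff_le hη (scaleRadius_lt hρ y) (hΨ.differentiableOn_ball hρ y)
      (hΨ.norm_le_ball hρ y) hh0 h2 (2 * K)
    refine h3.trans ?_
    rw [hnh, hle]
    have h4 : (β / 8) ^ (2 * K) ≤ β ^ (2 * K) := by gcongr; linarith
    calc 2 * q * (β / 8) ^ (2 * K) ≤ 2 * q * β ^ (2 * K) := by gcongr
      _ ≤ (2 * K + 2) * (q * β ^ (2 * K)) := by
        rw [mul_assoc]
        gcongr
        linarith [Nat.cast_nonneg (α := ℝ) K]
  · have hβ1 : 1 ≤ β := by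
      rw [hβ, div_mul_eq_mul_div, le_div_iff₀ hρ]
      nlinarith
    have h1 : ‖ψ (h • y) * Ψ h y‖ ≤ q := by
      rcases lt_or_ge (h * ‖y‖) ρ with h2 | h2
      · rw [norm_mul]
        calc _ ≤ 1 * q := by
              gcongr
              · exact hψ _
              · exact hΨ.bound _ y hh0 (by rwa [hnh])
          _ = q := one_mul q
      · rw [hψ0 _ (by rwa [norm_smul, Real.norm_of_nonneg hh.le]), zero_mul, norm_zero]
        exact hq0
    have h2 : ‖∑ m ∈ Finset.range (2 * K), (h : ℂ) ^ m * scaleCoeff Ψ ρ m y‖ ≤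
        ∑ m ∈ Finset.range (2 * K), q * β ^ (2 * K) := by
      refine norm_sum_le_of_le _ fun m hm => ?_
      rw [norm_mul, norm_pow, hnh]
      calc h ^ m * ‖scaleCoeff Ψ ρ m y‖ ≤
            h ^ m * (Q * (2 / ρ) ^ m * ((1 + ‖y‖) ^ m * Real.exp (-c * ‖y‖ ^ 2))) := by
            gcongr; exact hΨ.norm_scaleCoeff_le hρ m y
        _ = q * (β / 8) ^ m := by
            have : β / 8 = h * (2 / ρ) * (1 + ‖y‖) := by rw [hβ]; ring
            rw [this, mul_pow, mul_pow, hq]; ring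
        _ ≤ q * β ^ m := by gcongr; linarith
        _ ≤ q * β ^ (2 * K) := by
            gcongr
            exact (Finset.mem_range.1 hm).le
    rw [Finset.sum_const, Finset.card_range, nsmul_eq_mul] at h2
    have h3 : q ≤ q * β ^ (2 * K) := le_mul_of_one_le_right hq0 (one_le_pow₀ hβ1)
    refine (norm_sub_le _ _).trans ((add_le_add (h1.trans h3) h2).trans ?_)
    push_cast
    nlinarith [mul_nonneg hq0 (pow_nonneg hβ0 (2 * K))]

theorem sum_integral_scaleCoeff (hΨ : IsGaussianFamily Ψ ρ c Q) (h : ℂ) (K : ℕ) :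
    ∑ m ∈ Finset.range (2 * K), h ^ m * ∫ y, scaleCoeff Ψ ρ m y =
      ∑ k ∈ Finset.range K, h ^ (2 * k) * ∫ y, scaleCoeff Ψ ρ (2 * k) y := by
  induction K with
  | zero => simp
  | succ K ih =>
    rw [mul_add, mul_one, Finset.sum_range_succ, Finset.sum_range_succ, ih,
      hΨ.integral_scaleCoeff_odd, mul_zero, add_zero, Finset.sum_range_succ]

theorem integrable_cutoff_mul (hΨ : IsGaussianFamily Ψ ρ c Q) (hρ : 0 < ρ) (hc : 0 < c)
    {ψ : (Fin n → ℝ) → ℂ} (hψc : Continuous ψ) (hψ : ∀ x, ‖ψ x‖ ≤ 1)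
    (hψ0 : tsupport ψ ⊆ ball 0 ρ) {h : ℝ} (hh : 0 < h) :
    Integrable fun y => ψ (h • y) * Ψ h y := by
  have hQ := hΨ.nonneg hρ
  have hh0 : (h : ℂ) ≠ 0 := by exact_mod_cast hh.ne'
  have hnh : ‖(h : ℂ)‖ = h := by rw [Complex.norm_real, Real.norm_of_nonneg hh.le]
  have hψ0' : ∀ x, ρ ≤ ‖x‖ → ψ x = 0 := fun x hx => image_eq_zero_of_notMem_tsupport fun h' => by
    have := hψ0 h'
    rw [mem_ball_zero_iff] at this
    linarith
  have hcont : Continuous fun y => ψ (h • y) * Ψ h y := by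
    have hU : IsOpen {y : Fin n → ℝ | h • y ∈ ball (0 : Fin n → ℝ) ρ} :=
      isOpen_ball.preimage (by fun_prop)
    refine ContinuousOn.continuous_of_tsupport_subset (s := {y | h • y ∈ ball 0 ρ}) ?_ hU ?_
    · refine (hψc.comp (by fun_prop)).continuousOn.mul ?_
      refine hΨ.continuousOn.comp (f := fun y : Fin n → ℝ => ((h : ℂ), y)) (by fun_prop) fun y hy => ⟨hh0, ?_⟩
      have hy' : h • y ∈ ball (0 : Fin n → ℝ) ρ := hy
      rw [mem_ball_zero_iff, norm_smul, Real.norm_of_nonneg hh.le] at hy'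
      simpa [hnh, abs_of_pos hh] using hy'
    · refine (tsupport_mul_subset_left (f := fun y => ψ (h • y))).trans ?_
      refine (closure_minimal (fun y hy => ?_) ((isClosed_tsupport ψ).preimage
        (by fun_prop : Continuous fun y : Fin n → ℝ => h • y))).trans
        (preimage_mono (f := fun y : Fin n → ℝ => h • y) hψ0)
      exact subset_tsupport ψ hy
  refine ((integrable_exp_neg_mul_norm_sq (n := n) hc).const_mul Q).mono'
    hcont.aestronglyMeasurable (Eventually.of_forall fun y => ?_)
  rcases lt_or_ge (h * ‖y‖) ρ with h2 | h2
  · rw [norm_mul]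
    calc _ ≤ 1 * (Q * Real.exp (-c * ‖y‖ ^ 2)) := by
          gcongr
          · exact hψ _
          · exact hΨ.bound _ y hh0 (by rwa [hnh])
      _ = _ := one_mul _
  · rw [hψ0' _ (by rwa [norm_smul, Real.norm_of_nonneg hh.le]), zero_mul, norm_zero]
    positivity

/-- The asymptotic expansion of a rescaled Gaussian integral, with an explicit remainder. -/
theorem norm_integral_sub_sum_le (hΨ : IsGaussianFamily Ψ ρ c Q) (hρ : 0 < ρ) (hc : 0 < c)
    {ψ : (Fin n → ℝ) → ℂ} (hψc : Continuous ψ) (hψ : ∀ x, ‖ψ x‖ ≤ 1)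
    (hψ1 : ∀ x, ‖x‖ ≤ ρ / 8 → ψ x = 1) (hψ0 : tsupport ψ ⊆ ball 0 ρ) {h : ℝ} (hh : 0 < h) (K : ℕ) :
    ‖(∫ y, ψ (h • y) * Ψ h y) -
        ∑ k ∈ Finset.range K, (h : ℂ) ^ (2 * k) * ∫ y, scaleCoeff Ψ ρ (2 * k) y‖ ≤
      (2 * K + 2) * Q * (16 * h / ρ) ^ (2 * K) *
        ∫ y : Fin n → ℝ, (1 + ‖y‖) ^ (2 * K) * Real.exp (-c * ‖y‖ ^ 2) := by
  have hψ0' : ∀ x, ρ ≤ ‖x‖ → ψ x = 0 := fun x hx => image_eq_zero_of_notMem_tsupport fun h' => by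
    have := hψ0 h'
    rw [mem_ball_zero_iff] at this
    linarith
  have hci : ∀ m, Integrable fun y => (h : ℂ) ^ m * scaleCoeff Ψ ρ m y := fun m =>
    (hΨ.integrable_scaleCoeff hρ hc m).const_mul _
  have h1 : ∑ m ∈ Finset.range (2 * K), (h : ℂ) ^ m * ∫ y, scaleCoeff Ψ ρ m y =
      ∫ y, ∑ m ∈ Finset.range (2 * K), (h : ℂ) ^ m * scaleCoeff Ψ ρ m y := by
    rw [integral_finsetSum _ fun m _ => hci m]
    exact Finset.sum_congr rfl fun m _ => (integral_const_mul _ _).symm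
  rw [← hΨ.sum_integral_scaleCoeff, h1, ← integral_sub (hΨ.integrable_cutoff_mul hρ hc hψc hψ hψ0 hh) (integrable_finsetSum _ fun m _ => hci m),
    ← integral_const_mul]
  exact norm_integral_le_of_norm_le ((integrable_one_add_norm_pow_mul_exp hc _).const_mul _)
    (Eventually.of_forall fun y => hΨ.norm_sub_sum_scaleCoeff_le hρ hψ hψ1 hψ0' hh K y)

end IsGaussianFamily

end Expansion

/-! ### Analytic dependence of the expansion coefficients on parameters -/

section Expansion

open Metric Set MeasureTheory

/-- Writing out the mean value over the circle turns the coefficient into an integral over `(y, θ)`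
of functions holomorphic in `b`, dominated by a Gaussian moment independent of `b`;
`analyticOnNhd_ball_integral` applies. -/
theorem analyticOnNhd_integral_scaleCoeff {n n' : ℕ} {Ψ : (Fin n' → ℂ) → ℂ → (Fin n → ℝ) → ℂ}
    {ρ κ Q R : ℝ} {c : Fin n' → ℂ} (hρ : 0 < ρ) (hκ : 0 < κ)
    (hΨ : ∀ b ∈ closedBall c R, IsGaussianFamily (Ψ b) ρ κ Q)
    (hcont : ContinuousOn (fun p : (Fin n' → ℂ) × ℂ × (Fin n → ℝ) => Ψ p.1 p.2.1 p.2.2)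
      {p | p.1 ∈ closedBall c R ∧ p.2.1 ≠ 0 ∧ ‖p.2.1‖ * ‖p.2.2‖ < ρ})
    (hdiff : ∀ h y, h ≠ 0 → ‖h‖ * ‖y‖ < ρ → DifferentiableOn ℂ (fun b => Ψ b h y) (closedBall c R))
    (m : ℕ) :
    AnalyticOnNhd ℂ (fun b => ∫ y, scaleCoeff (Ψ b) ρ m y) (ball c R) := by
  rcases le_or_gt R 0 with hR | hR
  · rw [ball_eq_empty.2 hR]; exact fun x hx => hx.elim
  set ν : Measure ℝ := volume.restrict (Ioc 0 (2 * Real.pi)) with hν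
  have : IsFiniteMeasure ν := ⟨by rw [hν, Measure.restrict_apply_univ]; exact measure_Ioc_lt_top⟩
  set z : (Fin n → ℝ) × ℝ → ℂ := fun p => circleMap 0 (scaleRadius ρ p.1) p.2 with hz
  have hr : Continuous fun y : Fin n → ℝ => scaleRadius ρ y := by
    unfold scaleRadius
    exact continuous_const.div (by fun_prop) fun y => by positivity
  have hzc : Continuous z := by
    simp only [hz]
    unfold circleMap
    have := hr.comp (continuous_fst (X := Fin n → ℝ) (Y := ℝ))
    fun_prop
  have hz0 : ∀ p, z p ≠ 0 := fun p => circleMap_ne_center (scaleRadius_pos hρ p.1).ne'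
  have hzn : ∀ p, ‖z p‖ = scaleRadius ρ p.1 := fun p => by
    simp [hz, abs_of_pos (scaleRadius_pos hρ p.1)]
  have hzρ : ∀ p, ‖z p‖ * ‖p.1‖ < ρ := fun p =>
    mul_norm_lt_of_lt_two_mul_scaleRadius hρ (by
      rw [hzn]; exact IsGaussianFamily.scaleRadius_lt hρ p.1)
  set f : (Fin n → ℝ) × ℝ → (Fin n' → ℂ) → ℂ := fun p b =>
    (2 * Real.pi : ℂ)⁻¹ * (Ψ b (z p) p.1 * (z p ^ m)⁻¹) with hf
  set g : (Fin n → ℝ) × ℝ → ℝ := fun p =>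
    (2 * Real.pi)⁻¹ * (Q * (2 / ρ) ^ m * ((1 + ‖p.1‖) ^ m * Real.exp (-κ * ‖p.1‖ ^ 2)) * 1) with hg
  have hgi : Integrable g (volume.prod ν) :=
    ((((integrable_one_add_norm_pow_mul_exp hκ m).const_mul _).mul_prod
      (integrable_const (1 : ℝ))).const_mul _)
  have hfc : Continuous fun p : ((Fin n → ℝ) × ℝ) × closedBall c R => f p.1 p.2 := by
    refine continuous_const.mul (Continuous.mul ?_ ?_)
    · exact hcont.comp_continuous (f := fun p : ((Fin n → ℝ) × ℝ) × closedBall c R =>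
        ((p.2 : Fin n' → ℂ), z p.1, p.1.1)) (by fun_prop) fun p => ⟨p.2.2, hz0 _, hzρ _⟩
    · exact ((hzc.comp continuous_fst).pow m).inv₀ fun p => pow_ne_zero m (hz0 _)
  have hfg : ∀ p, ∀ b ∈ closedBall c R, ‖f p b‖ ≤ g p := by
    intro p b hb
    have h1 := (hΨ b hb).bound (z p) p.1 (hz0 p) (hzρ p)
    have h3 : ‖(2 * Real.pi : ℂ)⁻¹‖ = (2 * Real.pi)⁻¹ := by
      simp [abs_of_pos Real.pi_pos]
    have h4 : (scaleRadius ρ p.1 ^ m)⁻¹ = (2 / ρ) ^ m * (1 + ‖p.1‖) ^ m := by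
      unfold scaleRadius
      rw [div_pow, div_pow, mul_pow]; field_simp
    simp only [hf, hg]
    rw [norm_mul, norm_mul, norm_inv (z p ^ m), norm_pow, hzn, h3, h4, mul_one]
    refine mul_le_mul_of_nonneg_left ?_ (by positivity)
    calc _ ≤ Q * Real.exp (-κ * ‖p.1‖ ^ 2) * ((2 / ρ) ^ m * (1 + ‖p.1‖) ^ m) := by gcongr
      _ = _ := by ring
  have key := analyticOnNhd_ball_integral (R := R) (volume.prod ν) f c g ?_ ?_ hgi hfg
  · refine key.congr isOpen_ball fun b hb => ?_
    have hbc := ball_subset_closedBall hb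
    have hfi : Integrable (fun p => f p b) (volume.prod ν) :=
      hgi.mono' (hfc.comp (f := fun p => (p, (⟨b, hbc⟩ : closedBall c R)))
        (by fun_prop)).aestronglyMeasurable (Eventually.of_forall fun p => hfg p b hbc)
    rw [integral_prod _ hfi]
    congr 1; ext y
    rw [scaleCoeff, taylorCoeff, intervalIntegral.integral_of_le Real.two_pi_pos.le,
      ← integral_const_mul]
  · intro p
    exact DifferentiableOn.const_mul ((hdiff _ _ (hz0 p) (hzρ p)).mul_const _) _
  · have hmem : ∀ θ : Fin n' → ℝ, torusMap c (fun _ => R) θ ∈ closedBall c R := by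
      intro θ
      refine (dist_pi_le_iff hR.le).2 fun i => ?_
      simp [torusMap, dist_eq_norm, abs_of_pos hR]
    have hT : Continuous fun θ : Fin n' → ℝ => torusMap c (fun _ => R) θ := by
      unfold torusMap; fun_prop
    exact (hfc.comp (f := fun p : ((Fin n → ℝ) × ℝ) × (Fin n' → ℝ) =>
      (p.1, (⟨torusMap c (fun _ => R) p.2, hmem _⟩ : closedBall c R))) (by fun_prop)).aestronglyMeasurable

end Expansion

/-! ### The holomorphic critical point -/

section CriticalPoint

variable {N N' : ℕ}

/-- The inclusion of `ℝⁿ` into `ℂⁿ` as a continuous real linear map. -/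
noncomputable def toComplexL (n : ℕ) : (Fin n → ℝ) →L[ℝ] (Fin n → ℂ) :=
  ContinuousLinearMap.pi fun i => Complex.ofRealCLM.comp (ContinuousLinearMap.proj i)

theorem continuous_toComplex {n : ℕ} : Continuous (toComplex (n := n)) := (toComplexL n).continuous

theorem toComplex_sub {n : ℕ} (x y : Fin n → ℝ) : toComplex (x - y) = toComplex x - toComplex y :=
  (toComplexL n).map_sub x y

theorem toComplex_add {n : ℕ} (x y : Fin n → ℝ) : toComplex (x + y) = toComplex x + toComplex y :=
  (toComplexL n).map_add x y

theorem toComplex_smul {n : ℕ} (t : ℝ) (x : Fin n → ℝ) : toComplex (t • x) = (t : ℂ) • toComplex x := by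
  ext i; simp [toComplex]

theorem toComplex_neg {n : ℕ} (x : Fin n → ℝ) : toComplex (-x) = -toComplex x :=
  (toComplexL n).map_neg x

theorem norm_toComplex {n : ℕ} (x : Fin n → ℝ) : ‖toComplex x‖ = ‖x‖ := by
  refine le_antisymm ?_ ?_
  · refine (pi_norm_le_iff_of_nonneg (norm_nonneg x)).2 fun i => ?_
    simpa [toComplex] using norm_le_pi_norm x i
  · refine (pi_norm_le_iff_of_nonneg (norm_nonneg _)).2 fun i => ?_
    simpa [toComplex] using norm_le_pi_norm (toComplex x) i

theorem dist_toComplex {n : ℕ} (x y : Fin n → ℝ) : dist (toComplex x) (toComplex y) = dist x y := by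
  rw [dist_eq_norm, ← toComplex_sub, norm_toComplex, dist_eq_norm]

theorem phaseGrad_eq {Φ : (Fin N → ℂ) × (Fin N' → ℂ) → ℂ} {a : Fin N → ℂ} {b : Fin N' → ℂ}
    (h : DifferentiableAt ℂ Φ (a, b)) :
    phaseGrad Φ a b = (fderiv ℂ Φ (a, b)).comp (ContinuousLinearMap.inl ℂ _ _) := by
  have h1 : HasFDerivAt (fun x => Φ (x, b)) _ a := h.hasFDerivAt.comp a (hasFDerivAt_prodMk_left a b)
  exact h1.fderiv

theorem analyticOnNhd_phaseGrad {Φ : (Fin N → ℂ) × (Fin N' → ℂ) → ℂ}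
    {U : Set ((Fin N → ℂ) × (Fin N' → ℂ))} (hU : IsOpen U) (hΦ : AnalyticOnNhd ℂ Φ U) :
    AnalyticOnNhd ℂ (fun p : (Fin N → ℂ) × (Fin N' → ℂ) => phaseGrad Φ p.1 p.2) U := by
  intro p hp
  have h1 : AnalyticAt ℂ (fun p => (fderiv ℂ Φ p).comp
      (ContinuousLinearMap.inl ℂ (Fin N → ℂ) (Fin N' → ℂ))) p :=
    (((ContinuousLinearMap.compL ℂ (Fin N → ℂ) ((Fin N → ℂ) × (Fin N' → ℂ)) ℂ).flip
      (ContinuousLinearMap.inl ℂ (Fin N → ℂ) (Fin N' → ℂ))).analyticAt _).comp (hΦ.fderiv p hp)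
  refine h1.congr ?_
  filter_upwards [hU.mem_nhds hp] with q hq
  exact (phaseGrad_eq (hΦ q hq).differentiableAt).symm

/-- The second derivative in `a` as a bilinear form is nondegenerate if the Hessian matrix is. -/
theorem fderiv_phaseGrad_injective {Φ : (Fin N → ℂ) × (Fin N' → ℂ) → ℂ} {a : Fin N → ℂ}
    {b : Fin N' → ℂ} (h : DifferentiableAt ℂ (fun x => phaseGrad Φ x b) a)
    (hdet : (phaseHessian Φ a b).det ≠ 0) (z : Fin N → ℂ)
    (hz : ∀ j, fderiv ℂ (fun x => phaseGrad Φ x b) a z (Pi.single j 1) = 0) : z = 0 := by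
  refine Matrix.eq_zero_of_vecMul_eq_zero hdet ?_
  ext j
  have h1 : ∀ i, phaseHessian Φ a b i j =
      fderiv ℂ (fun x => phaseGrad Φ x b) a (Pi.single i 1) (Pi.single j 1) := by
    intro i
    have := h.hasFDerivAt.clm_apply (hasFDerivAt_const (Pi.single j (1 : ℂ)) a)
    rw [phaseHessian, Matrix.of_apply, this.fderiv]
    simp
  simp only [Matrix.vecMul, dotProduct, h1, Pi.zero_apply]
  rw [← hz j]
  conv_rhs => rw [pi_eq_sum_univ' z]
  simp

/-- Implicit function theorem for the equation `∇_a Φ = 0`: the partial derivative in `a` is the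
Hessian, which is injective between spaces of equal dimension and hence invertible. -/
theorem exists_isCriticalPointMap {A₀C : Set (Fin N → ℂ)} {B₀C : Set (Fin N' → ℂ)}
    (hA₀C : IsOpen A₀C) (hB₀C : IsOpen B₀C) {Φ : (Fin N → ℂ) × (Fin N' → ℂ) → ℂ}
    (hΦ : AnalyticOnNhd ℂ Φ (A₀C ×ˢ B₀C)) {a₀ : Fin N → ℂ} {b₀ : Fin N' → ℂ} (ha₀ : a₀ ∈ A₀C)
    (hb₀ : b₀ ∈ B₀C) (hgrad : phaseGrad Φ a₀ b₀ = 0) (hhess : (phaseHessian Φ a₀ b₀).det ≠ 0) :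
    ∃ (AC : Set (Fin N → ℂ)) (BC : Set (Fin N' → ℂ)) (acrit : (Fin N' → ℂ) → (Fin N → ℂ)),
      IsOpen AC ∧ a₀ ∈ AC ∧ AC ⊆ A₀C ∧ IsOpen BC ∧ b₀ ∈ BC ∧ BC ⊆ B₀C ∧
      IsCriticalPointMap Φ a₀ b₀ AC BC acrit := by
  have hg := analyticOnNhd_phaseGrad (hA₀C.prod hB₀C) hΦ (a₀, b₀) ⟨ha₀, hb₀⟩
  let f : (Fin N' → ℂ) × (Fin N → ℂ) → ((Fin N → ℂ) →L[ℂ] ℂ) := fun p => phaseGrad Φ p.2 p.1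
  have hf : AnalyticAt ℂ f (b₀, a₀) :=
    AnalyticAt.fun_comp (g := fun p : (Fin N → ℂ) × (Fin N' → ℂ) => phaseGrad Φ p.1 p.2)
      (f := fun p : (Fin N' → ℂ) × (Fin N → ℂ) => (p.2, p.1)) hg
      (analyticAt_snd.prod analyticAt_fst)
  -- Here `⊤` is the analytic smoothness class, so the implicit function comes out holomorphic.
  have cdf : ContDiffAt ℂ ⊤ f (b₀, a₀) := hf.contDiffAt
  have hpart : HasFDerivAt (fun x => phaseGrad Φ x b₀)
      ((fderiv ℂ f (b₀, a₀)).comp (ContinuousLinearMap.inr ℂ (Fin N' → ℂ) (Fin N → ℂ))) a₀ :=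
    hf.differentiableAt.hasFDerivAt.comp a₀ (hasFDerivAt_prodMk_right b₀ a₀)
  have hinj : Function.Injective ((fderiv ℂ f (b₀, a₀)).comp
      (ContinuousLinearMap.inr ℂ (Fin N' → ℂ) (Fin N → ℂ))) := by
    rw [injective_iff_map_eq_zero]
    intro z hz
    refine fderiv_phaseGrad_injective hpart.differentiableAt hhess z fun j => ?_
    rw [hpart.fderiv, hz]; rfl
  have hinv : ((fderiv ℂ f (b₀, a₀)).comp
      (ContinuousLinearMap.inr ℂ (Fin N' → ℂ) (Fin N → ℂ))).IsInvertible := by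
    have hdim : Module.finrank ℂ (Fin N → ℂ) = Module.finrank ℂ ((Fin N → ℂ) →L[ℂ] ℂ) := by
      rw [← LinearMap.toContinuousLinearMap.finrank_eq]
      exact (Subspace.dual_finrank_eq).symm
    let e := (LinearEquiv.ofInjectiveOfFinrankEq _ hinj hdim).toContinuousLinearEquiv
    exact ⟨e, by ext; rfl⟩
  have htop : (⊤ : WithTop ℕ∞) ≠ 0 := by simp
  set ψ := cdf.implicitFunction htop hinv with hψ
  have h1 : ∀ᶠ v in 𝓝 (b₀, a₀), f v = f (b₀, a₀) ↔ ψ v.1 = v.2 :=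
    cdf.eventually_apply_eq_iff_implicitFunction htop hinv
  have h2 : AnalyticAt ℂ ψ b₀ := (cdf.contDiffAt_implicitFunction htop hinv).analyticAt
  have h3 : ψ b₀ = a₀ := cdf.implicitFunction_apply_self htop hinv
  obtain ⟨V, hV, U, hU, hVU⟩ := eventually_prod_iff.1 (by rwa [nhds_prod_eq] at h1)
  obtain ⟨AC, hACU, hACo, haAC⟩ := eventually_nhds_iff.1 (hU.and (hA₀C.mem_nhds ha₀))
  have h4 : ∀ᶠ b in 𝓝 b₀, ψ b ∈ AC :=
    h2.continuousAt.eventually (by rw [h3]; exact hACo.mem_nhds haAC)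
  obtain ⟨BC, hBC, hBCo, hbBC⟩ := eventually_nhds_iff.1
    (((hV.and h2.eventually_analyticAt).and h4).and (hB₀C.mem_nhds hb₀))
  refine ⟨AC, BC, ψ, hACo, haAC, fun a ha => (hACU a ha).2, hBCo, hbBC, fun b hb => (hBC b hb).2,
    ⟨fun b hb => (hBC b hb).1.1.2, fun b hb => (hBC b hb).1.2, h3, fun a ha b hb => ?_⟩⟩
  have h5 := hVU (hBC b hb).1.1.1 (hACU a ha).1
  have h6 : f (b₀, a₀) = 0 := hgrad
  rw [h6] at h5
  exact h5.trans eq_comm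

end CriticalPoint

/-! ### A linear flow that increases the imaginary part of the phase -/

section Deformation

variable {N N' : ℕ}

/-- The complex deformation `a₀ + exp(s L)(x - a₀)` of the real point `x`. -/
noncomputable def flow (L : (Fin N → ℂ) →L[ℂ] (Fin N → ℂ)) (a₀ : Fin N → ℝ) (s : ℝ) (x : Fin N → ℝ) :
    Fin N → ℂ :=
  toComplex a₀ + NormedSpace.exp (s • L) (toComplex (x - a₀))

theorem exp_zero_smul (L : (Fin N → ℂ) →L[ℂ] (Fin N → ℂ)) : NormedSpace.exp ((0 : ℝ) • L) = 1 :=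
  (congrArg NormedSpace.exp (zero_smul ℝ L)).trans NormedSpace.exp_zero

theorem flow_zero (L : (Fin N → ℂ) →L[ℂ] (Fin N → ℂ)) (a₀ x : Fin N → ℝ) :
    flow L a₀ 0 x = toComplex x := by
  simp [flow, exp_zero_smul, toComplex_sub]

theorem contDiff_exp_smul (L : (Fin N → ℂ) →L[ℂ] (Fin N → ℂ)) :
    ContDiff ℝ 1 fun s : ℝ => NormedSpace.exp (s • L) := by
  have h : ContDiff ℝ 1 (NormedSpace.exp : ((Fin N → ℂ) →L[ℂ] (Fin N → ℂ)) → _) :=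
    (AnalyticOnNhd.contDiff (𝕜 := ℝ) fun x _ => NormedSpace.exp_analytic (𝕂 := ℝ) x)
  exact h.comp (contDiff_id.smul contDiff_const)

theorem contDiff_flow (L : (Fin N → ℂ) →L[ℂ] (Fin N → ℂ)) (a₀ : Fin N → ℝ) :
    ContDiff ℝ 1 fun p : ℝ × (Fin N → ℝ) => flow L a₀ p.1 p.2 := by
  have h1 : ContDiff ℝ 1 fun p : ℝ × (Fin N → ℝ) => toComplex (p.2 - a₀) :=
    (toComplexL N).contDiff.comp (contDiff_snd.sub contDiff_const)
  have h2 : ContDiff ℝ 1 fun p : ℝ × (Fin N → ℝ) =>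
      (NormedSpace.exp (p.1 • L)).restrictScalars ℝ :=
    (ContinuousLinearMap.restrictScalarsL ℂ (Fin N → ℂ) (Fin N → ℂ) ℝ ℝ).contDiff.comp
      ((contDiff_exp_smul L).comp contDiff_fst)
  exact contDiff_const.add (h2.clm_apply h1)

theorem hasDerivAt_flow (L : (Fin N → ℂ) →L[ℂ] (Fin N → ℂ)) (a₀ : Fin N → ℝ) (s : ℝ) (x : Fin N → ℝ) :
    HasDerivAt (fun s => flow L a₀ s x) (L (flow L a₀ s x - toComplex a₀)) s := by
  have h := hasDerivAt_exp_smul_const' (𝕂 := ℝ) L s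
  have h2 := ((ContinuousLinearMap.apply ℂ (Fin N → ℂ) (toComplex (x - a₀))).restrictScalars
    ℝ).hasFDerivAt.comp_hasDerivAt s h
  have h3 := h2.const_add (toComplex a₀)
  have h4 : L (flow L a₀ s x - toComplex a₀) = (L * NormedSpace.exp (s • L)) (toComplex (x - a₀)) := by
    rw [flow, add_sub_cancel_left]
    rfl
  rw [h4]
  exact h3

/-- For real `ξ` and `M` the conjugate of the Hessian `D`, `D ξ (M ξ)` is the sum of the squares
`|(Dξ)_j|²`, which is at least `c₀ ‖ξ‖²` because `D` is injective. With `L = iM` this real part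
becomes the imaginary part of the rate of change of `Φ`. The bound survives, with half the constant,
near `a₀` and for short times, where `∇Φ` is close to its linearization and `exp(sL)` to the
identity. -/
theorem exists_deformation {Φ : (Fin N → ℂ) × (Fin N' → ℂ) → ℂ} {a₀ : Fin N → ℝ} {b : Fin N' → ℂ}
    (hdiff : DifferentiableAt ℂ (fun x => phaseGrad Φ x b) (toComplex a₀))
    (hgrad : phaseGrad Φ (toComplex a₀) b = 0)
    (hhess : (phaseHessian Φ (toComplex a₀) b).det ≠ 0) {ρ₁ : ℝ} (hρ₁ : 0 < ρ₁) :
    ∃ (L : (Fin N → ℂ) →L[ℂ] (Fin N → ℂ)) (δ c ρ₂ : ℝ), 0 < δ ∧ 0 < c ∧ 0 < ρ₂ ∧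
      (∀ s : ℝ, |s| ≤ 2 * δ → ∀ x, dist x a₀ ≤ ρ₂ → dist (flow L a₀ s x) (toComplex a₀) < ρ₁) ∧
      ∀ s : ℝ, |s| ≤ 2 * δ → ∀ x, dist x a₀ ≤ ρ₂ → c * dist x a₀ ^ 2 ≤
        (phaseGrad Φ (flow L a₀ s x) b (L (flow L a₀ s x - toComplex a₀))).im := by
  set D := fderiv ℂ (fun x => phaseGrad Φ x b) (toComplex a₀) with hD
  set F : (Fin N → ℂ) →ₗ[ℂ] (Fin N → ℂ) :=
    { toFun := fun z j => D z (Pi.single j 1)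
      map_add' := fun x y => by ext j; simp
      map_smul' := fun t x => by ext j; simp } with hF
  have hFap : ∀ z j, F z j = D z (Pi.single j 1) := fun _ _ => rfl
  obtain ⟨K, hK, hKF⟩ := F.exists_antilipschitzWith (by
    rw [LinearMap.ker_eq_bot']
    exact fun z hz => fderiv_phaseGrad_injective hdiff hhess z fun j => congrFun hz j)
  set M : (Fin N → ℂ) →L[ℂ] (Fin N → ℂ) := ContinuousLinearMap.pi fun j =>
    ∑ i, (starRingEnd ℂ (D (Pi.single i 1) (Pi.single j 1))) • ContinuousLinearMap.proj i with hM
  have hlin : ∀ (f : (Fin N → ℂ) →L[ℂ] ℂ) (z : Fin N → ℂ), f z = ∑ j, z j * f (Pi.single j 1) := by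
    intro f z
    conv_lhs => rw [pi_eq_sum_univ' z]
    simp [map_sum]
  have hDlin : ∀ z j, D z (Pi.single j 1) = ∑ i, z i * D (Pi.single i 1) (Pi.single j 1) := by
    intro z j
    exact hlin (D.flip (Pi.single j 1)) z
  have hpos : ∀ ξ : Fin N → ℝ, (K : ℝ)⁻¹ ^ 2 * ‖ξ‖ ^ 2 ≤ (D (toComplex ξ) (M (toComplex ξ))).re := by
    intro ξ
    have h1 : D (toComplex ξ) (M (toComplex ξ)) = ∑ j, ((‖F (toComplex ξ) j‖ ^ 2 : ℝ) : ℂ) := by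
      rw [hlin (D (toComplex ξ))]
      refine Finset.sum_congr rfl fun j _ => ?_
      have h2 : M (toComplex ξ) j = starRingEnd ℂ (F (toComplex ξ) j) := by
        rw [hFap, hDlin, map_sum]
        simp only [hM, ContinuousLinearMap.coe_pi', sum_apply,
          smul_apply, ContinuousLinearMap.proj_apply, smul_eq_mul, map_mul]
        refine Finset.sum_congr rfl fun i _ => ?_
        simp [toComplex, mul_comm]
      rw [h2, ← hFap, ← Complex.normSq_eq_conj_mul_self, Complex.normSq_eq_norm_sq]
    rw [h1, ← Complex.ofReal_sum, Complex.ofReal_re]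
    have h3 : ‖ξ‖ ≤ K * ‖F (toComplex ξ)‖ := by
      have := hKF.le_mul_dist (toComplex ξ) 0
      rwa [map_zero, dist_zero_right, dist_zero_right, norm_toComplex] at this
    have h4 : ‖F (toComplex ξ)‖ ^ 2 ≤ ∑ j, ‖F (toComplex ξ) j‖ ^ 2 := by
      have hs : 0 ≤ ∑ j, ‖F (toComplex ξ) j‖ ^ 2 := Finset.sum_nonneg fun _ _ => sq_nonneg _
      rw [← Real.le_sqrt (norm_nonneg _) hs, pi_norm_le_iff_of_nonneg (Real.sqrt_nonneg _)]
      intro j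
      exact Real.le_sqrt_of_sq_le
        (Finset.single_le_sum (f := fun j => ‖F (toComplex ξ) j‖ ^ 2) (fun _ _ => sq_nonneg _)
          (Finset.mem_univ j))
    refine le_trans ?_ h4
    rw [← mul_pow]
    have hK' : (0 : ℝ) < K := hK
    refine pow_le_pow_left₀ (by positivity) ?_ 2
    rwa [inv_mul_le_iff₀ hK']
  set c₀ : ℝ := (K : ℝ)⁻¹ ^ 2 with hc₀
  have hc₀pos : 0 < c₀ := by have : (0 : ℝ) < K := hK; positivity
  set L : (Fin N → ℂ) →L[ℂ] (Fin N → ℂ) := Complex.I • M with hL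
  -- The constants `12` here and `16` below make the two errors, from `exp(sL) - 1` and from the
  -- linearization, at most `c₀/4 · ‖v‖²` each, leaving `c₀/2` of the original `c₀`.
  have hexp : ∀ᶠ s : ℝ in 𝓝 0, ‖NormedSpace.exp (s • L) - 1‖ <
      min 1 (c₀ / (12 * (‖D‖ * ‖M‖ + 1))) := by
    have hc : Continuous fun s : ℝ => ‖NormedSpace.exp (s • L) - 1‖ :=
      (((contDiff_exp_smul L).continuous).sub continuous_const).norm
    refine hc.continuousAt.eventually_lt continuousAt_const ?_
    simp only [exp_zero_smul, sub_self, norm_zero]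
    positivity
  obtain ⟨δ', hδ', hexp⟩ := Metric.eventually_nhds_iff.1 hexp
  have hlit := (hdiff.hasFDerivAt.isLittleO.def
    (show (0 : ℝ) < c₀ / (16 * (‖M‖ + 1)) by positivity))
  obtain ⟨r₀, hr₀, hlit⟩ := Metric.eventually_nhds_iff.1 hlit
  have hz : ∀ s : ℝ, |s| ≤ 2 * (δ' / 4) → ∀ v : Fin N → ℂ,
      ‖NormedSpace.exp (s • L) v - v‖ ≤ min 1 (c₀ / (12 * (‖D‖ * ‖M‖ + 1))) * ‖v‖ := by
    intro s hs v
    have := (NormedSpace.exp (s • L) - 1).le_of_opNorm_le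
      (hexp (y := s) (by rw [Real.dist_eq, sub_zero]; linarith)).le v
    simpa using this
  have hz1 : ∀ s : ℝ, |s| ≤ 2 * (δ' / 4) → ∀ v : Fin N → ℂ,
      ‖NormedSpace.exp (s • L) v‖ ≤ 2 * ‖v‖ := by
    intro s hs v
    have h1 := (hz s hs v).trans (mul_le_mul_of_nonneg_right (min_le_left _ _) (norm_nonneg v))
    have h2 := norm_add_le (NormedSpace.exp (s • L) v - v) v
    rw [sub_add_cancel] at h2
    linarith
  refine ⟨L, δ' / 4, c₀ / 2, min (ρ₁ / 4) (r₀ / 4), by positivity, by positivity, by positivity,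
    fun s hs x hx => ?_, fun s hs x hx => ?_⟩
  · have h1 := hz1 s hs (toComplex (x - a₀))
    have h2 : ‖x - a₀‖ ≤ ρ₁ / 4 := by rw [← dist_eq_norm]; exact hx.trans (min_le_left _ _)
    rw [norm_toComplex] at h1
    rw [flow, dist_eq_norm, add_sub_cancel_left]
    linarith
  · set v := toComplex (x - a₀) with hv
    set z := NormedSpace.exp (s • L) v with hzdef
    have hfl : flow L a₀ s x - toComplex a₀ = z := by rw [flow, add_sub_cancel_left]
    have hvn : ‖v‖ = dist x a₀ := by rw [hv, norm_toComplex, dist_eq_norm]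
    have hzn := hz1 s hs v
    have hzr : dist (flow L a₀ s x) (toComplex a₀) < r₀ := by
      rw [dist_eq_norm, hfl]
      have := hx.trans (min_le_right _ _)
      linarith
    have h1 := hlit hzr
    rw [hgrad, sub_zero, hfl, ← hD] at h1
    have him : (phaseGrad Φ (flow L a₀ s x) b (L z)).im =
        (phaseGrad Φ (flow L a₀ s x) b (M z)).re := by
      simp [hL]
    rw [hfl, him, ← hvn]
    have h2 : ‖phaseGrad Φ (flow L a₀ s x) b (M z) - D z (M z)‖ ≤ c₀ / 4 * ‖v‖ ^ 2 := by
      have h3 := (phaseGrad Φ (flow L a₀ s x) b - D z).le_of_opNorm_le h1 (M z)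
      rw [sub_apply] at h3
      refine h3.trans ?_
      calc c₀ / (16 * (‖M‖ + 1)) * ‖z‖ * ‖M z‖
          ≤ c₀ / (16 * (‖M‖ + 1)) * (2 * ‖v‖) * ((‖M‖ + 1) * (2 * ‖v‖)) := by
            gcongr
            refine (M.le_opNorm z).trans ?_
            gcongr
            linarith
        _ = c₀ / 4 * ‖v‖ ^ 2 := by field_simp; ring
    have h4 : ‖D z (M z) - D v (M v)‖ ≤ c₀ / 4 * ‖v‖ ^ 2 := by
      have h5 : D z (M z) - D v (M v) = D (z - v) (M z) + D v (M (z - v)) := by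
        simp only [map_sub, sub_apply]; ring
      have h6 : ‖z - v‖ ≤ c₀ / (12 * (‖D‖ * ‖M‖ + 1)) * ‖v‖ :=
        (hz s hs v).trans (mul_le_mul_of_nonneg_right (min_le_right _ _) (norm_nonneg v))
      have hb : ∀ x y, ‖D x (M y)‖ ≤ ‖D‖ * ‖M‖ * ‖x‖ * ‖y‖ := fun x y => by
        calc ‖D x (M y)‖ ≤ ‖D‖ * ‖x‖ * ‖M y‖ := D.le_opNorm₂ x (M y)
          _ ≤ ‖D‖ * ‖x‖ * (‖M‖ * ‖y‖) := by gcongr; exact M.le_opNorm y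
          _ = _ := by ring
      rw [h5]
      refine (norm_add_le _ _).trans ?_
      have hb1 : ‖D (z - v) (M z)‖ ≤ (‖D‖ * ‖M‖ + 1) * (c₀ / (12 * (‖D‖ * ‖M‖ + 1)) * ‖v‖) * (2 * ‖v‖) := by
        refine (hb _ _).trans ?_
        gcongr
        linarith
      have hb2 : ‖D v (M (z - v))‖ ≤ (‖D‖ * ‖M‖ + 1) * ‖v‖ * (c₀ / (12 * (‖D‖ * ‖M‖ + 1)) * ‖v‖) := by
        refine (hb _ _).trans ?_
        gcongr
        linarith
      have e1 : (‖D‖ * ‖M‖ + 1) * (c₀ / (12 * (‖D‖ * ‖M‖ + 1)) * ‖v‖) * (2 * ‖v‖) = c₀ / 6 * ‖v‖ ^ 2 := by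
        field_simp; ring
      have e2 : (‖D‖ * ‖M‖ + 1) * ‖v‖ * (c₀ / (12 * (‖D‖ * ‖M‖ + 1)) * ‖v‖) = c₀ / 12 * ‖v‖ ^ 2 := by
        field_simp
      rw [e1] at hb1
      rw [e2] at hb2
      linarith
    have h7 := hpos (x - a₀)
    rw [← hv, ← dist_eq_norm, ← hvn] at h7
    have h8 := (Complex.abs_re_le_norm _).trans h2
    have h9 := (Complex.abs_re_le_norm _).trans h4
    rw [Complex.sub_re, abs_le] at h8 h9
    linarith [h8.1, h9.1]

/-- Integrating a lower bound for the rate of change of `Im Φ` along the deformation. -/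
theorem im_add_mul_le_im_flow {Φ : (Fin N → ℂ) × (Fin N' → ℂ) → ℂ} {a₀ x : Fin N → ℝ}
    {b : Fin N' → ℂ} {L : (Fin N → ℂ) →L[ℂ] (Fin N → ℂ)} {δ k : ℝ} 
    (hΦ : ∀ s ∈ Set.Icc 0 δ, DifferentiableAt ℂ Φ (flow L a₀ s x, b))
    (hk : ∀ s ∈ Set.Icc 0 δ,
      k ≤ (phaseGrad Φ (flow L a₀ s x) b (L (flow L a₀ s x - toComplex a₀))).im)
    {s : ℝ} (hs : s ∈ Set.Icc 0 δ) :
    (Φ (toComplex x, b)).im + k * s ≤ (Φ (flow L a₀ s x, b)).im := by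
  have hd : ∀ s ∈ Set.Icc 0 δ, HasDerivAt (fun s => (Φ (flow L a₀ s x, b)).im - k * s)
      ((phaseGrad Φ (flow L a₀ s x) b (L (flow L a₀ s x - toComplex a₀))).im - k) s := by
    intro s hs
    have h1 : HasFDerivAt (fun z => Φ (z, b)) (phaseGrad Φ (flow L a₀ s x) b) (flow L a₀ s x) :=
      ((hΦ s hs).comp (flow L a₀ s x) (hasFDerivAt_prodMk_left _ b).differentiableAt).hasFDerivAt
    have h2 := (h1.restrictScalars ℝ).comp_hasDerivAt s (hasDerivAt_flow L a₀ s x)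
    have h3 := Complex.imCLM.hasFDerivAt.comp_hasDerivAt s h2
    have h4 := h3.sub ((hasDerivAt_id s).const_mul k)
    rw [mul_one] at h4
    exact h4
  have hmono : MonotoneOn (fun s => (Φ (flow L a₀ s x, b)).im - k * s) (Set.Icc 0 δ) := by
    refine monotoneOn_of_deriv_nonneg (convex_Icc 0 δ)
      (fun s hs => (hd s hs).continuousAt.continuousWithinAt)
      (fun s hs => (hd s (interior_subset hs)).differentiableAt.differentiableWithinAt)
      fun s hs => ?_
    rw [(hd s (interior_subset hs)).deriv]
    linarith [hk s (interior_subset hs)]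
  have h := hmono (Set.left_mem_Icc.2 (hs.1.trans hs.2)) hs hs.1
  simp only [flow_zero] at h
  linarith

theorem IsCompact.eventually_forall_lt {Y Z : Type*} [TopologicalSpace Y] [TopologicalSpace Z]
    {K : Set Z} (hK : IsCompact K) {F : Z → Y → ℝ} {c : ℝ} {y : Y}
    (hF : ∀ z ∈ K, ContinuousAt (fun p : Y × Z => F p.2 p.1) (y, z)) (hc : ∀ z ∈ K, c < F z y) :
    ∀ᶠ y' in 𝓝 y, ∀ z ∈ K, c < F z y' :=
  hK.eventually_forall_of_forall_eventually fun z hz =>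
    (continuousAt_const.eventually_lt (hF z hz) (hc z hz))

end Deformation

/-! ### Gaussian decay on the deformed contour -/

section GaussianBound

variable {N N' : ℕ}

theorem hasFDerivAt_phaseGrad {Φ : (Fin N → ℂ) × (Fin N' → ℂ) → ℂ} {a : Fin N → ℂ} {b : Fin N' → ℂ}
    (h : DifferentiableAt ℂ Φ (a, b)) : HasFDerivAt (fun z => Φ (z, b)) (phaseGrad Φ a b) a :=
  (h.comp (f := fun z => (z, b)) a (hasFDerivAt_prodMk_left a b).differentiableAt).hasFDerivAt

/-- On the complex line through `acrit b` in a direction `Tu`, with `u` real of norm `1`, the phase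
minus its critical value is a function `g(ζ)` with a double zero, so `g(ζ)/ζ²` is within `c/8` of
its second Taylor coefficient for `‖ζ‖ ≤ t`. Hypothesis `hT` bounds `Im g(t)/t²` below at `b₀`;
compactness of the sphere extends this to nearby `b`, with `c/2`. Comparing both `g(t)/t²` and
`g(ζ)/ζ²` with the same coefficient leaves `c/4` for every complex `ζ = h‖y‖`. -/
theorem exists_gaussian_bound {Φ : (Fin N → ℂ) × (Fin N' → ℂ) → ℂ} {a₀ : Fin N → ℝ} {b₀ : Fin N' → ℂ}
    {acrit : (Fin N' → ℂ) → (Fin N → ℂ)} {T : (Fin N → ℂ) →L[ℂ] (Fin N → ℂ)} {ρ₁ ρ₂ c : ℝ}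
    (hρ₁ : 0 < ρ₁) (hρ₂ : 0 < ρ₂) (hc : 0 < c)
    (hΦ : AnalyticOnNhd ℂ Φ (Metric.closedBall (toComplex a₀) ρ₁ ×ˢ Metric.closedBall b₀ ρ₁))
    (hacrit : ContinuousAt acrit b₀) (hbase : acrit b₀ = toComplex a₀)
    (hcrit : ∀ᶠ b in 𝓝 b₀, phaseGrad Φ (acrit b) b = 0)
    (hT : ∀ x, dist x a₀ ≤ ρ₂ → (Φ (toComplex a₀, b₀)).im + c * dist x a₀ ^ 2 ≤
      (Φ (toComplex a₀ + T (toComplex (x - a₀)), b₀)).im) :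
    ∃ ρ κ : ℝ, 0 < ρ ∧ 0 < κ ∧ ∀ᶠ b in 𝓝 b₀, ∀ (h : ℂ) (y : Fin N → ℝ), h ≠ 0 → ‖h‖ * ‖y‖ < ρ →
      κ * ‖y‖ ^ 2 ≤ ((Φ (acrit b + h • T (toComplex y), b) - Φ (acrit b, b)) / h ^ 2).im := by
  obtain ⟨Q₀, hQ₀⟩ := ((isCompact_closedBall (toComplex a₀) ρ₁).prod
    (isCompact_closedBall b₀ ρ₁)).exists_bound_of_continuousOn hΦ.continuousOn
  have hQ₀' : 0 ≤ Q₀ := (norm_nonneg _).trans (hQ₀ (toComplex a₀, b₀)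
    ⟨Metric.mem_closedBall_self hρ₁.le, Metric.mem_closedBall_self hρ₁.le⟩)
  set η : ℝ := ρ₁ / (4 * (‖T‖ + 1)) with hη
  have hηpos : 0 < η := by positivity
  -- The last entry makes the cubic Taylor remainder, at most `4(Q₀+1)‖ζ‖³/η³`, no larger than
  -- `(c/8)‖ζ‖²`.
  set t : ℝ := min ρ₂ (min (η / 2) (c * η ^ 3 / (32 * (Q₀ + 1)))) with ht
  have htpos : 0 < t := by positivity
  have ht1 : t ≤ ρ₂ := min_le_left _ _
  have ht2 : t ≤ η / 2 := (min_le_right _ _).trans (min_le_left _ _)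
  have ht3 : t ≤ c * η ^ 3 / (32 * (Q₀ + 1)) := (min_le_right _ _).trans (min_le_right _ _)
  have hTn : ∀ (ζ : ℂ) (u : Fin N → ℝ), ‖u‖ = 1 → ‖ζ‖ < 2 * η → ‖ζ • T (toComplex u)‖ < ρ₁ / 2 := by
    intro ζ u hu hζ
    have h1 : ‖T (toComplex u)‖ ≤ ‖T‖ + 1 := by
      have := T.le_opNorm (toComplex u)
      rw [norm_toComplex, hu] at this
      linarith
    rw [norm_smul]
    calc ‖ζ‖ * ‖T (toComplex u)‖ ≤ ‖ζ‖ * (‖T‖ + 1) := by gcongr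
      _ < 2 * η * (‖T‖ + 1) := by gcongr
      _ = ρ₁ / 2 := by rw [hη]; field_simp; ring
  have hmem : ∀ᶠ b in 𝓝 b₀, ∀ z : Fin N → ℂ, ‖z‖ < ρ₁ / 2 → (acrit b + z, b) ∈
      Metric.closedBall (toComplex a₀) ρ₁ ×ˢ Metric.closedBall b₀ ρ₁ := by
    filter_upwards [Metric.closedBall_mem_nhds b₀ hρ₁,
      hacrit.eventually_mem (by rw [hbase]; exact Metric.ball_mem_nhds _ (half_pos hρ₁))] with b hb hb' z hz
    refine ⟨?_, hb⟩
    rw [Metric.mem_ball, dist_eq_norm] at hb'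
    rw [Metric.mem_closedBall, dist_eq_norm]
    calc ‖acrit b + z - toComplex a₀‖ = ‖(acrit b - toComplex a₀) + z‖ := by congr 1; abel
      _ ≤ ‖acrit b - toComplex a₀‖ + ‖z‖ := norm_add_le _ _
      _ ≤ ρ₁ := by linarith
  have hmem₀ := hmem.self_of_nhds
  have hK : IsCompact (Metric.sphere (0 : Fin N → ℝ) 1) := isCompact_sphere _ _
  have hF := hK.eventually_forall_lt (y := b₀) (c := c / 2 * t ^ 2)
    (F := fun u b => (Φ (acrit b + (t : ℂ) • T (toComplex u), b) - Φ (acrit b, b)).im) (by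
      intro u hu
      have hu' : ‖u‖ = 1 := by simpa using hu
      refine Complex.continuous_im.continuousAt.comp' (ContinuousAt.sub ?_ ?_)
      · refine ContinuousAt.comp (g := Φ) (f := fun p : (Fin N' → ℂ) × (Fin N → ℝ) =>
            (acrit p.1 + (t : ℂ) • T (toComplex p.2), p.1)) ?_ ?_
        · exact (hΦ _ (hmem₀ _ (hTn _ _ hu' (by
            rw [Complex.norm_real, Real.norm_of_nonneg htpos.le]; linarith)))).continuousAt
        · refine ContinuousAt.prodMk (ContinuousAt.add ?_ ?_) continuousAt_fst
          · exact ContinuousAt.comp (f := Prod.fst) (g := acrit) hacrit continuousAt_fst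
          · exact (((T.continuous.comp continuous_toComplex).comp continuous_snd).const_smul
              (t : ℂ)).continuousAt
      · refine ContinuousAt.comp (g := Φ) (f := fun p : (Fin N' → ℂ) × (Fin N → ℝ) =>
            (acrit p.1, p.1)) ?_ ?_
        · have := hmem₀ 0 (by simpa using hρ₁)
          rw [add_zero] at this
          exact (hΦ _ this).continuousAt
        · exact (ContinuousAt.comp (f := Prod.fst) (g := acrit) hacrit continuousAt_fst).prodMk
            continuousAt_fst) (by
      intro u hu
      have hu' : ‖u‖ = 1 := by simpa using hu
      have h1 := hT (a₀ + t • u) (by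
        rw [dist_eq_norm, add_sub_cancel_left, norm_smul, hu', mul_one, Real.norm_of_nonneg htpos.le]
        exact ht1)
      rw [dist_eq_norm, add_sub_cancel_left, norm_smul, hu', mul_one, Real.norm_of_nonneg htpos.le,
        toComplex_smul, map_smul] at h1
      simp only [hbase, Complex.sub_im]
      have : 0 < c * t ^ 2 := by positivity
      linarith)
  refine ⟨t, c / 4, htpos, by positivity, ?_⟩
  filter_upwards [hmem, hcrit, hF] with b hb hbc hbF h y hh hhy
  rcases eq_or_ne y 0 with rfl | hy
  · have : toComplex (0 : Fin N → ℝ) = 0 := (toComplexL N).map_zero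
    simp [this]
  have hyn : 0 < ‖y‖ := norm_pos_iff.2 hy
  have hyn' : (‖y‖ : ℂ) ≠ 0 := by exact_mod_cast hyn.ne'
  set u : Fin N → ℝ := ‖y‖⁻¹ • y with hu
  have hu1 : ‖u‖ = 1 := by rw [hu, norm_smul, norm_inv, norm_norm, inv_mul_cancel₀ hyn.ne']
  have hyu : toComplex y = (‖y‖ : ℂ) • toComplex u := by
    rw [hu, toComplex_smul, smul_smul, Complex.ofReal_inv, mul_inv_cancel₀ hyn', one_smul]
  set g : ℂ → ℂ := fun ζ => Φ (acrit b + ζ • T (toComplex u), b) - Φ (acrit b, b) with hg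
  have hb0 : (acrit b, b) ∈ Metric.closedBall (toComplex a₀) ρ₁ ×ˢ Metric.closedBall b₀ ρ₁ := by
    have := hb 0 (by simpa using hρ₁)
    rwa [add_zero] at this
  have hmemζ : ∀ ζ ∈ Metric.ball (0 : ℂ) (2 * η), (acrit b + ζ • T (toComplex u), b) ∈
      Metric.closedBall (toComplex a₀) ρ₁ ×ˢ Metric.closedBall b₀ ρ₁ := fun ζ hζ =>
    hb _ (hTn ζ u hu1 (by simpa using hζ))
  have hin : ∀ ζ, HasDerivAt (fun ζ : ℂ => (acrit b + ζ • T (toComplex u))) (T (toComplex u)) ζ := fun ζ => by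
    simpa using ((hasDerivAt_id ζ).smul_const (T (toComplex u))).const_add (acrit b)
  have hgd : ∀ ζ ∈ Metric.ball (0 : ℂ) (2 * η), HasDerivAt g
      (phaseGrad Φ (acrit b + ζ • T (toComplex u)) b (T (toComplex u))) ζ := by
    intro ζ hζ
    exact ((hasFDerivAt_phaseGrad (hΦ _ (hmemζ ζ hζ)).differentiableAt).comp_hasDerivAt ζ (hin ζ)).sub_const _
  have hg0 : g 0 = 0 := by simp [hg]
  have hg1 : deriv g 0 = 0 := by
    rw [(hgd 0 (Metric.mem_ball_self (by positivity))).deriv]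
    simp [hbc]
  have hgQ : ∀ ζ ∈ Metric.ball (0 : ℂ) (2 * η), ‖g ζ‖ ≤ 2 * (Q₀ + 1) := fun ζ hζ => by
    refine (norm_sub_le _ _).trans ?_
    linarith [hQ₀ _ (hmemζ ζ hζ), hQ₀ _ hb0]
  have hest : ∀ ζ : ℂ, ζ ≠ 0 → ‖ζ‖ ≤ t → ‖g ζ / ζ ^ 2 - taylorCoeff g η 2‖ ≤ c / 8 := by
    intro ζ hζ hζt
    have h1 := (norm_sub_sq_mul_taylorCoeff_le hηpos (by linarith : η < 2 * η)
      (fun ζ hζ => (hgd ζ hζ).differentiableAt.differentiableWithinAt) hgQ hg0 hg1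
      (hζt.trans ht2)).2
    have h2 : g ζ / ζ ^ 2 - taylorCoeff g η 2 = (g ζ - ζ ^ 2 * taylorCoeff g η 2) / ζ ^ 2 := by
      field_simp
    have hζ' : 0 < ‖ζ‖ := norm_pos_iff.2 hζ
    rw [h2, norm_div, norm_pow, div_le_iff₀ (by positivity)]
    refine h1.trans ?_
    have h3 : 2 * (2 * (Q₀ + 1)) * (‖ζ‖ / η) ^ 3 = (4 * (Q₀ + 1) / η ^ 3 * ‖ζ‖) * ‖ζ‖ ^ 2 := by
      field_simp; ring
    rw [h3]
    gcongr
    calc 4 * (Q₀ + 1) / η ^ 3 * ‖ζ‖ ≤ 4 * (Q₀ + 1) / η ^ 3 * (c * η ^ 3 / (32 * (Q₀ + 1))) := by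
          gcongr; exact hζt.trans ht3
      _ = c / 8 := by field_simp; ring
  have htn : ‖(t : ℂ)‖ = t := by rw [Complex.norm_real, Real.norm_of_nonneg htpos.le]
  have e1 := (Complex.abs_im_le_norm _).trans (hest t (by exact_mod_cast htpos.ne') htn.le)
  have e2 := (Complex.abs_im_le_norm _).trans (hest (h * ‖y‖) (mul_ne_zero hh hyn') (by
    rw [norm_mul, Complex.norm_real, norm_norm]; exact hhy.le))
  have e3 : c / 2 < (g t / (t : ℂ) ^ 2).im := by
    have := hbF u (by simpa using hu1)
    rw [← Complex.ofReal_pow, Complex.div_ofReal_im, lt_div_iff₀ (by positivity)]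
    exact this
  rw [Complex.sub_im, abs_le] at e1 e2
  have e4 : (Φ (acrit b + h • T (toComplex y), b) - Φ (acrit b, b)) / h ^ 2 =
      ((‖y‖ ^ 2 : ℝ) : ℂ) * (g (h * ‖y‖) / (h * ‖y‖) ^ 2) := by
    rw [hg, hyu, map_smul, smul_smul]
    push_cast
    field_simp
  rw [e4, Complex.im_ofReal_mul, mul_comm]
  gcongr
  linarith [e1.1, e1.2, e2.1, e2.2]

end GaussianBound

/-! ### Transport equations for the flow and for translations -/

section Transport

variable {N : ℕ}

/-- The linear vector field whose complexified flow is `flow L a₀`. -/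
noncomputable def flowField (L : (Fin N → ℂ) →L[ℂ] (Fin N → ℂ)) (a₀ x : Fin N → ℝ) : Fin N → ℂ :=
  L (toComplex (x - a₀))

theorem toComplex_single (i : Fin N) :
    toComplex (Pi.single i (1 : ℝ)) = (Pi.single i (1 : ℂ) : Fin N → ℂ) := by
  ext j
  by_cases h : j = i
  · subst h; simp [toComplex]
  · simp [toComplex, h]

theorem clm_eq_sum_single {F : Type*} [NormedAddCommGroup F] [NormedSpace ℂ F]
    (T : (Fin N → ℂ) →L[ℂ] F) (z : Fin N → ℂ) : T z = ∑ i, z i • T (Pi.single i 1) := by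
  conv_lhs => rw [pi_eq_sum_univ' z]
  simp [map_sum]

theorem isAffineField_flowField (L : (Fin N → ℂ) →L[ℂ] (Fin N → ℂ)) (a₀ : Fin N → ℝ) :
    IsAffineField (flowField L a₀) fun l i => L (Pi.single l 1) i := by
  refine ⟨-L (toComplex a₀), fun x i => ?_⟩
  rw [flowField, toComplex_sub, map_sub, clm_eq_sum_single L (toComplex x)]
  simp [toComplex]
  ring

theorem isAffineField_const (w : Fin N → ℂ) : IsAffineField (fun _ => w) fun _ _ => 0 :=
  ⟨w, fun x i => by simp⟩

/-- Chain rule: the derivative of the holomorphic `g` is complex linear, so a relation with complex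
coefficients between the derivatives of the contour `γ` passes to `g ∘ γ`. -/
theorem isTransported_comp {γ : ℝ × (Fin N → ℝ) → (Fin N → ℂ)} {V : Set (ℝ × (Fin N → ℝ))}
    {W : (Fin N → ℝ) → Fin N → ℂ} (hγ : ContDiff ℝ 1 γ) {v : ℝ × (Fin N → ℝ) → (Fin N → ℂ)}
    {w : ℝ × (Fin N → ℝ) → Fin N → (Fin N → ℂ)}
    (hv : ∀ p ∈ V, HasDerivAt (fun s => γ (s, p.2)) (v p) p.1)
    (hw : ∀ p ∈ V, ∀ i, HasDerivAt (fun t : ℝ => γ (p.1, p.2 + t • Pi.single i 1)) (w p i) 0)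
    (hvw : ∀ p ∈ V, v p = ∑ i, W p.2 i • w p i) {g : (Fin N → ℂ) → ℂ}
    (hg : ∀ p ∈ V, AnalyticAt ℂ g (γ p)) :
    IsTransported W V (fun p => g (γ p)) ∧ ContDiffOn ℝ 1 (fun p => g (γ p)) V := by
  refine ⟨fun p hp => ?_, fun p hp => ?_⟩
  · have hγp : HasFDerivAt γ (fderiv ℝ γ p) p := (hγ.differentiable one_ne_zero p).hasFDerivAt
    have h1 : HasFDerivAt (fun p => g (γ p)) _ p :=
      ((hg p hp).differentiableAt.hasFDerivAt.restrictScalars ℝ).comp p hγp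
    have e1 : fderiv ℝ γ p (1, 0) = v p := by
      have h2 : HasDerivAt (fun s : ℝ => ((s, p.2) : ℝ × (Fin N → ℝ))) (1, 0) p.1 :=
        (hasDerivAt_id p.1).prodMk (hasDerivAt_const p.1 p.2)
      exact (hγp.comp_hasDerivAt p.1 h2).unique (hv p hp)
    have e2 : ∀ i, fderiv ℝ γ p (0, Pi.single i 1) = w p i := fun i => by
      have h2 : HasDerivAt (fun t : ℝ => ((p.1, p.2 + t • Pi.single i 1) : ℝ × (Fin N → ℝ)))
          (0, Pi.single i 1) 0 := by
        refine (hasDerivAt_const (0 : ℝ) p.1).prodMk ?_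
        simpa using ((hasDerivAt_id (0 : ℝ)).smul_const (Pi.single i (1 : ℝ))).const_add p.2
      have h3 : HasFDerivAt γ (fderiv ℝ γ p) (p.1, p.2 + (0 : ℝ) • Pi.single i 1) := by
        simpa using hγp
      exact (h3.comp_hasDerivAt 0 h2).unique (hw p hp i)
    rw [h1.fderiv]
    simp only [ContinuousLinearMap.comp_apply, ContinuousLinearMap.coe_restrictScalars', e1, e2,
      hvw p hp, map_sum, map_smul, smul_eq_mul]
  · exact (((hg p hp).contDiffAt.restrict_scalars ℝ).comp p hγ.contDiffAt).contDiffWithinAt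

/-- `L` commutes with `exp(sL)`, so the velocity equals `exp(sL)` applied to `L(x - a₀)`, that is,
the spatial derivative of the flow along `flowField`. -/
theorem isTransported_flow (L : (Fin N → ℂ) →L[ℂ] (Fin N → ℂ)) (a₀ : Fin N → ℝ)
    {V : Set (ℝ × (Fin N → ℝ))} {g : (Fin N → ℂ) → ℂ}
    (hg : ∀ p ∈ V, AnalyticAt ℂ g (flow L a₀ p.1 p.2)) :
    IsTransported (flowField L a₀) V (fun p => g (flow L a₀ p.1 p.2)) ∧
      ContDiffOn ℝ 1 (fun p => g (flow L a₀ p.1 p.2)) V := by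
  refine isTransported_comp (contDiff_flow L a₀) (fun p _ => hasDerivAt_flow L a₀ p.1 p.2)
    (w := fun p i => NormedSpace.exp (p.1 • L) (Pi.single i 1)) (fun p _ i => ?_) (fun p _ => ?_) hg
  · have h : ∀ t : ℝ, flow L a₀ p.1 (p.2 + t • Pi.single i 1) =
        flow L a₀ p.1 p.2 + t • NormedSpace.exp (p.1 • L) (Pi.single i 1) := fun t => by
      have h2 : p.2 + t • Pi.single i (1 : ℝ) - a₀ = (p.2 - a₀) + t • Pi.single i (1 : ℝ) := by abel
      rw [flow, flow, h2, toComplex_add, toComplex_smul, toComplex_single, map_add, map_smul,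
        add_assoc]
      rfl
    simp only [h]
    simpa using ((hasDerivAt_id (0 : ℝ)).smul_const
      (NormedSpace.exp (p.1 • L) (Pi.single i 1))).const_add (flow L a₀ p.1 p.2)
  · rw [← clm_eq_sum_single]
    have h1 := (hasDerivAt_exp_smul_const (𝕂 := ℝ) L p.1).unique
      (hasDerivAt_exp_smul_const' (𝕂 := ℝ) L p.1)
    rw [flow, add_sub_cancel_left, flowField]
    exact congrArg (fun S : (Fin N → ℂ) →L[ℂ] (Fin N → ℂ) => S (toComplex (p.2 - a₀))) h1.symm

/-- A translation by `w` in the target is motion along `S w` in the parameter space, as `T` maps `S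
w` to `w`. The field is constant, so no Jacobian arises. -/
theorem isTransported_shift (T S : (Fin N → ℂ) →L[ℂ] (Fin N → ℂ)) (hTS : ∀ z, T (S z) = z)
    (a w : Fin N → ℂ) (a₀ : Fin N → ℝ)
    {V : Set (ℝ × (Fin N → ℝ))} {g : (Fin N → ℂ) → ℂ}
    (hg : ∀ p ∈ V, AnalyticAt ℂ g (a + T (toComplex (p.2 - a₀)) + (p.1 : ℂ) • w)) :
    IsTransported (fun _ => S w) V (fun p => g (a + T (toComplex (p.2 - a₀)) + (p.1 : ℂ) • w)) ∧
      ContDiffOn ℝ 1 (fun p => g (a + T (toComplex (p.2 - a₀)) + (p.1 : ℂ) • w)) V := by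
  refine isTransported_comp (γ := fun p => a + T (toComplex (p.2 - a₀)) + (p.1 : ℂ) • w) ?_
    (v := fun _ => w) (fun p _ => ?_)
    (w := fun p i => T (Pi.single i 1)) (fun p _ i => ?_) (fun p _ => ?_) hg
  · have h1 : ContDiff ℝ 1 fun p : ℝ × (Fin N → ℝ) => toComplex (p.2 - a₀) :=
      (toComplexL N).contDiff.comp (contDiff_snd.sub contDiff_const)
    exact (contDiff_const.add ((T.restrictScalars ℝ).contDiff.comp h1)).add
      ((contDiff_fst (𝕜 := ℝ)).smul (contDiff_const (c := w)))
  · simpa using ((hasDerivAt_id p.1).smul_const w).const_add (a + T (toComplex (p.2 - a₀)))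
  · have h : ∀ t : ℝ, a + T (toComplex (p.2 + t • Pi.single i 1 - a₀)) + (p.1 : ℂ) • w =
        a + T (toComplex (p.2 - a₀)) + (p.1 : ℂ) • w + t • T (Pi.single i 1) := fun t => by
      have h2 : p.2 + t • Pi.single i (1 : ℝ) - a₀ = (p.2 - a₀) + t • Pi.single i (1 : ℝ) := by abel
      rw [h2, toComplex_add, toComplex_smul, toComplex_single, map_add, map_smul, Complex.coe_smul]
      abel
    simp only [h]
    simpa using ((hasDerivAt_id (0 : ℝ)).smul_const
      (T (Pi.single i 1))).const_add (a + T (toComplex (p.2 - a₀)) + (p.1 : ℂ) • w)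
  · rw [← clm_eq_sum_single, hTS]

end Transport

/-! ### The rescaled integrand at the critical point -/

section Expansion

open Metric Set MeasureTheory

variable {N N' : ℕ}

/-- The integrand of the oscillatory integral in the coordinates centred at the critical point and
scaled by `h = lam ^ (-1/2)`. -/
noncomputable def scaledIntegrand (Φ : (Fin N → ℂ) × (Fin N' → ℂ) → ℂ)
    (acrit : (Fin N' → ℂ) → (Fin N → ℂ)) (T : (Fin N → ℂ) →L[ℂ] (Fin N → ℂ))
    (f : (Fin N → ℂ) × (Fin N' → ℂ) → ℂ) (b : Fin N' → ℂ) (h : ℂ) (y : Fin N → ℝ) : ℂ :=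
  Complex.exp (Complex.I * ((Φ (acrit b + h • T (toComplex y), b) - Φ (acrit b, b)) / h ^ 2)) *
    f (acrit b + h • T (toComplex y), b)

/-- The coefficients of the stationary phase expansion, up to the Jacobian of the contour. -/
noncomputable def stationaryCoeff (Φ : (Fin N → ℂ) × (Fin N' → ℂ) → ℂ)
    (acrit : (Fin N' → ℂ) → (Fin N → ℂ)) (T : (Fin N → ℂ) →L[ℂ] (Fin N → ℂ)) (ρ : ℝ) (k : ℕ)
    (f : (Fin N → ℂ) × (Fin N' → ℂ) → ℂ) (b : Fin N' → ℂ) : ℂ :=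
  ∫ y, scaleCoeff (scaledIntegrand Φ acrit T f b) ρ (2 * k) y

/-- Uniform Gaussian decay of `exp(i lam Φ)` on the contours `acrit b + T ℝⁿ` near the critical point. -/
structure IsGaussianPhase (Φ : (Fin N → ℂ) × (Fin N' → ℂ) → ℂ)
    (acrit : (Fin N' → ℂ) → (Fin N → ℂ)) (T : (Fin N → ℂ) →L[ℂ] (Fin N → ℂ))
    (U : Set ((Fin N → ℂ) × (Fin N' → ℂ))) (P : Set (Fin N' → ℂ)) (ρ κ : ℝ) : Prop where
  pos : 0 < ρ
  decay_pos : 0 < κ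
  phase : AnalyticOnNhd ℂ Φ U
  point : AnalyticOnNhd ℂ acrit P
  mem : ∀ b ∈ P, ∀ (h : ℂ) (y : Fin N → ℝ), ‖h‖ * ‖y‖ < ρ → (acrit b + h • T (toComplex y), b) ∈ U
  decay : ∀ b ∈ P, ∀ (h : ℂ) (y : Fin N → ℝ), h ≠ 0 → ‖h‖ * ‖y‖ < ρ →
    κ * ‖y‖ ^ 2 ≤ ((Φ (acrit b + h • T (toComplex y), b) - Φ (acrit b, b)) / h ^ 2).im

namespace IsGaussianPhase

variable {Φ : (Fin N → ℂ) × (Fin N' → ℂ) → ℂ} {acrit : (Fin N' → ℂ) → (Fin N → ℂ)}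
  {T : (Fin N → ℂ) →L[ℂ] (Fin N → ℂ)} {U : Set ((Fin N → ℂ) × (Fin N' → ℂ))}
  {P : Set (Fin N' → ℂ)} {ρ κ Q : ℝ} {f : (Fin N → ℂ) × (Fin N' → ℂ) → ℂ}

theorem mem_center (H : IsGaussianPhase Φ acrit T U P ρ κ) {b : Fin N' → ℂ} (hb : b ∈ P) :
    (acrit b, b) ∈ U := by
  simpa using H.mem b hb 0 0 (by simpa using H.pos)

theorem continuousOn_scaledIntegrand (H : IsGaussianPhase Φ acrit T U P ρ κ)
    (hf : ContinuousOn f U) :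
    ContinuousOn (fun p : (Fin N' → ℂ) × ℂ × (Fin N → ℝ) => scaledIntegrand Φ acrit T f p.1 p.2.1 p.2.2)
      {p | p.1 ∈ P ∧ p.2.1 ≠ 0 ∧ ‖p.2.1‖ * ‖p.2.2‖ < ρ} := by
  have h1 : ContinuousOn (fun p : (Fin N' → ℂ) × ℂ × (Fin N → ℝ) => acrit p.1)
      {p | p.1 ∈ P ∧ p.2.1 ≠ 0 ∧ ‖p.2.1‖ * ‖p.2.2‖ < ρ} :=
    H.point.continuousOn.comp continuousOn_fst fun p hp => hp.1
  have h2 : ContinuousOn (fun p : (Fin N' → ℂ) × ℂ × (Fin N → ℝ) =>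
      (acrit p.1 + p.2.1 • T (toComplex p.2.2), p.1))
      {p | p.1 ∈ P ∧ p.2.1 ≠ 0 ∧ ‖p.2.1‖ * ‖p.2.2‖ < ρ} := by
    refine (h1.add ?_).prodMk continuousOn_fst
    exact (continuous_snd.fst.smul
      ((T.continuous.comp continuous_toComplex).comp continuous_snd.snd)).continuousOn
  have h3 : ContinuousOn (fun p : (Fin N' → ℂ) × ℂ × (Fin N → ℝ) => (acrit p.1, p.1))
      {p | p.1 ∈ P ∧ p.2.1 ≠ 0 ∧ ‖p.2.1‖ * ‖p.2.2‖ < ρ} := h1.prodMk continuousOn_fst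
  have h4 := H.phase.continuousOn.comp h2 fun p hp => H.mem _ hp.1 _ _ hp.2.2
  have h5 := H.phase.continuousOn.comp h3 fun p hp => H.mem_center hp.1
  have h6 := hf.comp h2 fun p hp => H.mem _ hp.1 _ _ hp.2.2
  refine ContinuousOn.mul (Complex.continuous_exp.comp_continuousOn
    (continuousOn_const.mul ((h4.sub h5).div (by fun_prop) fun p hp => ?_))) h6
  exact pow_ne_zero 2 hp.2.1

theorem isGaussianFamily (H : IsGaussianPhase Φ acrit T U P ρ κ) (hf : AnalyticOnNhd ℂ f U)
    (hQ : ∀ p ∈ U, ‖f p‖ ≤ Q) {b : Fin N' → ℂ} (hb : b ∈ P) :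
    IsGaussianFamily (scaledIntegrand Φ acrit T f b) ρ κ Q where
  continuousOn := (H.continuousOn_scaledIntegrand hf.continuousOn).comp
    (f := fun p : ℂ × (Fin N → ℝ) => (b, p)) (by fun_prop) fun _ hp => ⟨hb, hp⟩
  differentiableOn y h hh := by
    have h1 : DifferentiableAt ℂ (fun h : ℂ => (acrit b + h • T (toComplex y), b)) h := by fun_prop
    have h2 : DifferentiableAt ℂ (fun h : ℂ => Φ (acrit b + h • T (toComplex y), b)) h :=
      (H.phase _ (H.mem b hb h y hh.2)).differentiableAt.comp h h1
    have h3 : DifferentiableAt ℂ (fun h : ℂ => f (acrit b + h • T (toComplex y), b)) h :=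
      (hf _ (H.mem b hb h y hh.2)).differentiableAt.comp h h1
    have h4 : DifferentiableAt ℂ (fun h : ℂ => h ^ 2) h := by fun_prop
    have h5 := ((h2.sub_const (Φ (acrit b, b))).fun_div h4 (pow_ne_zero 2 hh.1)).const_mul Complex.I
    exact (h5.cexp.mul h3).differentiableWithinAt
  bound h y hh hy := by
    rw [scaledIntegrand, norm_mul, Complex.norm_exp, mul_comm]
    have h1 := H.decay b hb h y hh hy
    have hQ0 : 0 ≤ Q := (norm_nonneg _).trans (hQ _ (H.mem b hb h y hy))
    refine mul_le_mul (hQ _ (H.mem b hb h y hy)) (Real.exp_le_exp.2 ?_) (Real.exp_pos _).le hQ0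
    rw [Complex.I_mul_re]
    linarith
  neg h y := by
    simp only [scaledIntegrand, toComplex_neg, map_neg, smul_neg, neg_smul, neg_sq]

theorem analyticOnNhd_stationaryCoeff {c : Fin N' → ℂ} {R : ℝ}
    (H : IsGaussianPhase Φ acrit T U (closedBall c R) ρ κ) (hf : AnalyticOnNhd ℂ f U)
    (hQ : ∀ p ∈ U, ‖f p‖ ≤ Q) (k : ℕ) :
    AnalyticOnNhd ℂ (stationaryCoeff Φ acrit T ρ k f) (ball c R) := by
  refine analyticOnNhd_integral_scaleCoeff H.pos H.decay_pos (fun b hb => H.isGaussianFamily hf hQ hb)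
    (H.continuousOn_scaledIntegrand hf.continuousOn) (fun h y hh hy b hb => ?_) _
  have h0 := (H.point b hb).differentiableAt
  have h1 : DifferentiableAt ℂ (fun b => (acrit b + h • T (toComplex y), b)) b :=
    (h0.add_const _).prodMk differentiableAt_id
  have h1' : DifferentiableAt ℂ (fun b => (acrit b, b)) b := h0.prodMk differentiableAt_id
  have h2 : DifferentiableAt ℂ (fun b => Φ (acrit b + h • T (toComplex y), b)) b :=
    DifferentiableAt.comp (g := Φ) (f := fun b => (acrit b + h • T (toComplex y), b)) b
      (H.phase _ (H.mem b hb h y hy)).differentiableAt h1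
  have h2' : DifferentiableAt ℂ (fun b => Φ (acrit b, b)) b :=
    DifferentiableAt.comp (g := Φ) (f := fun b => (acrit b, b)) b
      (H.phase _ (H.mem_center hb)).differentiableAt h1'
  have h3 : DifferentiableAt ℂ (fun b => f (acrit b + h • T (toComplex y), b)) b :=
    DifferentiableAt.comp (g := f) (f := fun b => (acrit b + h • T (toComplex y), b)) b
      (hf _ (H.mem b hb h y hy)).differentiableAt h1
  have h4 : DifferentiableAt ℂ
      (fun b => (Φ (acrit b + h • T (toComplex y), b) - Φ (acrit b, b)) / h ^ 2) b := by
    simpa only [div_eq_mul_inv] using (h2.fun_sub h2').mul_const (h ^ 2)⁻¹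
  exact ((h4.const_mul Complex.I).cexp.mul h3).differentiableWithinAt

theorem tendsto_scaledIntegrand (H : IsGaussianPhase Φ acrit T U P ρ κ) (hf : AnalyticOnNhd ℂ f U)
    (hQ : ∀ p ∈ U, ‖f p‖ ≤ Q) {b : Fin N' → ℂ} (hb : b ∈ P) (y : Fin N → ℝ) :
    Tendsto (fun h => scaledIntegrand Φ acrit T f b h y) (𝓝[≠] 0)
      (𝓝 (scaleCoeff (scaledIntegrand Φ acrit T f b) ρ 0 y)) :=
  have hG := H.isGaussianFamily hf hQ hb
  tendsto_taylorCoeff_zero (scaleRadius_pos H.pos y) (IsGaussianFamily.scaleRadius_lt H.pos y)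
    (hG.differentiableOn_ball H.pos y) (hG.norm_le_ball H.pos y)

/-- The zeroth Taylor coefficient is the limit as `h → 0`, where the amplitude factor freezes at the
critical point. -/
theorem stationaryCoeff_zero (H : IsGaussianPhase Φ acrit T U P ρ κ) (hf : AnalyticOnNhd ℂ f U)
    (hQ : ∀ p ∈ U, ‖f p‖ ≤ Q) {b : Fin N' → ℂ} (hb : b ∈ P) :
    stationaryCoeff Φ acrit T ρ 0 f b =
      f (acrit b, b) * stationaryCoeff Φ acrit T ρ 0 (fun _ => 1) b := by
  rw [stationaryCoeff, stationaryCoeff, ← integral_const_mul]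
  refine integral_congr_ae (Eventually.of_forall fun y => ?_)
  refine tendsto_nhds_unique (H.tendsto_scaledIntegrand hf hQ hb y) ?_
  have h1 := H.tendsto_scaledIntegrand (f := fun _ => 1) (Q := 1) analyticOnNhd_const (by simp) hb y
  have h2 : ContinuousAt (fun h : ℂ => f (acrit b + h • T (toComplex y), b)) 0 := by
    refine ContinuousAt.comp (g := f) ?_ (by fun_prop)
    simpa using (hf _ (H.mem_center hb)).continuousAt
  have h3 : Tendsto (fun h : ℂ => f (acrit b + h • T (toComplex y), b)) (𝓝[≠] 0)
      (𝓝 (f (acrit b, b))) := by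
    simpa using h2.tendsto.mono_left nhdsWithin_le_nhds
  refine (h3.mul h1).congr fun h => ?_
  simp only [scaledIntegrand]
  ring

/-- The constants depend only on the phase and enter linearly in the bound `Q` of the amplitude.
They can thus be applied to all `q k` at once, with `Q` growing factorially in `k`. -/
theorem norm_stationaryCoeff_le (H : IsGaussianPhase Φ acrit T U P ρ κ) :
    ∃ M C : ℝ, 0 < M ∧ 0 < C ∧ (∀ (f : (Fin N → ℂ) × (Fin N' → ℂ) → ℂ) (Q : ℝ),
      AnalyticOnNhd ℂ f U → (∀ p ∈ U, ‖f p‖ ≤ Q) → ∀ b ∈ P, ∀ k : ℕ,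
        ‖stationaryCoeff Φ acrit T ρ k f b‖ ≤ Q * (M * C ^ k * k.factorial)) ∧
      ∀ (ψ : (Fin N → ℝ) → ℂ), Continuous ψ → (∀ x, ‖ψ x‖ ≤ 1) → (∀ x, ‖x‖ ≤ ρ / 8 → ψ x = 1) →
      tsupport ψ ⊆ ball 0 ρ → ∀ (f : (Fin N → ℂ) × (Fin N' → ℂ) → ℂ) (Q : ℝ),
      AnalyticOnNhd ℂ f U → (∀ p ∈ U, ‖f p‖ ≤ Q) → ∀ b ∈ P, ∀ h : ℝ, 0 < h → ∀ K : ℕ,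
        ‖(∫ y, ψ (h • y) * scaledIntegrand Φ acrit T f b h y) -
          ∑ k ∈ Finset.range K, (h : ℂ) ^ (2 * k) * stationaryCoeff Φ acrit T ρ k f b‖ ≤
          (K + 1) * Q * (M * (C * h ^ 2) ^ K * K.factorial) := by
  obtain ⟨M, C, hM, hC, hMC⟩ := exists_integral_one_add_norm_pow_le N H.decay_pos
  have hρ := H.pos
  have hle : (2 / ρ) ^ 2 * C ≤ (16 / ρ) ^ 2 * C := by gcongr; norm_num
  refine ⟨2 * M, (16 / ρ) ^ 2 * C, by positivity, by positivity, fun f Q hf hQ b hb k => ?_,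
    fun ψ hψc hψ hψ1 hψ0 f Q hf hQ b hb h hh K => ?_⟩
  · have hG := H.isGaussianFamily hf hQ hb
    have hQ0 := hG.nonneg hρ
    refine (hG.norm_integral_scaleCoeff_le hρ H.decay_pos (2 * k)).trans ?_
    calc Q * (2 / ρ) ^ (2 * k) * _ ≤ Q * (2 / ρ) ^ (2 * k) * (M * C ^ k * k.factorial) := by
          gcongr; exact hMC k
      _ = Q * (M * ((2 / ρ) ^ 2 * C) ^ k * k.factorial) := by rw [pow_mul, mul_pow]; ring
      _ ≤ Q * (2 * M * ((16 / ρ) ^ 2 * C) ^ k * k.factorial) := by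
          gcongr
          linarith
  · have hG := H.isGaussianFamily hf hQ hb
    have hQ0 := hG.nonneg hρ
    refine (hG.norm_integral_sub_sum_le hρ H.decay_pos hψc hψ hψ1 hψ0 hh K).trans ?_
    calc (2 * K + 2) * Q * (16 * h / ρ) ^ (2 * K) * _
        ≤ (2 * K + 2) * Q * (16 * h / ρ) ^ (2 * K) * (M * C ^ K * K.factorial) := by
          gcongr; exact hMC K
      _ = (K + 1) * Q * (2 * M * ((16 / ρ) ^ 2 * C * h ^ 2) ^ K * K.factorial) := by
          rw [pow_mul, show (16 / ρ) ^ 2 * C * h ^ 2 = (16 * h / ρ) ^ 2 * C by ring, mul_pow]; ring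

end IsGaussianPhase

end Expansion

/-! ### Nonvanishing of the leading coefficient -/

section LeadingCoefficient

open Metric Set MeasureTheory

/-- The mean value inequality for `φ(z) - (d/2) z²` on the disc of radius `‖h‖`, whose derivative
`ψ(z) - d z` is `o(‖h‖)` there. -/
theorem tendsto_sub_div_sq {φ ψ : ℂ → ℂ} {d : ℂ} (hφ : ∀ᶠ h in 𝓝 0, HasDerivAt φ (ψ h) h)
    (hψ : HasDerivAt ψ d 0) (h0 : ψ 0 = 0) :
    Tendsto (fun h => (φ h - φ 0) / h ^ 2) (𝓝[≠] 0) (𝓝 (d / 2)) := by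
  rw [Metric.tendsto_nhds]
  intro ε hε
  have h1 := hψ.hasFDerivAt.isLittleO.def (half_pos hε)
  obtain ⟨r, hr, hball⟩ := Metric.eventually_nhds_iff.1 (hφ.and h1)
  have hr' : ∀ᶠ h : ℂ in 𝓝[≠] 0, dist h 0 < r :=
    nhdsWithin_le_nhds (Metric.ball_mem_nhds (0 : ℂ) hr)
  filter_upwards [hr', self_mem_nhdsWithin] with h hh hne
  have hne' : h ≠ 0 := hne
  have hpos : 0 < ‖h‖ := norm_pos_iff.2 hne'
  rw [dist_zero_right] at hh
  have hmv := Convex.norm_image_sub_le_of_norm_hasDerivWithin_le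
    (f := fun z => φ z - d / 2 * z ^ 2) (f' := fun z => ψ z - d * z) (s := closedBall (0 : ℂ) ‖h‖)
    (C := ε / 2 * ‖h‖) (x := 0) (y := h) (fun z hz => by
      have hz' : dist z 0 < r := by
        rw [mem_closedBall, dist_zero_right] at hz
        rw [dist_zero_right]; exact hz.trans_lt hh
      have h2 := ((hball hz').1.sub ((hasDerivAt_pow 2 z).const_mul (d / 2)))
      refine HasDerivAt.hasDerivWithinAt ?_
      have e : ψ z - d * z = ψ z - d / 2 * ((2 : ℕ) * z ^ (2 - 1)) := by push_cast; ring
      rw [e]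
      exact h2) (fun z hz => by
      rw [mem_closedBall, dist_zero_right] at hz
      have hz' : dist z 0 < r := by rw [dist_zero_right]; exact hz.trans_lt hh
      have h2 := (hball hz').2
      simp only [h0, sub_zero, ContinuousLinearMap.toSpanSingleton_apply, smul_eq_mul] at h2
      rw [mul_comm d]
      refine h2.trans ?_
      gcongr) (convex_closedBall _ _) (mem_closedBall_self hpos.le) (by simp)
  rw [dist_eq_norm]
  have e : (φ h - φ 0) / h ^ 2 - d / 2 =
      ((φ h - d / 2 * h ^ 2) - (φ 0 - d / 2 * 0 ^ 2)) / h ^ 2 := by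
    field_simp
    ring
  rw [e, norm_div, norm_pow, div_lt_iff₀ (by positivity)]
  refine hmv.trans_lt ?_
  rw [sub_zero]
  nlinarith [mul_pos hpos hpos]

variable {N N' : ℕ} {Φ : (Fin N → ℂ) × (Fin N' → ℂ) → ℂ} {acrit : (Fin N' → ℂ) → (Fin N → ℂ)}
  {T : (Fin N → ℂ) →L[ℂ] (Fin N → ℂ)} {U : Set ((Fin N → ℂ) × (Fin N' → ℂ))}
  {P : Set (Fin N' → ℂ)} {ρ κ : ℝ}

theorem tendsto_phase_sub_div_sq {a : Fin N → ℂ} {b : Fin N' → ℂ} (hΦ : AnalyticAt ℂ Φ (a, b))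
    (hcrit : phaseGrad Φ a b = 0) (v : Fin N → ℂ) :
    Tendsto (fun h : ℂ => (Φ (a + h • v, b) - Φ (a, b)) / h ^ 2) (𝓝[≠] 0)
      (𝓝 (fderiv ℂ (fun x => phaseGrad Φ x b) a v v / 2)) := by
  have hU := isOpen_analyticAt ℂ Φ
  have hin : ∀ h : ℂ, HasDerivAt (fun h : ℂ => a + h • v) v h := fun h => by
    simpa using ((hasDerivAt_id h).smul_const v).const_add a
  have hc : ContinuousAt (fun h : ℂ => (a + h • v, b)) 0 := by fun_prop
  have h1 : ∀ᶠ h : ℂ in 𝓝 0, HasDerivAt (fun h : ℂ => Φ (a + h • v, b))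
      (phaseGrad Φ (a + h • v) b v) h := by
    have hev := hc.eventually_mem (hU.mem_nhds (by simpa using hΦ))
    filter_upwards [hev] with h hh
    exact (hasFDerivAt_phaseGrad hh.differentiableAt).comp_hasDerivAt h (hin h)
  have hg : DifferentiableAt ℂ (fun x => phaseGrad Φ x b) a :=
    DifferentiableAt.comp (g := fun p : (Fin N → ℂ) × (Fin N' → ℂ) => phaseGrad Φ p.1 p.2)
      (f := fun x => (x, b)) a
      (analyticOnNhd_phaseGrad hU (fun _ hp => hp) (a, b) hΦ).differentiableAt
      (by fun_prop)
  have h2 : HasDerivAt (fun h : ℂ => phaseGrad Φ (a + h • v) b)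
      (fderiv ℂ (fun x => phaseGrad Φ x b) a v) 0 := by
    refine HasFDerivAt.comp_hasDerivAt (l := fun x => phaseGrad Φ x b) (0 : ℂ) ?_ (hin 0)
    simpa using hg.hasFDerivAt
  have h3 := tendsto_sub_div_sq h1 (h2.clm_apply (hasDerivAt_const 0 v)) (by simp [hcrit])
  simpa using h3

/-- The coefficient is the integral of `exp(i D(Ty,Ty)/2)`, the pointwise limit of the rescaled
integrand. The decay of the phase passes to this limit, making the exponent a quadratic form with
negative definite real part. -/
theorem IsGaussianPhase.stationaryCoeff_zero_one_ne_zero (H : IsGaussianPhase Φ acrit T U P ρ κ)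
    {b : Fin N' → ℂ} (hb : b ∈ P) (hcrit : phaseGrad Φ (acrit b) b = 0) :
    stationaryCoeff Φ acrit T ρ 0 (fun _ => 1) b ≠ 0 := by
  set D := fderiv ℂ (fun x => phaseGrad Φ x b) (acrit b) with hD
  have hlim := fun y : Fin N → ℝ =>
    tendsto_phase_sub_div_sq (H.phase _ (H.mem_center hb)) hcrit (T (toComplex y))
  set S : Matrix (Fin N) (Fin N) ℂ := Matrix.of fun i j =>
    -(Complex.I / 2 * D (T (Pi.single i 1)) (T (Pi.single j 1))) with hS
  have hSD : ∀ y : Fin N → ℝ, ∑ i, ∑ j, S i j * y i * y j =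
      -(Complex.I * (D (T (toComplex y)) (T (toComplex y)) / 2)) := by
    intro y
    have e1 : D (T (toComplex y)) (T (toComplex y)) =
        ∑ i, ∑ j, (y i : ℂ) * y j * D (T (Pi.single i 1)) (T (Pi.single j 1)) := by
      rw [clm_eq_sum_single T (toComplex y)]
      simp only [map_sum, map_smul, sum_apply, smul_apply, smul_eq_mul, Finset.mul_sum, toComplex]
      rw [Finset.sum_comm]
      refine Finset.sum_congr rfl fun i _ => Finset.sum_congr rfl fun j _ => ?_
      ring
    rw [e1, Finset.sum_div, Finset.mul_sum, ← Finset.sum_neg_distrib]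
    refine Finset.sum_congr rfl fun i _ => ?_
    rw [Finset.sum_div, Finset.mul_sum, ← Finset.sum_neg_distrib]
    refine Finset.sum_congr rfl fun j _ => ?_
    rw [hS, Matrix.of_apply]
    ring
  have hpos : ∀ y : Fin N → ℝ, y ≠ 0 → 0 < (∑ i, ∑ j, S i j * y i * y j).re := by
    intro y hy
    have hyn := norm_pos_iff.2 hy
    have h1 : κ * ‖y‖ ^ 2 ≤ (D (T (toComplex y)) (T (toComplex y)) / 2).im := by
      refine ge_of_tendsto ((Complex.continuous_im.tendsto _).comp (hlim y)) ?_
      have hsm : ∀ᶠ h : ℂ in 𝓝[≠] 0, ‖h‖ * ‖y‖ < ρ := by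
        have hc : ContinuousAt (fun h : ℂ => ‖h‖ * ‖y‖) 0 := by fun_prop
        exact nhdsWithin_le_nhds (hc.eventually_lt continuousAt_const (by simpa using H.pos))
      filter_upwards [hsm, self_mem_nhdsWithin] with h hh hne
      exact H.decay b hb h y hne hh
    rw [hSD, Complex.neg_re, Complex.I_mul_re, neg_neg]
    exact lt_of_lt_of_le (mul_pos H.decay_pos (by positivity)) h1
  have hne := integral_cexp_neg_quadratic_ne_zero S hpos
  convert hne using 1
  refine integral_congr_ae (Eventually.of_forall fun y => ?_)
  refine tendsto_nhds_unique (H.tendsto_scaledIntegrand (f := fun _ => 1) (Q := 1)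
    analyticOnNhd_const (by simp) hb y) ?_
  simp only [scaledIntegrand, mul_one, hSD, neg_neg]
  exact (Complex.continuous_exp.tendsto _).comp ((hlim y).const_mul Complex.I)

end LeadingCoefficient

/-! ### The formal amplitude and its exponentially small remainder -/

section FormalExpansion

open Metric Set MeasureTheory

/-- For `n = ⌊lam/R⌋`, `n! (C/lam)^n ≤ (C/R)^n ≤ (e⁻¹/8)^n`. The factor `8^n` absorbs the polynomial
prefactor, and `e^(-n)` is exponentially small since `n + 1 > lam/R`. -/
theorem factorial_mul_pow_div_le_exp {C R lam : ℝ} (hC : 0 < C) (hR : 8 * Real.exp 1 * C ≤ R)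
    (hlam : 1 ≤ lam) :
    ((⌊lam / R⌋₊ : ℝ) + 1) * (⌊lam / R⌋₊ + 2) *
      ((C / lam) ^ (⌊lam / R⌋₊ + 1) * (⌊lam / R⌋₊ + 1).factorial) ≤
      2 * C * Real.exp 1 * Real.exp (-(1 / R) * lam) := by
  have hR0 : 0 < R := lt_of_lt_of_le (by positivity) hR
  set n := ⌊lam / R⌋₊ with hn
  have hnle : (n : ℝ) ≤ lam / R := Nat.floor_le (by positivity)
  have hltn : lam / R < n + 1 := Nat.lt_floor_add_one _
  have h1 : (n.factorial : ℝ) ≤ (n : ℝ) ^ n := by exact_mod_cast Nat.factorial_le_pow n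
  have h2 : (C / lam) ^ n * n.factorial ≤ (Real.exp (-1) / 8) ^ n := by
    calc (C / lam) ^ n * n.factorial ≤ (C / lam) ^ n * (lam / R) ^ n := by
          gcongr
          exact h1.trans (by gcongr)
      _ = (C / R) ^ n := by rw [← mul_pow]; congr 1; field_simp
      _ ≤ (Real.exp (-1) / 8) ^ n := by
          refine pow_le_pow_left₀ (by positivity) ?_ n
          rw [div_le_div_iff₀ hR0 (by norm_num), Real.exp_neg, ← div_eq_inv_mul,
            le_div_iff₀ (Real.exp_pos 1)]
          linarith
  have h3 : ((n : ℝ) + 1) ≤ 2 ^ n := by exact_mod_cast Nat.lt_two_pow_self (n := n)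
  have h4 : ((n : ℝ) + 1) * (n + 2) * (n + 1) ≤ 2 * 8 ^ n := by
    calc ((n : ℝ) + 1) * (n + 2) * (n + 1) ≤ 2 ^ n * (2 * 2 ^ n) * 2 ^ n := by gcongr; linarith
      _ = 2 * 8 ^ n := by rw [show (8 : ℝ) = 2 * 2 * 2 by norm_num, mul_pow, mul_pow]; ring
  have h5 : Real.exp (-1) ^ n ≤ Real.exp 1 * Real.exp (-(1 / R) * lam) := by
    rw [← Real.exp_nat_mul, ← Real.exp_add]
    refine Real.exp_le_exp.2 ?_
    have : -(1 / R) * lam = -(lam / R) := by ring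
    rw [this]
    linarith
  have hCl : C / lam ≤ C := div_le_self hC.le hlam
  calc ((n : ℝ) + 1) * (n + 2) * ((C / lam) ^ (n + 1) * (n + 1).factorial)
      = (C / lam) * (((n : ℝ) + 1) * (n + 2) * (n + 1)) * ((C / lam) ^ n * n.factorial) := by
        rw [Nat.factorial_succ]; push_cast; ring
    _ ≤ C * (2 * 8 ^ n) * (Real.exp (-1) / 8) ^ n := by gcongr
    _ = 2 * C * Real.exp (-1) ^ n := by rw [div_pow]; field_simp
    _ ≤ 2 * C * (Real.exp 1 * Real.exp (-(1 / R) * lam)) := by gcongr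
    _ = _ := by ring

theorem factorial_mul_pow_mul_le {C₁ C₂ : ℝ} (h₁ : 0 < C₁) (h₂ : 0 < C₂) (i j : ℕ) :
    C₁ ^ i * i.factorial * (C₂ ^ j * j.factorial) ≤ max C₁ C₂ ^ (i + j) * (i + j).factorial := by
  have hf : (i.factorial : ℝ) * j.factorial ≤ (i + j).factorial := by
    exact_mod_cast Nat.le_of_dvd (Nat.factorial_pos _) (Nat.factorial_mul_factorial_dvd_factorial_add i j)
  calc C₁ ^ i * i.factorial * (C₂ ^ j * j.factorial)
      = C₁ ^ i * C₂ ^ j * (i.factorial * j.factorial) := by ring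
    _ ≤ max C₁ C₂ ^ i * max C₁ C₂ ^ j * (i + j).factorial := by
        gcongr
        · exact le_max_left _ _
        · exact le_max_right _ _
    _ = _ := by rw [pow_add]

variable {N N' : ℕ} {Φ : (Fin N → ℂ) × (Fin N' → ℂ) → ℂ} {acrit : (Fin N' → ℂ) → (Fin N → ℂ)}
  {T : (Fin N → ℂ) →L[ℂ] (Fin N → ℂ)} {U : Set ((Fin N → ℂ) × (Fin N' → ℂ))}
  {P : Set (Fin N' → ℂ)} {ρ κ : ℝ}

/-- The formal amplitude produced by stationary phase; `J` is the Jacobian of the contour. -/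
noncomputable def stationaryAmplitude (Φ : (Fin N → ℂ) × (Fin N' → ℂ) → ℂ)
    (acrit : (Fin N' → ℂ) → (Fin N → ℂ)) (T : (Fin N → ℂ) →L[ℂ] (Fin N → ℂ)) (ρ : ℝ) (J : ℂ)
    (q : ℕ → (Fin N → ℂ) × (Fin N' → ℂ) → ℂ) (m : ℕ) (b : Fin N' → ℂ) : ℂ :=
  J * ∑ k ∈ Finset.range (m + 1), stationaryCoeff Φ acrit T ρ (m - k) (q k) b

/-- Regrouping by the index `k` of `q k`: the term `q k` is expanded to `⌊lam/R⌋ + 1 - k` orders, so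
that `k` and its remainder order always add up to `⌊lam/R⌋ + 1`. -/
theorem finiteRealization_stationaryAmplitude (J : ℂ) (q : ℕ → (Fin N → ℂ) × (Fin N' → ℂ) → ℂ)
    (R lam : ℝ) (b : Fin N' → ℂ) :
    finiteRealization (stationaryAmplitude Φ acrit T ρ J q) R lam b =
      J * ∑ k ∈ Finset.range (⌊lam / R⌋₊ + 1), ((lam : ℂ) ^ k)⁻¹ *
        ∑ j ∈ Finset.range (⌊lam / R⌋₊ + 1 - k), ((lam : ℂ) ^ j)⁻¹ *
          stationaryCoeff Φ acrit T ρ j (q k) b := by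
  have h := Finset.sum_range_diag_flip (⌊lam / R⌋₊ + 1) fun k j =>
    ((lam : ℂ) ^ k)⁻¹ * (((lam : ℂ) ^ j)⁻¹ * stationaryCoeff Φ acrit T ρ j (q k) b)
  simp only [← Finset.mul_sum] at h
  rw [← h, finiteRealization, Finset.mul_sum]
  refine Finset.sum_congr rfl fun m _ => ?_
  rw [stationaryAmplitude, mul_left_comm, Finset.mul_sum]
  congr 1
  refine Finset.sum_congr rfl fun k hk => ?_
  rw [← mul_assoc, ← mul_inv, ← pow_add, Nat.add_sub_cancel' (Nat.lt_succ_iff.1 (Finset.mem_range.1 hk))]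

/-- The remainder for `q k` carries `C₀^k k!` from the amplitude and `C₁^(n+1-k) (n+1-k)!` from the
expansion. Their product is at most `C'^(n+1) (n+1)!` for every `k`, so the `n + 1` remainders sum
to an exponentially small quantity. -/
theorem IsGaussianPhase.exists_expansion (H : IsGaussianPhase Φ acrit T U P ρ κ)
    {q : ℕ → (Fin N → ℂ) × (Fin N' → ℂ) → ℂ} {M₀ C₀ : ℝ} (hM₀ : 0 < M₀) (hC₀ : 0 < C₀)
    (hq : ∀ k, AnalyticOnNhd ℂ (q k) U)
    (hqb : ∀ k, ∀ p ∈ U, ‖q k p‖ ≤ M₀ * C₀ ^ k * (k.factorial : ℝ)) (J : ℂ) :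
    ∃ M C : ℝ, 0 < M ∧ 0 < C ∧
      (∀ m, ∀ b ∈ P, ‖stationaryAmplitude Φ acrit T ρ J q m b‖ ≤ M * C ^ m * (m.factorial : ℝ)) ∧
      ∀ R, C ≤ R → ∀ (ψ : (Fin N → ℝ) → ℂ), Continuous ψ → (∀ x, ‖ψ x‖ ≤ 1) →
        (∀ x, ‖x‖ ≤ ρ / 8 → ψ x = 1) → tsupport ψ ⊆ ball 0 ρ → ∀ b ∈ P, ∀ h : ℝ, 0 < h →
        ∀ lam : ℝ, 1 ≤ lam → h ^ 2 = lam⁻¹ →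
        ‖J * (∫ y, ψ (h • y) * scaledIntegrand Φ acrit T (finiteRealization q R lam) b h y) -
          finiteRealization (stationaryAmplitude Φ acrit T ρ J q) R lam b‖ ≤
          M * Real.exp (-(1 / R) * lam) := by
  obtain ⟨M₁, C₁, hM₁, hC₁, hcoeff, hrem⟩ := H.norm_stationaryCoeff_le
  set C' := max C₀ C₁ with hC'
  have hC'pos : 0 < C' := lt_max_of_lt_left hC₀
  have he : 1 < Real.exp 1 := Real.one_lt_exp_iff.2 one_pos
  set M := (‖J‖ + 1) * (M₀ * M₁) * (2 * C' * Real.exp 1 + 1) with hM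
  have hMpos : 0 < M := by positivity
  have hMle : ‖J‖ * (M₀ * M₁) ≤ M := by
    calc ‖J‖ * (M₀ * M₁) ≤ (‖J‖ + 1) * (M₀ * M₁) * 1 := by
          rw [mul_one]; gcongr; linarith
      _ ≤ M := by rw [hM]; gcongr; linarith [show 0 < 2 * C' * Real.exp 1 by positivity]
  -- For the coefficients `2 C'` would suffice, by `m + 1 ≤ 2^m`; the factor `8e` is what the
  -- remainder estimate demands of `R`.
  refine ⟨M, 8 * Real.exp 1 * C', hMpos, by positivity, fun m b hb => ?_,
    fun R hR ψ hψc hψ hψ1 hψ0 b hb h hh lam hlam hhl => ?_⟩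
  · rw [stationaryAmplitude, norm_mul]
    have h1 : ∀ k ∈ Finset.range (m + 1), ‖stationaryCoeff Φ acrit T ρ (m - k) (q k) b‖ ≤
        M₀ * M₁ * (C' ^ m * m.factorial) := by
      intro k hk
      have hk' : k + (m - k) = m := Nat.add_sub_cancel' (Nat.lt_succ_iff.1 (Finset.mem_range.1 hk))
      refine (hcoeff (q k) _ (hq k) (hqb k) b hb (m - k)).trans ?_
      have h2 := factorial_mul_pow_mul_le hC₀ hC₁ k (m - k)
      rw [hk'] at h2
      calc M₀ * C₀ ^ k * k.factorial * (M₁ * C₁ ^ (m - k) * (m - k).factorial)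
          = M₀ * M₁ * (C₀ ^ k * k.factorial * (C₁ ^ (m - k) * (m - k).factorial)) := by ring
        _ ≤ _ := by gcongr
    have h2 : ((m : ℝ) + 1) ≤ 2 ^ m := by exact_mod_cast Nat.lt_two_pow_self (n := m)
    calc ‖J‖ * ‖∑ k ∈ Finset.range (m + 1), stationaryCoeff Φ acrit T ρ (m - k) (q k) b‖
        ≤ ‖J‖ * ((m + 1 : ℕ) * (M₀ * M₁ * (C' ^ m * m.factorial))) := by
          gcongr
          refine (norm_sum_le_of_le _ h1).trans_eq ?_
          rw [Finset.sum_const, Finset.card_range, nsmul_eq_mul]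
      _ = ‖J‖ * (M₀ * M₁) * ((m + 1) * C' ^ m) * m.factorial := by push_cast; ring
      _ ≤ M * (2 ^ m * C' ^ m) * m.factorial := by gcongr
      _ = M * (2 * C') ^ m * m.factorial := by rw [mul_pow]
      _ ≤ M * (8 * Real.exp 1 * C') ^ m * m.factorial := by
          gcongr
          linarith
  · have hlam0 : 0 < lam := by linarith
    set n := ⌊lam / R⌋₊ with hn
    have hG := fun k => H.isGaussianFamily (hq k) (hqb k) hb
    have hpow : ∀ j, (h : ℂ) ^ (2 * j) = ((lam : ℂ) ^ j)⁻¹ := fun j => by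
      rw [pow_mul, ← Complex.ofReal_pow, hhl, Complex.ofReal_inv, inv_pow]
    have hint : (∫ y, ψ (h • y) * scaledIntegrand Φ acrit T (finiteRealization q R lam) b h y) =
        ∑ k ∈ Finset.range (n + 1), ((lam : ℂ) ^ k)⁻¹ *
          ∫ y, ψ (h • y) * scaledIntegrand Φ acrit T (q k) b h y := by
      simp only [← integral_const_mul]
      rw [← integral_finsetSum _ fun k _ =>
        ((hG k).integrable_cutoff_mul H.pos H.decay_pos hψc hψ hψ0 hh).const_mul _]
      refine integral_congr_ae (Eventually.of_forall fun y => ?_)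
      simp only [scaledIntegrand, finiteRealization, Finset.mul_sum]
      exact Finset.sum_congr rfl fun k _ => by ring
    rw [finiteRealization_stationaryAmplitude, hint, ← mul_sub, ← Finset.sum_sub_distrib, norm_mul]
    have hterm : ∀ k ∈ Finset.range (n + 1),
        ‖((lam : ℂ) ^ k)⁻¹ * (∫ y, ψ (h • y) * scaledIntegrand Φ acrit T (q k) b h y) -
          ((lam : ℂ) ^ k)⁻¹ * ∑ j ∈ Finset.range (n + 1 - k), ((lam : ℂ) ^ j)⁻¹ *
            stationaryCoeff Φ acrit T ρ j (q k) b‖ ≤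
        (n + 2) * (M₀ * M₁) * ((C' / lam) ^ (n + 1) * (n + 1).factorial) := by
      intro k hk
      have hk' : k + (n + 1 - k) = n + 1 := Nat.add_sub_cancel' (Finset.mem_range.1 hk).le
      have h1 := hrem ψ hψc hψ hψ1 hψ0 (q k) _ (hq k) (hqb k) b hb h hh (n + 1 - k)
      simp only [hpow, hhl] at h1
      rw [← mul_sub, norm_mul, norm_inv, norm_pow, Complex.norm_real, Real.norm_of_nonneg hlam0.le]
      have h2 := factorial_mul_pow_mul_le hC₀ hC₁ k (n + 1 - k)
      rw [hk'] at h2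
      have hle : ((n + 1 - k : ℕ) : ℝ) + 1 ≤ n + 2 := by
        have : n + 1 - k ≤ n + 1 := Nat.sub_le _ _
        have : ((n + 1 - k : ℕ) : ℝ) ≤ n + 1 := by exact_mod_cast this
        linarith
      calc (lam ^ k)⁻¹ * _ ≤ (lam ^ k)⁻¹ * ((((n + 1 - k : ℕ) : ℝ) + 1) *
            (M₀ * C₀ ^ k * k.factorial) *
              (M₁ * (C₁ * lam⁻¹) ^ (n + 1 - k) * (n + 1 - k).factorial)) := by
            gcongr
        _ = (lam⁻¹ ^ k * lam⁻¹ ^ (n + 1 - k)) * (((n + 1 - k : ℕ) : ℝ) + 1) * (M₀ * M₁) *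
            (C₀ ^ k * k.factorial * (C₁ ^ (n + 1 - k) * (n + 1 - k).factorial)) := by
            rw [mul_pow, inv_pow]; ring
        _ ≤ (lam⁻¹ ^ k * lam⁻¹ ^ (n + 1 - k)) * (n + 2) * (M₀ * M₁) *
            (C' ^ (n + 1) * (n + 1).factorial) := by
            gcongr
        _ = _ := by rw [← pow_add, hk', div_pow, inv_pow]; ring
    calc ‖J‖ * _ ≤ ‖J‖ * ((n + 1 : ℕ) *
          ((n + 2) * (M₀ * M₁) * ((C' / lam) ^ (n + 1) * (n + 1).factorial))) := by
          gcongr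
          refine (norm_sum_le_of_le _ hterm).trans_eq ?_
          rw [Finset.sum_const, Finset.card_range, nsmul_eq_mul]
      _ = ‖J‖ * (M₀ * M₁) * (((n : ℝ) + 1) * (n + 2) * ((C' / lam) ^ (n + 1) * (n + 1).factorial)) := by
          push_cast; ring
      _ ≤ ‖J‖ * (M₀ * M₁) * (2 * C' * Real.exp 1 * Real.exp (-(1 / R) * lam)) := by
          exact mul_le_mul_of_nonneg_left (factorial_mul_pow_div_le_exp hC'pos hR hlam) (by positivity)
      _ = ‖J‖ * (M₀ * M₁) * (2 * C' * Real.exp 1) * Real.exp (-(1 / R) * lam) := by ring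
      _ ≤ M * Real.exp (-(1 / R) * lam) := by
          rw [hM]
          gcongr <;> linarith

end FormalExpansion

/-! ### Change of variables and deformation with a fixed cut-off -/

section Contour

open Metric Set MeasureTheory

variable {N N' : ℕ}

theorem exists_cutoff (n : ℕ) {ρ : ℝ} (hρ : 0 < ρ) :
    ∃ ψ : (Fin n → ℝ) → ℂ, ContDiff ℝ ∞ ψ ∧ HasCompactSupport ψ ∧ (∀ x, ‖ψ x‖ ≤ 1) ∧
      (∀ x, ‖x‖ ≤ ρ / 8 → ψ x = 1) ∧ tsupport ψ ⊆ ball 0 ρ := by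
  let f : ContDiffBump (0 : Fin n → ℝ) := ⟨ρ / 8, ρ / 2, by positivity, by linarith⟩
  have hts : tsupport (fun x => (f x : ℂ)) ⊆ closedBall 0 (ρ / 2) := by
    have hsub : Function.support (fun x => (f x : ℂ)) ⊆ Function.support f := fun x hx h =>
      hx (by simp [h])
    exact (closure_mono hsub).trans f.tsupport_eq.subset
  refine ⟨fun x => (f x : ℂ), Complex.ofRealCLM.contDiff.comp f.contDiff,
    (isCompact_closedBall _ _).of_isClosed_subset (isClosed_tsupport _) hts, fun x => ?_,
    fun x hx => ?_, hts.trans (closedBall_subset_ball (by linarith))⟩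
  · rw [Complex.norm_real, Real.norm_of_nonneg f.nonneg]
    exact f.le_one
  · have h1 : f x = 1 := f.one_of_mem_closedBall (by simpa using hx)
    simp [h1]

theorem integral_contour_eq (Φ : (Fin N → ℂ) × (Fin N' → ℂ) → ℂ)
    (acrit : (Fin N' → ℂ) → (Fin N → ℂ)) (T : (Fin N → ℂ) →L[ℂ] (Fin N → ℂ))
    (f : (Fin N → ℂ) × (Fin N' → ℂ) → ℂ) (b : Fin N' → ℂ) (a₀ : Fin N → ℝ) (ψ : (Fin N → ℝ) → ℂ)
    {h lam : ℝ} (hh : 0 < h) (hhl : h ^ 2 = lam⁻¹) :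
    ∫ x, Complex.exp (Complex.I * lam * Φ (acrit b + T (toComplex (x - a₀)), b)) *
        f (acrit b + T (toComplex (x - a₀)), b) * ψ (x - a₀) =
      ((h ^ N : ℝ) : ℂ) * Complex.exp (Complex.I * lam * Φ (acrit b, b)) *
        ∫ y, ψ (h • y) * scaledIntegrand Φ acrit T f b h y := by
  set F : (Fin N → ℝ) → ℂ := fun x =>
    Complex.exp (Complex.I * lam * Φ (acrit b + T (toComplex x), b)) *
      f (acrit b + T (toComplex x), b) * ψ x with hF
  have h1 : ∫ x, F (x - a₀) = ∫ x, F x := integral_sub_right_eq_self F a₀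
  have h2 := Measure.integral_comp_smul (volume : Measure (Fin N → ℝ)) F h
  have hN : |(h ^ Module.finrank ℝ (Fin N → ℝ))⁻¹| = (h ^ N)⁻¹ := by
    rw [Module.finrank_fin_fun, abs_of_pos (by positivity)]
  rw [hN] at h2
  have h3 : ∫ x, F x = ((h ^ N : ℝ) : ℂ) * ∫ y, F (h • y) := by
    have hhN : h ^ N ≠ 0 := (pow_pos hh N).ne'
    have h4 : ∀ z : ℂ, ((h ^ N)⁻¹ : ℝ) • z = (((h ^ N)⁻¹ : ℝ) : ℂ) * z := fun z => Complex.real_smul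
    rw [h2, h4, ← mul_assoc, ← Complex.ofReal_mul, mul_inv_cancel₀ hhN, Complex.ofReal_one, one_mul]
  have hlam : (lam : ℂ) = ((h : ℂ) ^ 2)⁻¹ := by
    rw [← Complex.ofReal_pow, hhl, Complex.ofReal_inv, inv_inv]
  have h5 : ∀ y, F (h • y) = Complex.exp (Complex.I * lam * Φ (acrit b, b)) *
      (ψ (h • y) * scaledIntegrand Φ acrit T f b h y) := fun y => by
    simp only [hF, scaledIntegrand, toComplex_smul, map_smul]
    have he : Complex.I * lam * Φ (acrit b + (h : ℂ) • T (toComplex y), b) =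
        Complex.I * lam * Φ (acrit b, b) +
          Complex.I * ((Φ (acrit b + (h : ℂ) • T (toComplex y), b) - Φ (acrit b, b)) / (h : ℂ) ^ 2) := by
      rw [hlam]
      ring
    rw [he, Complex.exp_add]
    ring
  have h6 : (∫ x, F (x - a₀)) = _ := h1.trans h3
  simp only [h5, integral_const_mul] at h6
  rw [mul_assoc]
  exact h6

/-- Deformation of the contour in an integral with a fixed cut-off which is constant where the
integrand is not small. -/
theorem norm_exp_mul_integral_cutoff_sub_le {n : ℕ} {W : (Fin n → ℝ) → Fin n → ℂ}
    {L : Fin n → Fin n → ℂ} (hW : IsAffineField W L) {φ : (Fin n → ℝ) → ℂ} (hφ : ContDiff ℝ ∞ φ)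
    (hφc : HasCompactSupport φ) {A : Set (Fin n → ℝ)} (hφA : tsupport φ ⊆ A) (hA : volume A < ⊤)
    {V : Set (ℝ × (Fin n → ℝ))} (hV : IsOpen V) {G : ℝ × (Fin n → ℝ) → ℂ} (hG : ContDiffOn ℝ 1 G V)
    (hGW : IsTransported W V G) {a₀ : Fin n → ℝ} {s₀ s₁ a d r Q : ℝ} (hs₀ : 0 ≤ s₀) (hs : s₀ ≤ s₁)
    (hmem : ∀ s ∈ Icc s₀ s₁, ∀ x ∈ A, (s, x) ∈ V) (hφ1 : ∀ x, dist x a₀ < r → φ x = 1)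
    (hd : ∀ i x, ‖pd i φ x‖ ≤ d) (ha : ∀ x ∈ A, ∑ i, ‖W x i‖ ≤ a) (hd0 : 0 ≤ d) (hQ0 : 0 ≤ Q)
    (ha0 : 0 ≤ a)
    (hQ : ∀ s ∈ Icc s₀ s₁, ∀ x ∈ A, r ≤ dist x a₀ → ‖G (s, x)‖ ≤ Q) :
    ‖Complex.exp (s₁ * ∑ i, L i i) * (∫ x, G (s₁, x) * φ x) -
      Complex.exp (s₀ * ∑ i, L i i) * ∫ x, G (s₀, x) * φ x‖ ≤
      Real.exp (s₁ * ‖∑ i, L i i‖) * (Q * (a * d) * volume.real A) * (s₁ - s₀) := by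
  refine norm_exp_mul_integral_sub_le hW hφ hφc hV hG hGW hs (fun s hs x hx => hmem s hs x (hφA hx))
    fun s hs => ?_
  rw [norm_mul]
  refine mul_le_mul ?_ ?_ (norm_nonneg _) (Real.exp_pos _).le
  · refine (Complex.norm_exp_le_exp_norm _).trans (Real.exp_le_exp.2 ?_)
    rw [norm_mul, Complex.norm_real, Real.norm_of_nonneg (hs₀.trans hs.1)]
    exact mul_le_mul_of_nonneg_right hs.2 (norm_nonneg _)
  · refine norm_integral_le_of_norm_le_const_of_eq_zero hA (fun x hx => ?_) fun x hx => ?_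
    · rcases lt_or_ge (dist x a₀) r with h | h
      · have h0 : vecField W φ x = 0 := by
          have h1 : φ =ᶠ[𝓝 x] fun _ => 1 := by
            filter_upwards [isOpen_ball.mem_nhds (show x ∈ ball a₀ r from h)] with z hz
            exact hφ1 z hz
          refine Finset.sum_eq_zero fun i _ => ?_
          rw [pd, h1.fderiv_eq]
          simp
        rw [h0, mul_zero, norm_zero]
        positivity
      · rw [norm_mul]
        refine mul_le_mul (hQ s hs x hx h) ?_ (norm_nonneg _) hQ0
        refine (norm_sum_le _ _).trans ?_
        calc ∑ i, ‖W x i * pd i φ x‖ ≤ ∑ i, ‖W x i‖ * d := by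
              refine Finset.sum_le_sum fun i _ => ?_
              rw [norm_mul]
              exact mul_le_mul_of_nonneg_left (hd i x) (norm_nonneg _)
          _ = (∑ i, ‖W x i‖) * d := (Finset.sum_mul _ _ _).symm
          _ ≤ a * d := mul_le_mul_of_nonneg_right (ha x hx) hd0
    · rw [image_eq_zero_of_notMem_tsupport (fun h => hx (hφA (tsupport_vecField_subset W φ h))),
        mul_zero]

theorem exists_bound_pd {n : ℕ} {φ : (Fin n → ℝ) → ℂ} (hφ : ContDiff ℝ ∞ φ)
    (hφc : HasCompactSupport φ) : ∃ d, 0 ≤ d ∧ ∀ i x, ‖pd i φ x‖ ≤ d := by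
  have h : ∀ i, ∃ d, ∀ x, ‖pd i φ x‖ ≤ d := fun i =>
    (hφ.pd i).continuous.bounded_above_of_compact_support
      (hφc.of_isClosed_subset (isClosed_tsupport _) (tsupport_pd_subset i φ))
  choose d hd using h
  refine ⟨∑ i, |d i|, Finset.sum_nonneg fun _ _ => abs_nonneg _, fun i x => ?_⟩
  exact ((hd i x).trans (le_abs_self _)).trans
    (Finset.single_le_sum (f := fun i => |d i|) (fun _ _ => abs_nonneg _) (Finset.mem_univ i))

end Contour

/-! ### From the real domain to the contour through the critical point -/

section ContourDeformation

open Metric Set MeasureTheory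

variable {N : ℕ}

/-- The integrand `g` extends along the complex deformation `flow L a₀`, followed by a translation by
`w`, and decays with rate `Λ` away from `a₀`. -/
structure IsDeformable (L : (Fin N → ℂ) →L[ℂ] (Fin N → ℂ)) (a₀ : Fin N → ℝ) (δ ρ r : ℝ)
    (w : Fin N → ℂ) (g : (Fin N → ℂ) → ℂ) (Q Λ : ℝ) : Prop where
  analytic_flow : ∀ s, |s| < 2 * δ → ∀ x, dist x a₀ < ρ → AnalyticAt ℂ g (flow L a₀ s x)
  analytic_shift : ∀ t : ℝ, |t| < 2 → ∀ x, dist x a₀ < ρ →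
    AnalyticAt ℂ g (flow L a₀ δ x + (t : ℂ) • w)
  nonneg : 0 ≤ Q
  decay : ∀ s ∈ Icc 0 δ, ∀ x, dist x a₀ < ρ → r ≤ dist x a₀ →
    ‖g (flow L a₀ s x)‖ ≤ Q * Real.exp (-Λ * s)
  decay_shift : ∀ t ∈ Icc (0 : ℝ) 1, ∀ x, dist x a₀ < ρ → r ≤ dist x a₀ →
    ‖g (flow L a₀ δ x + (t : ℂ) • w)‖ ≤ Q * Real.exp (-Λ * δ)

variable {L : (Fin N → ℂ) →L[ℂ] (Fin N → ℂ)} {a₀ : Fin N → ℝ} {δ ρ r : ℝ}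

/-- The Jacobian of the deformation `flow L a₀ s`. -/
noncomputable def flowJacobian (L : (Fin N → ℂ) →L[ℂ] (Fin N → ℂ)) (s : ℝ) : ℂ :=
  Complex.exp (s * ∑ i, L (Pi.single i 1) i)

theorem sum_norm_flowField_le (L : (Fin N → ℂ) →L[ℂ] (Fin N → ℂ)) (a₀ x : Fin N → ℝ) {ρ : ℝ}
    (hx : dist x a₀ < ρ) : ∑ i, ‖flowField L a₀ x i‖ ≤ N * (‖L‖ * ρ) := by
  refine (Finset.sum_le_card_nsmul _ _ (‖L‖ * ρ) fun i _ => ?_).trans_eq (by simp)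
  refine (norm_le_pi_norm _ i).trans ((L.le_opNorm _).trans ?_)
  rw [norm_toComplex, ← dist_eq_norm]
  gcongr

theorem NormedSpace.exp_mul_exp_neg {𝔸 : Type*} [NormedRing 𝔸] [NormedAlgebra ℂ 𝔸] [CompleteSpace 𝔸]
    (x : 𝔸) : NormedSpace.exp x * NormedSpace.exp (-x) = 1 := by
  let _ : NormedAlgebra ℚ 𝔸 := NormedAlgebra.restrictScalars ℚ ℂ 𝔸
  rw [← NormedSpace.exp_add_of_commute (Commute.refl x).neg_right, add_neg_cancel, NormedSpace.exp_zero]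

theorem exp_smul_apply_exp_neg_smul (L : (Fin N → ℂ) →L[ℂ] (Fin N → ℂ)) (s : ℝ) (z : Fin N → ℂ) :
    NormedSpace.exp (s • L) (NormedSpace.exp (-(s • L)) z) = z :=
  congrArg (fun S : (Fin N → ℂ) →L[ℂ] (Fin N → ℂ) => S z) (NormedSpace.exp_mul_exp_neg (s • L))

theorem isOpen_strip (a₀ : Fin N → ℝ) (δ ρ : ℝ) :
    IsOpen {p : ℝ × (Fin N → ℝ) | |p.1| < δ ∧ dist p.2 a₀ < ρ} :=
  (isOpen_lt (f := fun p : ℝ × (Fin N → ℝ) => |p.1|) (by fun_prop) continuous_const).inter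
    (isOpen_lt (f := fun p : ℝ × (Fin N → ℝ) => dist p.2 a₀) (by fun_prop) continuous_const)

/-- From time `s` on the integrand is of size `e^(-Λs)` wherever `ψ` is not locally constant. A
fixed cut-off can therefore be kept both for the rest of the flow and for the translation, without
Taylor transport. -/
theorem exists_norm_shifted_contour_sub_le (L : (Fin N → ℂ) →L[ℂ] (Fin N → ℂ)) (a₀ : Fin N → ℝ)
    (r : ℝ) (hδ : 0 < δ) (hρ : 0 < ρ) {ψ : (Fin N → ℝ) → ℂ} (hψ : ContDiff ℝ ∞ ψ)
    (hψc : HasCompactSupport ψ) (hψρ : tsupport ψ ⊆ ball a₀ ρ) (hψ1 : ∀ x, dist x a₀ < r → ψ x = 1) :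
    ∃ K : ℝ, 0 < K ∧ ∀ (w : Fin N → ℂ), ‖w‖ ≤ 1 → ∀ (g : (Fin N → ℂ) → ℂ) (Q Λ : ℝ), 0 ≤ Λ →
      IsDeformable L a₀ δ ρ r w g Q Λ → ∀ s ∈ Icc 0 δ,
      ‖flowJacobian L δ * (∫ x, g (flow L a₀ δ x + w) * ψ x) -
        flowJacobian L s * ∫ x, g (flow L a₀ s x) * ψ x‖ ≤ K * Q * Real.exp (-Λ * s) := by
  obtain ⟨d, hd0, hd⟩ := exists_bound_pd hψ hψc
  set S : (Fin N → ℂ) →L[ℂ] (Fin N → ℂ) := NormedSpace.exp (-(δ • L)) with hS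
  set t₀ := ∑ i, L (Pi.single i 1) i with ht₀
  set v := volume.real (ball a₀ ρ) with hv
  have hvol : volume (ball a₀ ρ) < ⊤ := measure_ball_lt_top
  have hJ : ∀ s ∈ Icc 0 δ, ‖flowJacobian L s‖ ≤ Real.exp (δ * ‖t₀‖) := fun s hs => by
    refine (Complex.norm_exp_le_exp_norm _).trans (Real.exp_le_exp.2 ?_)
    rw [norm_mul, Complex.norm_real, Real.norm_of_nonneg hs.1]
    exact mul_le_mul_of_nonneg_right hs.2 (norm_nonneg _)
  refine ⟨Real.exp (δ * ‖t₀‖) * (N * (‖L‖ * ρ) * d * v) * δ +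
    Real.exp (δ * ‖t₀‖) * (N * ‖S‖ * d * v) + 1, by positivity, fun w hw g Q Λ hΛ H s hs => ?_⟩
  have hQ := H.nonneg
  have hflow := isTransported_flow L a₀ (V := {p | |p.1| < 2 * δ ∧ dist p.2 a₀ < ρ}) (g := g)
    fun p hp => H.analytic_flow p.1 hp.1 p.2 hp.2
  have hshift := isTransported_shift (NormedSpace.exp (δ • L)) S (exp_smul_apply_exp_neg_smul L δ)
    (toComplex a₀) w a₀ (V := {p | |p.1| < 2 ∧ dist p.2 a₀ < ρ}) (g := g)
    fun p hp => H.analytic_shift p.1 hp.1 p.2 hp.2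
  have h1 := norm_exp_mul_integral_cutoff_sub_le (isAffineField_flowField L a₀) hψ hψc hψρ hvol
    (isOpen_strip a₀ (2 * δ) ρ) hflow.2 hflow.1 (a₀ := a₀) (s₀ := s) (s₁ := δ) (r := r) (d := d)
    (a := N * (‖L‖ * ρ)) (Q := Q * Real.exp (-Λ * s)) hs.1 hs.2
    (fun s' hs' x hx => ⟨by rw [abs_of_nonneg (hs.1.trans hs'.1)]; linarith [hs'.2], hx⟩) hψ1 hd
    (fun x hx => sum_norm_flowField_le L a₀ x hx) hd0 (by positivity) (by positivity)
    (fun s' hs' x hx hxr => (H.decay s' ⟨hs.1.trans hs'.1, hs'.2⟩ x hx hxr).trans 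
      (mul_le_mul_of_nonneg_left (Real.exp_le_exp.2 (by nlinarith [hs'.1])) hQ))
  have h2 := norm_exp_mul_integral_cutoff_sub_le (isAffineField_const (S w)) hψ hψc hψρ hvol
    (isOpen_strip a₀ 2 ρ) hshift.2 hshift.1 (a₀ := a₀) (s₀ := 0) (s₁ := 1) (r := r) (d := d)
    (a := N * ‖S‖) (Q := Q * Real.exp (-Λ * s)) le_rfl zero_le_one
    (fun s' hs' x hx => ⟨by rw [abs_of_nonneg hs'.1]; linarith [hs'.2], hx⟩) hψ1 hd
    (fun x _ => by
      refine (Finset.sum_le_card_nsmul _ _ ‖S‖ fun i _ => ?_).trans_eq (by simp)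
      refine (norm_le_pi_norm _ i).trans ((S.le_opNorm _).trans ?_)
      exact mul_le_of_le_one_right (norm_nonneg _) hw) hd0 (by positivity) (by positivity)
    (fun t ht x hx hxr => (H.decay_shift t ht x hx hxr).trans 
      (mul_le_mul_of_nonneg_left (Real.exp_le_exp.2 (by nlinarith [hs.2])) hQ))
  simp only [Finset.sum_const_zero, mul_zero, Complex.exp_zero, one_mul, norm_zero, Real.exp_zero,
    Complex.ofReal_one, one_smul, Complex.ofReal_zero, zero_smul, add_zero, sub_zero, mul_one] at h2
  have h2' : ‖(∫ x, g (flow L a₀ δ x + w) * ψ x) - ∫ x, g (flow L a₀ δ x) * ψ x‖ ≤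
    Q * Real.exp (-Λ * s) * (N * ‖S‖ * d) * v := h2
  have h3 : ‖flowJacobian L δ * (∫ x, g (flow L a₀ δ x) * ψ x) -
      flowJacobian L s * ∫ x, g (flow L a₀ s x) * ψ x‖ ≤
      Real.exp (δ * ‖t₀‖) * (Q * Real.exp (-Λ * s) * (N * (‖L‖ * ρ) * d) * v) * (δ - s) := h1
  have e1 : flowJacobian L δ * (∫ x, g (flow L a₀ δ x + w) * ψ x) -
      flowJacobian L s * ∫ x, g (flow L a₀ s x) * ψ x =
      flowJacobian L δ * ((∫ x, g (flow L a₀ δ x + w) * ψ x) - ∫ x, g (flow L a₀ δ x) * ψ x) +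
      (flowJacobian L δ * (∫ x, g (flow L a₀ δ x) * ψ x) -
        flowJacobian L s * ∫ x, g (flow L a₀ s x) * ψ x) := by ring
  rw [e1]
  refine (norm_add_le _ _).trans ?_
  rw [norm_mul]
  calc _ ≤ Real.exp (δ * ‖t₀‖) * (Q * Real.exp (-Λ * s) * (N * ‖S‖ * d) * v) +
        Real.exp (δ * ‖t₀‖) * (Q * Real.exp (-Λ * s) * (N * (‖L‖ * ρ) * d) * v) * δ := by
        refine add_le_add (mul_le_mul (hJ δ (right_mem_Icc.2 hδ.le)) h2' (norm_nonneg _)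
          (Real.exp_pos _).le) (h3.trans ?_)
        gcongr
        linarith [hs.1]
    _ = (Real.exp (δ * ‖t₀‖) * (N * (‖L‖ * ρ) * d * v) * δ +
        Real.exp (δ * ‖t₀‖) * (N * ‖S‖ * d * v)) * Q * Real.exp (-Λ * s) := by ring
    _ ≤ _ := mul_le_mul_of_nonneg_right (mul_le_mul_of_nonneg_right (by linarith) hQ)
        (Real.exp_pos _).le

/-- Both `(m+1)^(m+1)/(m+1)!` and `m + 1` are at most `e^(m+1)`; the smallness `e^(-3)` of `s * k`
pays for these two factors and leaves one to spare. -/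
theorem pow_div_factorial_mul_pow_le {s k : ℝ} (hs : 0 ≤ s) (hk : 0 ≤ k)
    (hsk : s * k ≤ Real.exp (-3)) (m : ℕ) :
    s ^ m / m.factorial * (k * (m + 1)) ^ (m + 1) * s ≤ Real.exp (-((m : ℝ) + 1)) := by
  have h1 : ((m : ℝ) + 1) ^ (m + 1) / (m + 1).factorial ≤ Real.exp ((m : ℝ) + 1) :=
    Real.pow_div_factorial_le_exp _ (by positivity) (m + 1)
  have h2 : (m : ℝ) + 1 ≤ Real.exp ((m : ℝ) + 1) := by linarith [Real.add_one_le_exp ((m : ℝ) + 1)]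
  calc s ^ m / m.factorial * (k * (m + 1)) ^ (m + 1) * s
      = (s * k) ^ (m + 1) * ((m : ℝ) + 1) * (((m : ℝ) + 1) ^ (m + 1) / (m + 1).factorial) := by
        rw [Nat.factorial_succ, mul_pow, mul_pow]
        push_cast
        field_simp
        ring
    _ ≤ Real.exp (-3) ^ (m + 1) * Real.exp ((m : ℝ) + 1) * Real.exp ((m : ℝ) + 1) := by
        gcongr
    _ = Real.exp (-((m : ℝ) + 1)) := by
        rw [← Real.exp_nat_mul, ← Real.exp_add, ← Real.exp_add]
        push_cast
        ring_nf

/-- The Ehrenpreis cut-off is transported only for the short time `s`, after which it is exchanged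
for the fixed `ψ`. The first error is the Taylor remainder of the transport; the second compares the
size of the transported cut-off with the decay `e^(-Λs)` gained by time `s`. -/
theorem exists_norm_contour_sub_cutoff_le (L : (Fin N → ℂ) →L[ℂ] (Fin N → ℂ)) (a₀ : Fin N → ℝ)
    (r : ℝ) (hδ : 0 < δ) (hρ : 0 < ρ) {ψ : (Fin N → ℝ) → ℂ} (hψ : ContDiff ℝ ∞ ψ)
    (hψc : HasCompactSupport ψ) (hψn : ∀ x, ‖ψ x‖ ≤ 1) (hψ1 : ∀ x, dist x a₀ < r → ψ x = 1)
    {A A' : Set (Fin N → ℝ)} (hAρ : A ⊆ ball a₀ ρ) (hA' : IsOpen A') (hA'A : A' ⊆ A)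
    (hψA : tsupport ψ ⊆ A') (hr : ball a₀ r ⊆ A') {C : ℝ} (hC : 0 < C) :
    ∃ s k K : ℝ, 0 < s ∧ 0 < k ∧ 0 < K ∧ ∀ (w : Fin N → ℂ), ‖w‖ ≤ 1 →
      ∀ (g : (Fin N → ℂ) → ℂ) (Q Λ : ℝ), 0 ≤ Λ → IsDeformable L a₀ δ ρ r w g Q Λ →
      ∀ χ : ℕ → (Fin N → ℝ) → ℝ, IsEhrenpreisCutoff A A' C χ → ∀ m : ℕ,
      ‖flowJacobian L δ * (∫ x, g (flow L a₀ δ x + w) * ψ x) -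
        ∫ x, g (toComplex x) * (χ (m + 1) x : ℂ)‖ ≤
        K * Q * (Real.exp (-((m : ℝ) + 1)) + Real.exp (s * (k * ((m : ℝ) + 1) - Λ))) := by
  obtain ⟨K, hK, hKb⟩ := exists_norm_shifted_contour_sub_le L a₀ r hδ hρ hψ hψc
    ((hψA.trans hA'A).trans hAρ) hψ1
  have hvol : volume A < ⊤ := (measure_mono hAρ).trans_lt measure_ball_lt_top
  set a : ℝ := N * (‖L‖ * ρ) with ha
  have ha0 : 0 ≤ a := by positivity
  set ℓ : ℝ := ∑ l, ∑ i, ‖L (Pi.single l 1) i‖ + 1 with hℓ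
  have hℓ0 : 0 < ℓ := by
    have : 0 ≤ ∑ l, ∑ i, ‖L (Pi.single l 1) i‖ :=
      Finset.sum_nonneg fun _ _ => Finset.sum_nonneg fun _ _ => norm_nonneg _
    linarith
  set k := a * C + ℓ with hk
  have hk0 : 0 < k := by positivity
  -- The time must shrink as the growth constant `C` of the cut-offs increases; the decay it buys
  -- then decreases accordingly.
  set s := min δ (Real.exp (-3) / k) with hs
  have hs0 : 0 < s := lt_min hδ (by positivity)
  have hsδ : s ≤ δ := min_le_left _ _
  have hsk : s * k ≤ Real.exp (-3) := by
    rw [← le_div_iff₀ hk0]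
    exact min_le_right _ _
  set t₀ := ∑ i, L (Pi.single i 1) i with ht₀
  set K₂ := Real.exp (s * ‖t₀‖) * volume.real A with hK₂
  have hK₂0 : 0 ≤ K₂ := by positivity
  refine ⟨s, k, 2 * K₂ + K, hs0, hk0, by positivity, fun w hw g Q Λ hΛ H χ hχ m => ?_⟩
  have hQ := H.nonneg
  have h1 := hKb w hw g Q Λ hΛ H s ⟨hs0.le, hsδ⟩
  have hflow := isTransported_flow L a₀ (V := {p | |p.1| < 2 * δ ∧ dist p.2 a₀ < ρ}) (g := g)
    fun p hp => H.analytic_flow p.1 hp.1 p.2 hp.2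
  have h2 := norm_integral_cutoff_sub_le (isAffineField_flowField L a₀) (isOpen_strip a₀ (2 * δ) ρ)
    hflow.2 hflow.1 hχ hvol hA' (s₁ := s) (a := a) (ℓ := ℓ) (Q := Q) (Q' := Q * Real.exp (-Λ * s))
    (r := r) (a₀ := a₀) hs0.le hC.le hℓ0.le ha0
    (fun x hx => sum_norm_flowField_le L a₀ x (hAρ hx))
    (fun l => by
      have := Finset.single_le_sum (f := fun l => ∑ i, ‖L (Pi.single l 1) i‖)
        (fun _ _ => Finset.sum_nonneg fun _ _ => norm_nonneg _) (Finset.mem_univ l)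
      exact this.trans (by linarith))
    (fun s' hs' x hx => ⟨by rw [abs_of_nonneg hs'.1]; linarith [hs'.2], hAρ hx⟩)
    (fun s' hs' x hx => (H.decay s' ⟨hs'.1, hs'.2.trans hsδ⟩ x (hAρ hx.1)
      (not_lt.1 fun h => hx.2 (hr h))).trans (mul_le_of_le_one_right hQ (Real.exp_le_one_iff.2 (by
        nlinarith [hs'.1])))) hQ
    (fun x hx hxr => H.decay s ⟨hs0.le, hsδ⟩ x (hAρ hx) hxr) (by positivity) hψ.continuous hψn hψ1
    hψA hA'A hr m
  simp only [flow_zero] at h2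
  have h3 := pow_div_factorial_mul_pow_le hs0.le hk0.le hsk m
  have h2' : ‖flowJacobian L s * (∫ x, g (flow L a₀ s x) * ψ x) -
      ∫ x, g (toComplex x) * (χ (m + 1) x : ℂ)‖ ≤ K₂ * (Q * Real.exp (-((m : ℝ) + 1)) +
        2 * (Q * Real.exp (s * (k * ((m : ℝ) + 1) - Λ)))) := by
    refine h2.trans ?_
    refine mul_le_mul_of_nonneg_left ?_ hK₂0
    refine add_le_add (mul_le_mul_of_nonneg_left h3 hQ) ?_
    have hone : 1 ≤ Real.exp (s * (k * ((m : ℝ) + 1))) := Real.one_le_exp (by positivity)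
    calc Q * Real.exp (-Λ * s) * (Real.exp (s * (k * ((m : ℝ) + 1))) + 1)
        ≤ Q * Real.exp (-Λ * s) * (2 * Real.exp (s * (k * ((m : ℝ) + 1)))) := by
          gcongr
          linarith
      _ = 2 * (Q * (Real.exp (-Λ * s) * Real.exp (s * (k * ((m : ℝ) + 1))))) := by ring
      _ = _ := by rw [← Real.exp_add]; ring_nf
  have h1' : Real.exp (-Λ * s) ≤ Real.exp (s * (k * ((m : ℝ) + 1) - Λ)) := by
    refine Real.exp_le_exp.2 ?_
    have : 0 ≤ s * (k * ((m : ℝ) + 1)) := by positivity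
    linarith [mul_sub s (k * ((m : ℝ) + 1)) Λ]
  refine (norm_sub_le_norm_sub_add_norm_sub _
    (flowJacobian L s * ∫ x, g (flow L a₀ s x) * ψ x) _).trans ?_
  refine (add_le_add h1 h2').trans ?_
  have e1 := (Real.exp_pos (-((m : ℝ) + 1))).le
  have e2 := (Real.exp_pos (s * (k * ((m : ℝ) + 1) - Λ))).le
  calc _ ≤ K * Q * (Real.exp (-((m : ℝ) + 1)) + Real.exp (s * (k * ((m : ℝ) + 1) - Λ))) +
        2 * K₂ * Q * (Real.exp (-((m : ℝ) + 1)) + Real.exp (s * (k * ((m : ℝ) + 1) - Λ))) := by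
        refine add_le_add ?_ ?_
        · gcongr
          linarith
        · nlinarith [mul_nonneg (mul_nonneg hK₂0 hQ) e1]
    _ = _ := by ring

end ContourDeformation

/-! ### Choice of neighbourhoods uniform in the parameter -/

section Geometry

open Metric Set MeasureTheory

variable {N N' : ℕ}

/-- All growth estimates are strict inequalities at `b₀` on the compact annulus `ρ/8 ≤ |x - a₀| ≤
ρ₂`, so they persist for `b` near `b₀`. The flow and `ρ₂` are fixed before `ρ`, whereas `R` and the
decay rate `c` may depend on `ρ`, which is fitted to `A'` only later. -/
theorem exists_steepest_descent {Φ : (Fin N → ℂ) × (Fin N' → ℂ) → ℂ} {A₀ : Set (Fin N → ℝ)}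
    {B₀ : Set (Fin N' → ℝ)} (hA₀ : IsOpen A₀) (hB₀ : IsOpen B₀) {a₀ : Fin N → ℝ} {b₀ : Fin N' → ℝ}
    (ha₀ : a₀ ∈ A₀) (hb₀ : b₀ ∈ B₀) {A₀C : Set (Fin N → ℂ)} {B₀C : Set (Fin N' → ℂ)}
    (hA₀C : IsOpen A₀C) (hB₀C : IsOpen B₀C) (haC : toComplex a₀ ∈ A₀C) (hbC : toComplex b₀ ∈ B₀C)
    (hΦ : AnalyticOnNhd ℂ Φ (A₀C ×ˢ B₀C)) (hgrad : phaseGrad Φ (toComplex a₀) (toComplex b₀) = 0)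
    (hhess : (phaseHessian Φ (toComplex a₀) (toComplex b₀)).det ≠ 0)
    (him : ∀ a ∈ A₀, ∀ b ∈ B₀, 0 ≤ (Φ (toComplex a, toComplex b)).im)
    (him0 : (Φ (toComplex a₀, toComplex b₀)).im = 0)
    {AC : Set (Fin N → ℂ)} {BC : Set (Fin N' → ℂ)} {acrit : (Fin N' → ℂ) → (Fin N → ℂ)}
    (hBC : IsOpen BC) (hbBC : toComplex b₀ ∈ BC)
    (hcrit : IsCriticalPointMap Φ (toComplex a₀) (toComplex b₀) AC BC acrit) :
    ∃ (L : (Fin N → ℂ) →L[ℂ] (Fin N → ℂ)) (δ ρ₁ ρ₂ ρ₃ κ : ℝ), 0 < δ ∧ 0 < ρ₁ ∧ 0 < ρ₂ ∧ 0 < ρ₃ ∧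
      closedBall (toComplex a₀) ρ₁ ⊆ A₀C ∧ closedBall (toComplex b₀) ρ₁ ⊆ B₀C ∧
      closedBall a₀ ρ₂ ⊆ A₀ ∧ (∀ x, dist x a₀ < ρ₂ → toComplex x ∈ closedBall (toComplex a₀) ρ₁) ∧
      ∀ ρ, 0 < ρ → ρ ≤ ρ₃ → ∃ R c : ℝ, 0 < R ∧ R ≤ ρ₁ ∧ 0 < c ∧ closedBall (toComplex b₀) R ⊆ BC ∧
        closedBall b₀ R ⊆ B₀ ∧
        IsGaussianPhase Φ acrit (NormedSpace.exp (δ • L))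
          (closedBall (toComplex a₀) ρ₁ ×ˢ closedBall (toComplex b₀) ρ₁)
          (closedBall (toComplex b₀) R) ρ κ ∧
        ∀ b ∈ closedBall b₀ R, ‖acrit (toComplex b) - toComplex a₀‖ ≤ 1 ∧
          ∀ (f : (Fin N → ℂ) × (Fin N' → ℂ) → ℂ) (Q : ℝ),
          AnalyticOnNhd ℂ f (closedBall (toComplex a₀) ρ₁ ×ˢ closedBall (toComplex b₀) ρ₁) →
          (∀ p ∈ closedBall (toComplex a₀) ρ₁ ×ˢ closedBall (toComplex b₀) ρ₁, ‖f p‖ ≤ Q) →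
          ∀ lam : ℝ, 0 ≤ lam → IsDeformable L a₀ δ ρ₂ (ρ / 8) (acrit (toComplex b) - toComplex a₀)
            (fun z => Complex.exp (Complex.I * lam * Φ (z, toComplex b)) * f (z, toComplex b))
            Q (c * lam) := by
  obtain ⟨ρa, hρa, hρaA⟩ := nhds_basis_closedBall.mem_iff.1 (hA₀C.mem_nhds haC)
  obtain ⟨ρb, hρb, hρbB⟩ := nhds_basis_closedBall.mem_iff.1 (hB₀C.mem_nhds hbC)
  obtain ⟨ρA, hρA, hρAA⟩ := nhds_basis_closedBall.mem_iff.1 (hA₀.mem_nhds ha₀)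
  set ρ₁ := min ρa ρb with hρ₁def
  have hρ₁ : 0 < ρ₁ := lt_min hρa hρb
  have hA₁ : closedBall (toComplex a₀) ρ₁ ⊆ A₀C := (closedBall_subset_closedBall (min_le_left _ _)).trans hρaA
  have hB₁ : closedBall (toComplex b₀) ρ₁ ⊆ B₀C := (closedBall_subset_closedBall (min_le_right _ _)).trans hρbB
  set U := closedBall (toComplex a₀) ρ₁ ×ˢ closedBall (toComplex b₀) ρ₁ with hU
  have hUsub : U ⊆ A₀C ×ˢ B₀C := prod_mono hA₁ hB₁
  have hΦU : AnalyticOnNhd ℂ Φ U := hΦ.mono hUsub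
  have hpg := analyticOnNhd_phaseGrad (hA₀C.prod hB₀C) hΦ
  have hdiff : DifferentiableAt ℂ (fun x => phaseGrad Φ x (toComplex b₀)) (toComplex a₀) :=
    DifferentiableAt.comp (g := fun p : (Fin N → ℂ) × (Fin N' → ℂ) => phaseGrad Φ p.1 p.2)
      (f := fun x => (x, toComplex b₀)) (toComplex a₀)
      (hpg (toComplex a₀, toComplex b₀) ⟨haC, hbC⟩).differentiableAt (by fun_prop)
  -- The flow stays within half the radius `ρ₁`, leaving room for the translation to the critical
  -- point.
  obtain ⟨L, δ, c, ρ', hδ, hc, hρ', hball, hrate⟩ :=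
    exists_deformation hdiff hgrad hhess (half_pos hρ₁)
  set ρ₂ := min ρ' ρA with hρ₂def
  have hρ₂ : 0 < ρ₂ := lt_min hρ' hρA
  have hA₂ : closedBall a₀ ρ₂ ⊆ A₀ := (closedBall_subset_closedBall (min_le_right _ _)).trans hρAA
  have hball' : ∀ s : ℝ, |s| ≤ 2 * δ → ∀ x, dist x a₀ ≤ ρ₂ →
      dist (flow L a₀ s x) (toComplex a₀) < ρ₁ / 2 := fun s hs x hx =>
    hball s hs x (hx.trans (min_le_left _ _))
  have habs : ∀ s ∈ Icc 0 δ, |s| ≤ 2 * δ := fun s hs => by rw [abs_of_nonneg hs.1]; linarith [hs.2]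
  have hflU : ∀ s : ℝ, |s| ≤ 2 * δ → ∀ x, dist x a₀ ≤ ρ₂ → ∀ b ∈ closedBall (toComplex b₀) ρ₁,
      (flow L a₀ s x, b) ∈ U := fun s hs x hx b hb =>
    ⟨by rw [mem_closedBall]; linarith [hball' s hs x hx], hb⟩
  have hb₀U : toComplex b₀ ∈ closedBall (toComplex b₀) ρ₁ := mem_closedBall_self hρ₁.le
  have hlow : ∀ x, dist x a₀ ≤ ρ₂ → c * dist x a₀ ^ 2 * δ ≤ (Φ (flow L a₀ δ x, toComplex b₀)).im := by
    intro x hx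
    have h1 := im_add_mul_le_im_flow (Φ := Φ) (b := toComplex b₀) (k := c * dist x a₀ ^ 2)
      (fun s hs => (hΦU _ (hflU s (habs s hs) x hx _ hb₀U)).differentiableAt)
      (fun s hs => hrate s (habs s hs) x (hx.trans (min_le_left _ _))) (right_mem_Icc.2 hδ.le)
    linarith [him x (hA₂ hx) b₀ hb₀]
  have hacritAt := hcrit.holomorphic _ hbBC
  have hcritev : ∀ᶠ b in 𝓝 (toComplex b₀), phaseGrad Φ (acrit b) b = 0 := by
    filter_upwards [hBC.mem_nhds hbBC] with b hb
    exact (hcrit.critical_iff _ (hcrit.mapsTo b hb) b hb).2 rfl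
  obtain ⟨ρm, κ, hρm, hκ, hgauss⟩ := exists_gaussian_bound (c := c * δ)
    (T := NormedSpace.exp (δ • L)) hρ₁ hρ₂ (by positivity) hΦU hacritAt.continuousAt hcrit.base
    hcritev (fun x hx => by
      have := hlow x hx
      rw [him0, zero_add]
      calc c * δ * dist x a₀ ^ 2 = c * dist x a₀ ^ 2 * δ := by ring
        _ ≤ _ := this)
  set T := NormedSpace.exp (δ • L) with hT
  refine ⟨L, δ, ρ₁, ρ₂, min ρm (ρ₁ / (2 * (‖T‖ + 1))), κ, hδ, hρ₁, hρ₂, by positivity, hA₁, hB₁, hA₂,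
    fun x hx => ?_, fun ρ hρ hρle => ?_⟩
  · have := hball' 0 (by simpa using hδ.le) x hx.le
    rw [flow_zero] at this
    rw [mem_closedBall]
    linarith
  set r := ρ / 8 with hr
  have hr0 : 0 < r := by positivity
  have hKx : IsCompact {x : Fin N → ℝ | dist x a₀ ≤ ρ₂ ∧ r ≤ dist x a₀} :=
    (isCompact_closedBall a₀ ρ₂).inter_right (isClosed_le continuous_const
      (continuous_id.dist continuous_const))
  have hflc : ∀ (p : ℝ × (Fin N → ℝ)) (b : Fin N' → ℂ), ContinuousAt
      (fun y : (Fin N' → ℂ) × (ℝ × (Fin N → ℝ)) => flow L a₀ y.2.1 y.2.2) (b, p) := fun p b =>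
    ((contDiff_flow L a₀).continuous.comp continuous_snd).continuousAt
  -- Rate of increase of `Im Φ` along the flow, for parameters near `b₀`.
  have hE1 := ((isCompact_Icc (a := (0 : ℝ)) (b := δ)).prod hKx).eventually_forall_lt
    (y := toComplex b₀) (c := c * r ^ 2 / 2)
    (F := fun p b => (phaseGrad Φ (flow L a₀ p.1 p.2) b (L (flow L a₀ p.1 p.2 - toComplex a₀))).im)
    (fun p hp => by
      refine Complex.continuous_im.continuousAt.comp' (ContinuousAt.clm_apply ?_ ?_)
      · refine ContinuousAt.comp (g := fun p : (Fin N → ℂ) × (Fin N' → ℂ) => phaseGrad Φ p.1 p.2)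
          (f := fun y : (Fin N' → ℂ) × (ℝ × (Fin N → ℝ)) => (flow L a₀ y.2.1 y.2.2, y.1))
          ?_ ((hflc p _).prodMk continuousAt_fst)
        exact (hpg _ (hUsub (hflU p.1 (habs _ hp.1) p.2 hp.2.1 _ hb₀U))).continuousAt
      · exact L.continuous.continuousAt.comp' ((hflc p _).sub continuousAt_const))
    (fun p hp => by
      refine lt_of_lt_of_le ?_ (hrate p.1 (habs _ hp.1) p.2 (hp.2.1.trans (min_le_left _ _)))
      have h1 : c * r ^ 2 ≤ c * dist p.2 a₀ ^ 2 := by gcongr; exact hp.2.2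
      have h2 : 0 < c * r ^ 2 := by positivity
      linarith)
  -- Positivity of `Im Φ` during the translation: at `b₀` the shift vanishes, so the bound at the
  -- end of the flow applies there.
  have hE2 := ((isCompact_Icc (a := (0 : ℝ)) (b := 1)).prod hKx).eventually_forall_lt
    (y := toComplex b₀) (c := c * r ^ 2 / 2 * δ)
    (F := fun p b => (Φ (flow L a₀ δ p.2 + (p.1 : ℂ) • (acrit b - toComplex a₀), b)).im)
    (fun p hp => by
      refine Complex.continuous_im.continuousAt.comp' ?_
      refine ContinuousAt.comp (g := Φ) (f := fun y : (Fin N' → ℂ) × (ℝ × (Fin N → ℝ)) =>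
        (flow L a₀ δ y.2.2 + (y.2.1 : ℂ) • (acrit y.1 - toComplex a₀), y.1)) ?_ ?_
      · simp only [hcrit.base, sub_self, smul_zero, add_zero]
        exact (hΦU _ (hflU δ (habs _ (right_mem_Icc.2 hδ.le)) p.2 hp.2.1 _ hb₀U)).continuousAt
      · have hc2 : Continuous fun y : (Fin N' → ℂ) × (ℝ × (Fin N → ℝ)) => (δ, y.2.2) := by fun_prop
        have hc3 : ContinuousAt (fun y : (Fin N' → ℂ) × (ℝ × (Fin N → ℝ)) => acrit y.1)
            (toComplex b₀, p) :=
          ContinuousAt.comp (f := Prod.fst) (g := acrit) hacritAt.continuousAt continuousAt_fst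
        have hc4 : ContinuousAt (fun y : (Fin N' → ℂ) × (ℝ × (Fin N → ℝ)) => flow L a₀ δ y.2.2)
            (toComplex b₀, p) := ((contDiff_flow L a₀).continuous.comp hc2).continuousAt
        have hc5 : ContinuousAt (fun y : (Fin N' → ℂ) × (ℝ × (Fin N → ℝ)) => (y.2.1 : ℂ))
            (toComplex b₀, p) := by fun_prop
        exact (hc4.add (hc5.smul (hc3.sub continuousAt_const))).prodMk continuousAt_fst)
    (fun p hp => by
      simp only [hcrit.base, sub_self, smul_zero, add_zero]
      refine lt_of_lt_of_le ?_ (hlow p.2 hp.2.1)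
      have h1 : c * r ^ 2 ≤ c * dist p.2 a₀ ^ 2 := by gcongr; exact hp.2.2
      have h2 : 0 < c * r ^ 2 * δ := by positivity
      nlinarith)
  have hnear : ∀ᶠ b in 𝓝 (toComplex b₀), acrit b ∈ ball (toComplex a₀) (min (ρ₁ / 4) 1) :=
    hacritAt.continuousAt.eventually_mem (by rw [hcrit.base]; exact ball_mem_nhds _ (by positivity))
  obtain ⟨R₁, hR₁, hev⟩ := nhds_basis_closedBall.eventually_iff.1
    ((hE1.and hE2).and (hnear.and (hgauss.and (hBC.mem_nhds hbBC))))
  obtain ⟨R₂, hR₂, hB₂⟩ := nhds_basis_closedBall.mem_iff.1 (hB₀.mem_nhds hb₀)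
  set R := min R₁ (min R₂ ρ₁) with hRdef
  have hRR₁ : closedBall (toComplex b₀) R ⊆ closedBall (toComplex b₀) R₁ :=
    closedBall_subset_closedBall (min_le_left _ _)
  have hRρ : R ≤ ρ₁ := (min_le_right _ _).trans (min_le_right _ _)
  have hRU := closedBall_subset_closedBall (x := toComplex b₀) hRρ
  refine ⟨R, c * r ^ 2 / 2, by positivity, hRρ, by positivity, fun b hb => (hev (hRR₁ hb)).2.2.2,
    (closedBall_subset_closedBall ((min_le_right _ _).trans (min_le_left _ _))).trans hB₂, ?_,
    fun b hb => ?_⟩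
  · refine ⟨hρ, hκ, hΦU, fun b hb => hcrit.holomorphic b (hev (hRR₁ hb)).2.2.2,
      fun b hb h y hy => ⟨?_, hRU hb⟩,
      fun b hb h y hh hy => (hev (hRR₁ hb)).2.2.1 h y hh (hy.trans_le (hρle.trans (min_le_left _ _)))⟩
    have h1 := (mem_ball.1 (hev (hRR₁ hb)).2.1).trans_le (min_le_left _ _)
    rw [dist_eq_norm] at h1
    have h2 : ‖h • T (toComplex y)‖ ≤ ρ₁ / 2 := by
      rw [norm_smul]
      have h3 := T.le_opNorm (toComplex y)
      rw [norm_toComplex] at h3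
      calc ‖h‖ * ‖T (toComplex y)‖ ≤ ‖h‖ * ((‖T‖ + 1) * ‖y‖) := by
            gcongr
            exact h3.trans (by gcongr; linarith)
        _ = (‖h‖ * ‖y‖) * (‖T‖ + 1) := by ring
        _ ≤ (ρ₁ / (2 * (‖T‖ + 1))) * (‖T‖ + 1) := by
            gcongr
            exact hy.le.trans (hρle.trans (min_le_right _ _))
        _ = ρ₁ / 2 := by field_simp
    rw [mem_closedBall, dist_eq_norm]
    calc ‖acrit b + h • T (toComplex y) - toComplex a₀‖
        = ‖(acrit b - toComplex a₀) + h • T (toComplex y)‖ := by congr 1; abel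
      _ ≤ ‖acrit b - toComplex a₀‖ + ‖h • T (toComplex y)‖ := norm_add_le _ _
      _ ≤ ρ₁ := by linarith
  · have hbR : toComplex b ∈ closedBall (toComplex b₀) R := by
      rw [mem_closedBall, dist_toComplex]; exact hb
    have hbU := hRU hbR
    obtain ⟨⟨h1, h2⟩, h3, -⟩ := hev (hRR₁ hbR)
    rw [mem_ball, dist_eq_norm] at h3
    have hbB₀ : b ∈ B₀ := hB₂ (closedBall_subset_closedBall
      ((min_le_right _ _).trans (min_le_left _ _)) hb)
    refine ⟨(h3.trans_le (min_le_right _ _)).le, fun f Q hf hQ lam hlam => ?_⟩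
    have hshU : ∀ t : ℝ, |t| ≤ 2 → ∀ x, dist x a₀ ≤ ρ₂ →
        (flow L a₀ δ x + (t : ℂ) • (acrit (toComplex b) - toComplex a₀), toComplex b) ∈ U := by
      intro t ht x hx
      refine ⟨?_, hbU⟩
      have h4 := hball' δ (habs _ (right_mem_Icc.2 hδ.le)) x hx
      have h5 := h3.trans_le (min_le_left _ _)
      rw [dist_eq_norm] at h4
      rw [mem_closedBall, dist_eq_norm]
      calc _ = ‖(flow L a₀ δ x - toComplex a₀) + (t : ℂ) • (acrit (toComplex b) - toComplex a₀)‖ := by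
            rw [add_sub_right_comm]
        _ ≤ ‖flow L a₀ δ x - toComplex a₀‖ + ‖(t : ℂ) • (acrit (toComplex b) - toComplex a₀)‖ :=
            norm_add_le _ _
        _ ≤ ‖flow L a₀ δ x - toComplex a₀‖ + 2 * (ρ₁ / 4) := by
            rw [norm_smul, Complex.norm_real, Real.norm_eq_abs]
            gcongr
        _ ≤ ρ₁ := by linarith
    have han : ∀ z, (z, toComplex b) ∈ U → AnalyticAt ℂ (fun z =>
        Complex.exp (Complex.I * lam * Φ (z, toComplex b)) * f (z, toComplex b)) z := by
      intro z hz
      have e1 : AnalyticAt ℂ (fun z : Fin N → ℂ => (z, toComplex b)) z := analyticAt_id.prod analyticAt_const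
      have e2 : AnalyticAt ℂ (fun z => Φ (z, toComplex b)) z :=
        AnalyticAt.fun_comp (g := Φ) (f := fun z => (z, toComplex b)) (hΦU _ hz) e1
      have e3 : AnalyticAt ℂ (fun z => f (z, toComplex b)) z :=
        AnalyticAt.fun_comp (g := f) (f := fun z => (z, toComplex b)) (hf _ hz) e1
      exact (analyticAt_const.mul e2).cexp.mul e3
    have hnorm : ∀ z, (z, toComplex b) ∈ U → ∀ m : ℝ, m ≤ (Φ (z, toComplex b)).im →
        ‖Complex.exp (Complex.I * lam * Φ (z, toComplex b)) * f (z, toComplex b)‖ ≤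
          Q * Real.exp (-(lam * m)) := by
      intro z hz m hm
      rw [norm_mul, Complex.norm_exp, mul_comm]
      refine mul_le_mul (hQ _ hz) (Real.exp_le_exp.2 ?_) (Real.exp_pos _).le
        ((norm_nonneg _).trans (hQ _ hz))
      rw [mul_assoc, Complex.I_mul_re, Complex.im_ofReal_mul]
      nlinarith
    refine ⟨fun s hs x hx => han _ (hflU s hs.le x hx.le _ hbU),
      fun t ht x hx => han _ (hshU t ht.le x hx.le),
      (norm_nonneg _).trans (hQ (toComplex a₀, toComplex b₀) ⟨mem_closedBall_self hρ₁.le, hb₀U⟩),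
      fun s hs x hx hxr => ?_, fun t ht x hx hxr => ?_⟩
    · have h4 := im_add_mul_le_im_flow (Φ := Φ) (b := toComplex b) (k := c * r ^ 2 / 2)
        (fun s hs => (hΦU _ (hflU s (habs s hs) x hx.le _ hbU)).differentiableAt)
        (fun s hs => (h1 (s, x) ⟨hs, hx.le, hxr⟩).le) hs
      have h5 := him x (hA₂ hx.le) b hbB₀
      refine (hnorm _ (hflU s (habs s hs) x hx.le _ hbU) (c * r ^ 2 / 2 * s) (by linarith)).trans_eq ?_
      congr 2; ring
    · refine (hnorm _ (hshU t (by rw [abs_of_nonneg ht.1]; linarith [ht.2]) x hx.le) _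
        (h2 (t, x) ⟨ht, hx.le, hxr⟩).le).trans_eq ?_
      congr 2; ring

end Geometry

/-! ### Stationary phase where the base value of `Im Φ` is positive -/

section StationaryPhase

open Metric Set MeasureTheory

variable {N N' : ℕ}

/-- The oscillatory integrals with phase `Φ` and amplitude `q` are given by the values at the critical
point `acrit`, for all sufficiently small neighbourhoods of `a₀` and all admissible cut-offs. -/
def HasStationaryPhase (A₀ : Set (Fin N → ℝ)) (B₀ : Set (Fin N' → ℝ)) (a₀ : Fin N → ℝ)
    (b₀ : Fin N' → ℝ) (A₀C : Set (Fin N → ℂ)) (B₀C : Set (Fin N' → ℂ))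
    (q : ℕ → (Fin N → ℂ) × (Fin N' → ℂ) → ℂ) (Φ : (Fin N → ℂ) × (Fin N' → ℂ) → ℂ)
    (BC : Set (Fin N' → ℂ)) (acrit : (Fin N' → ℂ) → (Fin N → ℂ)) : Prop :=
    ∃ A₁ : Set (Fin N → ℝ), IsOpen A₁ ∧ a₀ ∈ A₁ ∧ IsCompact (closure A₁) ∧ closure A₁ ⊆ A₀ ∧
    ∀ A : Set (Fin N → ℝ), IsOpen A → a₀ ∈ A → A ⊆ A₁ →
    ∀ A' : Set (Fin N → ℝ), IsOpen A' → a₀ ∈ A' →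
      (∃ r : ℝ, 0 < r ∧ ∀ x ∈ A', ∀ y ∉ A, r ≤ dist x y) →
    ∃ (B : Set (Fin N' → ℝ)) (Ω : Set (Fin N' → ℂ)),
      IsOpen B ∧ b₀ ∈ B ∧ IsCompact (closure B) ∧ closure B ⊆ B₀ ∧
      IsOpen Ω ∧ toComplex '' closure B ⊆ Ω ∧ Ω ⊆ BC ∧
    ∀ C : ℝ, 0 < C → ∃ θ₀ : ℝ, 0 < θ₀ ∧ ∀ θ : ℝ, 0 < θ → θ < θ₀ →
    ∀ τ : ℝ → ℕ, (∀ᶠ lam : ℝ in atTop, θ * lam / 2 ≤ (τ lam : ℝ) ∧ (τ lam : ℝ) ≤ θ * lam) →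
    ∀ χ : ℕ → (Fin N → ℝ) → ℝ, IsEhrenpreisCutoff A A' C χ →
    ∃ qs : ℕ → (Fin N' → ℂ) → ℂ, IsFormalAnalyticAmplitude Ω qs ∧
      (∀ K : Set ((Fin N → ℂ) × (Fin N' → ℂ)), IsCompact K → K ⊆ A₀C ×ˢ B₀C →
        (toComplex '' A) ×ˢ (toComplex '' B) ⊆ K →
       ∀ R : ℝ, IsRealizationParameter q K R →
       ∀ Ks : Set (Fin N' → ℂ), IsCompact Ks → Ks ⊆ Ω → toComplex '' B ⊆ Ks →
       ∀ Rs : ℝ, IsRealizationParameter qs Ks Rs →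
       ∃ ε M lam₀ : ℝ, 0 < ε ∧ 1 ≤ lam₀ ∧ ∀ lam : ℝ, lam₀ ≤ lam → ∀ b ∈ B,
        ‖((lam ^ (-(N : ℝ) / 2) : ℝ) : ℂ) *
            Complex.exp (Complex.I * (lam : ℂ) * Φ (acrit (toComplex b), toComplex b)) *
            finiteRealization qs Rs lam (toComplex b)
          - oscIntegral Φ (χ (τ lam)) (finiteRealization q R lam) lam b‖
          ≤ M * Real.exp (-ε * lam)) ∧
      (q 0 (toComplex a₀, toComplex b₀) ≠ 0 → IsEllipticOn Ω qs)

theorem norm_rpow_neg_half_le_one (N : ℕ) {lam : ℝ} (hlam : 1 ≤ lam) :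
    ‖((lam ^ (-(N : ℝ) / 2) : ℝ) : ℂ)‖ ≤ 1 := by
  rw [Complex.norm_real, Real.norm_of_nonneg (by positivity)]
  refine Real.rpow_le_one_of_one_le_of_nonpos hlam ?_
  have : (0 : ℝ) ≤ N := Nat.cast_nonneg N
  linarith

theorem norm_exp_phase (lam : ℝ) (z : ℂ) :
    ‖Complex.exp (Complex.I * lam * z)‖ = Real.exp (-(lam * z.im)) := by
  rw [Complex.norm_exp, mul_assoc, Complex.I_mul_re, Complex.im_ofReal_mul]

theorem IsEhrenpreisCutoff.eq_zero_of_notMem {A A' : Set (Fin N → ℝ)} {C : ℝ}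
    {χ : ℕ → (Fin N → ℝ) → ℝ} (hχ : IsEhrenpreisCutoff A A' C χ) (j : ℕ) {x : Fin N → ℝ} (hx : x ∉ A) :
    χ j x = 0 :=
  image_eq_zero_of_notMem_tsupport fun h => hx (hχ.tsupport_subset j h)

theorem IsEhrenpreisCutoff.norm_le_one {A A' : Set (Fin N → ℝ)} {C : ℝ}
    {χ : ℕ → (Fin N → ℝ) → ℝ} (hχ : IsEhrenpreisCutoff A A' C χ) (j : ℕ) (x : Fin N → ℝ) :
    ‖(χ j x : ℂ)‖ ≤ 1 := by
  rw [Complex.norm_real, Real.norm_of_nonneg (hχ.nonneg j x)]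
  exact hχ.le_one j x

/-- The case where the integrand is exponentially small near the base point. -/
theorem hasStationaryPhase_of_im_pos {A₀ : Set (Fin N → ℝ)} {B₀ : Set (Fin N' → ℝ)}
    (hA₀ : IsOpen A₀) (hB₀ : IsOpen B₀) {a₀ : Fin N → ℝ} {b₀ : Fin N' → ℝ} (ha₀ : a₀ ∈ A₀)
    (hb₀ : b₀ ∈ B₀) {A₀C : Set (Fin N → ℂ)} {B₀C : Set (Fin N' → ℂ)}
    {q : ℕ → (Fin N → ℂ) × (Fin N' → ℂ) → ℂ} {Φ : (Fin N → ℂ) × (Fin N' → ℂ) → ℂ}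
    (hΦ : ContinuousAt Φ (toComplex a₀, toComplex b₀))
    (him : 0 < (Φ (toComplex a₀, toComplex b₀)).im) {BC : Set (Fin N' → ℂ)}
    {acrit : (Fin N' → ℂ) → (Fin N → ℂ)} (hBC : IsOpen BC) (hbBC : toComplex b₀ ∈ BC)
    (hacrit : ContinuousAt acrit (toComplex b₀)) (hbase : acrit (toComplex b₀) = toComplex a₀) :
    HasStationaryPhase A₀ B₀ a₀ b₀ A₀C B₀C q Φ BC acrit := by
  set η := (Φ (toComplex a₀, toComplex b₀)).im / 2 with hη
  have hη0 : 0 < η := half_pos him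
  have hlt : η < (Φ (toComplex a₀, toComplex b₀)).im := half_lt_self him
  have hev : ∀ᶠ p : (Fin N → ℂ) × (Fin N' → ℂ) in 𝓝 (toComplex a₀, toComplex b₀), η < (Φ p).im :=
    continuousAt_const.eventually_lt (Complex.continuous_im.continuousAt.comp' hΦ) hlt
  obtain ⟨ρ, hρ, hball⟩ := Metric.eventually_nhds_iff.1 hev
  obtain ⟨ρA, hρA, hρAA⟩ := nhds_basis_closedBall.mem_iff.1 (hA₀.mem_nhds ha₀)
  obtain ⟨ρB, hρB, hρBB⟩ := nhds_basis_closedBall.mem_iff.1 (hB₀.mem_nhds hb₀)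
  have hevc : ∀ᶠ b in 𝓝 (toComplex b₀), η < (Φ (acrit b, b)).im := by
    refine continuousAt_const.eventually_lt (Complex.continuous_im.continuousAt.comp' ?_)
      (by rw [hbase]; exact hlt)
    refine ContinuousAt.comp (g := Φ) (f := fun b => (acrit b, b)) ?_ (hacrit.prodMk continuousAt_id)
    rw [hbase]; exact hΦ
  obtain ⟨ρc, hρc, hballc⟩ := Metric.eventually_nhds_iff.1 (hevc.and (hBC.mem_nhds hbBC))
  set ρ₂ := min (ρ / 2) ρA with hρ₂
  have hρ₂0 : 0 < ρ₂ := by positivity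
  refine ⟨ball a₀ ρ₂, isOpen_ball, mem_ball_self hρ₂0,
    (isCompact_closedBall a₀ ρ₂).of_isClosed_subset isClosed_closure closure_ball_subset_closedBall,
    closure_ball_subset_closedBall.trans
      ((closedBall_subset_closedBall (min_le_right _ _)).trans hρAA),
    fun A hA haA hAA₁ A' hA' ha' hdist => ?_⟩
  set ρ₃ := min (min (ρ / 2) ρB) (ρc / 2) with hρ₃
  have hρ₃0 : 0 < ρ₃ := by positivity
  have hcl : closure (ball b₀ ρ₃) ⊆ closedBall b₀ ρ₃ := closure_ball_subset_closedBall
  refine ⟨ball b₀ ρ₃, ball (toComplex b₀) ρc, isOpen_ball, mem_ball_self hρ₃0,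
    (isCompact_closedBall b₀ ρ₃).of_isClosed_subset isClosed_closure hcl,
    hcl.trans ((closedBall_subset_closedBall ((min_le_left _ _).trans (min_le_right _ _))).trans hρBB),
    isOpen_ball, ?_, fun b hb => (hballc hb).2, fun C hC => ⟨1, one_pos, fun θ hθ hθ1 τ hτ χ hχ => ?_⟩⟩
  · rintro _ ⟨b, hb, rfl⟩
    have h1 := mem_closedBall.1 (hcl hb)
    rw [mem_ball, dist_toComplex]
    have h2 : ρ₃ ≤ ρc / 2 := min_le_right _ _
    linarith
  -- The constant amplitude `1` is elliptic, and both sides are exponentially small separately.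
  refine ⟨fun k _ => if k = 0 then 1 else 0, ⟨fun k => analyticOnNhd_const, fun K _ _ =>
    ⟨1, 1, one_pos, one_pos, fun k x _ => ?_⟩⟩, ?_, fun _ b _ => by simp⟩
  · split_ifs with h
    · simp [h]
    · simp
  intro K hK hKsub hABK R hR Ks hKs hKsΩ hBKs Rs hRs
  obtain ⟨Q, hQ, hQb⟩ := hR.exists_bound
  obtain ⟨Qs, hQs, hQsb⟩ := hRs.exists_bound
  have hvol : volume A < ⊤ := (measure_mono hAA₁).trans_lt measure_ball_lt_top
  refine ⟨η, Qs + Q * volume.real A, 1, hη0, le_rfl, fun lam hlam b hb => ?_⟩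
  have hlam0 : 0 ≤ lam := by linarith
  have hbb : dist (toComplex b) (toComplex b₀) < ρ₃ := by rw [dist_toComplex]; exact hb
  have hexp : ∀ z : ℂ, η < z.im → ‖Complex.exp (Complex.I * lam * z)‖ ≤ Real.exp (-η * lam) := by
    intro z hz
    rw [norm_exp_phase]
    refine Real.exp_le_exp.2 ?_
    nlinarith
  have h1 : ‖((lam ^ (-(N : ℝ) / 2) : ℝ) : ℂ) *
      Complex.exp (Complex.I * (lam : ℂ) * Φ (acrit (toComplex b), toComplex b)) *
      finiteRealization (fun k _ => if k = 0 then 1 else 0) Rs lam (toComplex b)‖ ≤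
      1 * Real.exp (-η * lam) * Qs := by
    rw [norm_mul, norm_mul]
    gcongr
    · exact norm_rpow_neg_half_le_one N hlam
    · refine hexp _ (hballc (y := toComplex b) ?_).1
      have h2 : ρ₃ ≤ ρc / 2 := min_le_right _ _
      linarith
    · exact hQsb lam hlam _ (hBKs ⟨b, hb, rfl⟩)
  have h2 : ‖oscIntegral Φ (χ (τ lam)) (finiteRealization q R lam) lam b‖ ≤
      Real.exp (-η * lam) * 1 * Q * volume.real A := by
    refine norm_integral_le_of_norm_le_const_of_eq_zero hvol (fun x hx => ?_) fun x hx => ?_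
    · rw [norm_mul, norm_mul]
      gcongr
      · refine hexp _ (hball ?_)
        have h3 : ρ₂ ≤ ρ / 2 := min_le_left _ _
        have h4 : ρ₃ ≤ ρ / 2 := (min_le_left _ _).trans (min_le_left _ _)
        have h5 := mem_ball.1 (hAA₁ hx)
        rw [Prod.dist_eq, max_lt_iff, dist_toComplex]
        exact ⟨by linarith, by linarith⟩
      · exact hχ.norm_le_one _ x
      · exact hQb lam hlam _ (hABK ⟨⟨x, hx, rfl⟩, ⟨b, hb, rfl⟩⟩)
    · rw [hχ.eq_zero_of_notMem _ hx]
      simp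
  refine (norm_sub_le _ _).trans ((add_le_add h1 h2).trans_eq ?_)
  ring

end StationaryPhase

/-! ### Sign of `Im Φ` at the critical points -/

section StationaryPhase

open Metric Set MeasureTheory

variable {N N' : ℕ}

theorem exists_centered_cutoff (a₀ : Fin N → ℝ) {ψ : (Fin N → ℝ) → ℂ} {ρ : ℝ} (hψ : ContDiff ℝ ∞ ψ)
    (hψ0 : tsupport ψ ⊆ ball 0 ρ) :
    ContDiff ℝ ∞ (fun x => ψ (x - a₀)) ∧ HasCompactSupport (fun x => ψ (x - a₀)) ∧
      tsupport (fun x => ψ (x - a₀)) ⊆ ball a₀ ρ := by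
  have h1 : tsupport (fun x => ψ (x - a₀)) ⊆ (fun x => x - a₀) ⁻¹' tsupport ψ :=
    closure_minimal (fun x hx => subset_tsupport ψ hx)
      ((isClosed_tsupport ψ).preimage (continuous_id.sub continuous_const))
  have h2 : tsupport (fun x => ψ (x - a₀)) ⊆ ball a₀ ρ := fun x hx => by
    have := hψ0 (h1 hx)
    rwa [mem_ball_zero_iff, ← dist_eq_norm] at this
  exact ⟨hψ.comp (contDiff_id.sub contDiff_const), (isCompact_closedBall a₀ ρ).of_isClosed_subset
    (isClosed_tsupport _) (h2.trans ball_subset_closedBall), h2⟩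

theorem flow_add_sub_eq (L : (Fin N → ℂ) →L[ℂ] (Fin N → ℂ)) (a₀ : Fin N → ℝ) (δ : ℝ) (a : Fin N → ℂ)
    (x : Fin N → ℝ) : flow L a₀ δ x + (a - toComplex a₀) =
      a + NormedSpace.exp (δ • L) (toComplex (x - a₀)) := by
  rw [flow]
  abel

/-- The imaginary part of the phase is nonnegative at the critical points for real parameters. -/
theorem im_critical_value_nonneg {Φ : (Fin N → ℂ) × (Fin N' → ℂ) → ℂ}
    {acrit : (Fin N' → ℂ) → (Fin N → ℂ)} {L : (Fin N → ℂ) →L[ℂ] (Fin N → ℂ)} {a₀ : Fin N → ℝ}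
    {U : Set ((Fin N → ℂ) × (Fin N' → ℂ))} {P : Set (Fin N' → ℂ)} {ρ ρ₂ δ κ c : ℝ}
    (H : IsGaussianPhase Φ acrit (NormedSpace.exp (δ • L)) U P ρ κ) (hδ : 0 < δ) (hρρ₂ : ρ ≤ ρ₂)
    (hc : 0 ≤ c) {b : Fin N' → ℂ} (hb : b ∈ P) (hcrit : phaseGrad Φ (acrit b) b = 0)
    (hw : ‖acrit b - toComplex a₀‖ ≤ 1)
    (hdef : ∀ lam : ℝ, 0 ≤ lam → IsDeformable L a₀ δ ρ₂ (ρ / 8) (acrit b - toComplex a₀)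
      (fun z => Complex.exp (Complex.I * lam * Φ (z, b)) * 1) 1 (c * lam))
    (him : ∀ x, dist x a₀ < ρ₂ → 0 ≤ (Φ (toComplex x, b)).im) : 0 ≤ (Φ (acrit b, b)).im := by
  obtain ⟨ψ, hψ, hψc, hψn, hψ1, hψ0⟩ := exists_cutoff N H.pos
  obtain ⟨hφ, hφc, hφ0⟩ := exists_centered_cutoff a₀ hψ hψ0
  have hφρ := hφ0.trans (ball_subset_ball hρρ₂)
  obtain ⟨K, hK, hKb⟩ := exists_norm_shifted_contour_sub_le L a₀ (ρ / 8) hδ (H.pos.trans_le hρρ₂) hφ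
    hφc hφρ fun x hx => hψ1 _ (by rw [← dist_eq_norm]; exact hx.le)
  obtain ⟨M, C, hM, hC, -, hrem⟩ := H.norm_stationaryCoeff_le
  set S := stationaryCoeff Φ acrit (NormedSpace.exp (δ • L)) ρ 0 (fun _ => 1) b with hS
  have hS0 : 0 < ‖S‖ := norm_pos_iff.2 (H.stationaryCoeff_zero_one_ne_zero hb hcrit)
  set J := flowJacobian L δ with hJ
  have hJ0 : 0 < ‖J‖ := norm_pos_iff.2 (Complex.exp_ne_zero _)
  set v := volume.real (ball a₀ ρ₂) with hv
  have hvol : volume (ball a₀ ρ₂) < ⊤ := measure_ball_lt_top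
  -- If the critical value had imaginary part `-m < 0`, the contour integral would grow like
  -- `lam^(-N/2) e^(m lam)`. It differs by a bounded amount from the integral over real points,
  -- itself bounded because `Im Φ ≥ 0` there.
  by_contra! hneg
  set m := -(Φ (acrit b, b)).im with hm
  have hm0 : 0 < m := by linarith
  have hbound : ∀ lam : ℝ, 1 ≤ lam → 2 * (M * C) / lam ≤ ‖S‖ / 2 →
      Real.exp (m * lam) / lam ^ ((N : ℝ) / 2) ≤ (K + v) / (‖J‖ * (‖S‖ / 2)) := by
    intro lam hlam hsmall
    have hlam0 : 0 < lam := by linarith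
    set h := lam ^ (-(1 : ℝ) / 2) with hh
    have hh0 : 0 < h := Real.rpow_pos_of_pos hlam0 _
    have hhl : h ^ 2 = lam⁻¹ := by
      rw [hh, ← Real.rpow_natCast, ← Real.rpow_mul hlam0.le]
      norm_num
      exact Real.rpow_neg_one lam
    have hhN : h ^ N = (lam ^ ((N : ℝ) / 2))⁻¹ := by
      rw [hh, ← Real.rpow_natCast, ← Real.rpow_mul hlam0.le, ← Real.rpow_neg hlam0.le]
      congr 1
      ring
    -- At time `0` the deformation error carries no decay, but boundedness uniformly in `lam` is
    -- enough here.
    have h1 := hKb _ hw _ _ _ (by positivity) (hdef lam hlam0.le) 0 (left_mem_Icc.2 hδ.le)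
    have h2 := integral_contour_eq Φ acrit (NormedSpace.exp (δ • L)) (fun _ => 1) b a₀ ψ hh0 hhl
    have h3 := hrem ψ hψ.continuous hψn hψ1 hψ0 (fun _ => 1) 1 analyticOnNhd_const (by simp) b hb h hh0 1
    simp only [flow_add_sub_eq, flow_zero] at h1
    rw [h2] at h1
    simp only [Finset.sum_range_one, mul_zero, pow_zero, one_mul, hhl, pow_one, Nat.factorial_one,
      Nat.cast_one, mul_one, ← hS] at h3
    set I := ∫ y, ψ (h • y) * scaledIntegrand Φ acrit (NormedSpace.exp (δ • L)) (fun _ => 1) b h y with hI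
    have hI0 : ‖S‖ / 2 ≤ ‖I‖ := by
      have h4 := norm_sub_norm_le S I
      rw [norm_sub_rev] at h4
      have h5 : (1 + 1) * (M * (C * lam⁻¹)) = 2 * (M * C) / lam := by field_simp; ring
      rw [h5] at h3
      linarith
    have hreal : ‖∫ x, Complex.exp (Complex.I * lam * Φ (toComplex x, b)) * 1 * ψ (x - a₀)‖ ≤ 1 * v := by
      refine norm_integral_le_of_norm_le_const_of_eq_zero hvol (fun x hx => ?_) fun x hx => ?_
      · rw [mul_one, norm_mul, norm_exp_phase]
        refine mul_le_one₀ (Real.exp_le_one_iff.2 ?_) (norm_nonneg _) (hψn _)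
        nlinarith [him x hx]
      · rw [image_eq_zero_of_notMem_tsupport (f := fun x => ψ (x - a₀)) fun h' => hx (hφρ h'), mul_zero]
    have hJ1 : flowJacobian L 0 = 1 := by simp [flowJacobian]
    rw [hJ1, one_mul, mul_zero, Real.exp_zero, mul_one, mul_one] at h1
    have h6 := norm_le_norm_add_norm_sub' (J * (((h ^ N : ℝ) : ℂ) *
      Complex.exp (Complex.I * lam * Φ (acrit b, b)) * I))
      (∫ x, Complex.exp (Complex.I * lam * Φ (toComplex x, b)) * 1 * ψ (x - a₀))
    rw [norm_mul, norm_mul, norm_mul, norm_exp_phase, Complex.norm_real,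
      Real.norm_of_nonneg (by positivity), hhN] at h6
    have h7 : -(lam * (Φ (acrit b, b)).im) = m * lam := by rw [hm]; ring
    rw [h7] at h6
    rw [hhN] at h1
    rw [le_div_iff₀ (by positivity)]
    calc Real.exp (m * lam) / lam ^ ((N : ℝ) / 2) * (‖J‖ * (‖S‖ / 2))
        = ‖J‖ * ((lam ^ ((N : ℝ) / 2))⁻¹ * Real.exp (m * lam) * (‖S‖ / 2)) := by ring
      _ ≤ ‖J‖ * ((lam ^ ((N : ℝ) / 2))⁻¹ * Real.exp (m * lam) * ‖I‖) := by gcongr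
      _ ≤ K + v := by linarith
  have hlim := tendsto_exp_mul_div_rpow_atTop ((N : ℝ) / 2) m hm0
  have hsm : Tendsto (fun lam : ℝ => 2 * (M * C) / lam) atTop (𝓝 0) :=
    tendsto_const_nhds.div_atTop tendsto_id
  obtain ⟨lam, ⟨h1, h2⟩, h3⟩ := (((eventually_ge_atTop (1 : ℝ)).and
    (hsm.eventually_le_const (half_pos hS0))).and
    (hlim.eventually_gt_atTop ((K + v) / (‖J‖ * (‖S‖ / 2))))).exists
  exact (hbound lam h1 h2).not_gt h3

theorem integrable_oscillatory {Φ : (Fin N → ℂ) × (Fin N' → ℂ) → ℂ} {A : Set (Fin N → ℝ)}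
    (hA : IsOpen A) {b : Fin N' → ℝ} {χ : (Fin N → ℝ) → ℝ} (hχ : Continuous χ)
    (hχc : HasCompactSupport χ) (hχA : tsupport χ ⊆ A) (lam : ℝ)
    (hΦ : ∀ x ∈ A, ContinuousAt Φ (toComplex x, toComplex b))
    {u : (Fin N → ℂ) × (Fin N' → ℂ) → ℂ} (hu : ∀ x ∈ A, ContinuousAt u (toComplex x, toComplex b)) :
    Integrable fun x : Fin N → ℝ => Complex.exp (Complex.I * (lam : ℂ) * Φ (toComplex x, toComplex b)) *
      (χ x : ℂ) * u (toComplex x, toComplex b) := by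
  have hsub : tsupport (fun x : Fin N → ℝ =>
      Complex.exp (Complex.I * (lam : ℂ) * Φ (toComplex x, toComplex b)) *
      (χ x : ℂ) * u (toComplex x, toComplex b)) ⊆ tsupport χ := by
    refine closure_mono fun x hx h => hx ?_
    simp [h]
  refine Continuous.integrable_of_hasCompactSupport (ContinuousOn.continuous_of_tsupport_subset
    (s := A) (fun x hx => ContinuousAt.continuousWithinAt ?_) hA (hsub.trans hχA))
    (hχc.of_isClosed_subset (isClosed_tsupport _) hsub)
  have hc : ContinuousAt (fun x : Fin N → ℝ => (toComplex x, toComplex b)) x :=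
    (continuous_toComplex.prodMk continuous_const).continuousAt
  have h1 := ContinuousAt.comp (g := Φ) (f := fun x : Fin N → ℝ => (toComplex x, toComplex b)) (hΦ x hx) hc
  have h2 := ContinuousAt.comp (g := u) (f := fun x : Fin N → ℝ => (toComplex x, toComplex b)) (hu x hx) hc
  exact (((continuousAt_const.mul h1).cexp).mul
    (Complex.continuous_ofReal.comp hχ).continuousAt).mul h2

theorem analyticAt_finiteRealization {q : ℕ → (Fin N → ℂ) × (Fin N' → ℂ) → ℂ}
    {p : (Fin N → ℂ) × (Fin N' → ℂ)} (hq : ∀ k, AnalyticAt ℂ (q k) p) (R lam : ℝ) :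
    AnalyticAt ℂ (finiteRealization q R lam) p := by
  have : finiteRealization q R lam = fun x => ∑ k ∈ Finset.range (⌊lam / R⌋₊ + 1),
      ((lam : ℂ) ^ k)⁻¹ * q k x := rfl
  rw [this]
  exact Finset.analyticAt_fun_sum _ fun k _ => analyticAt_const.mul (hq k)

end StationaryPhase

/-! ### Stationary phase with real critical value, and conclusion -/

section StationaryPhase

open Metric Set MeasureTheory

variable {N N' : ℕ}

/-- The case where the critical value at the base point is real. -/
theorem hasStationaryPhase_of_im_eq_zero {A₀ : Set (Fin N → ℝ)} {B₀ : Set (Fin N' → ℝ)}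
    (hA₀ : IsOpen A₀) (hB₀ : IsOpen B₀) {a₀ : Fin N → ℝ} {b₀ : Fin N' → ℝ} (ha₀ : a₀ ∈ A₀)
    (hb₀ : b₀ ∈ B₀) {A₀C : Set (Fin N → ℂ)} {B₀C : Set (Fin N' → ℂ)} (hA₀C : IsOpen A₀C)
    (hB₀C : IsOpen B₀C) (haC : toComplex a₀ ∈ A₀C) (hbC : toComplex b₀ ∈ B₀C)
    {q : ℕ → (Fin N → ℂ) × (Fin N' → ℂ) → ℂ} (hq : IsFormalAnalyticAmplitude (A₀C ×ˢ B₀C) q)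
    {Φ : (Fin N → ℂ) × (Fin N' → ℂ) → ℂ} (hΦ : AnalyticOnNhd ℂ Φ (A₀C ×ˢ B₀C))
    (hgrad : phaseGrad Φ (toComplex a₀) (toComplex b₀) = 0)
    (hhess : (phaseHessian Φ (toComplex a₀) (toComplex b₀)).det ≠ 0)
    (him : ∀ a ∈ A₀, ∀ b ∈ B₀, 0 ≤ (Φ (toComplex a, toComplex b)).im)
    (him0 : (Φ (toComplex a₀, toComplex b₀)).im = 0) {AC : Set (Fin N → ℂ)} {BC : Set (Fin N' → ℂ)}
    {acrit : (Fin N' → ℂ) → (Fin N → ℂ)} (hBC : IsOpen BC) (hbBC : toComplex b₀ ∈ BC)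
    (hcrit : IsCriticalPointMap Φ (toComplex a₀) (toComplex b₀) AC BC acrit) :
    HasStationaryPhase A₀ B₀ a₀ b₀ A₀C B₀C q Φ BC acrit := by
  obtain ⟨L, δ, ρ₁, ρ₂, ρ₃, κ, hδ, hρ₁, hρ₂, hρ₃, hA₁, hB₁, hA₂, hA₂U, hgeo⟩ :=
    exists_steepest_descent hA₀ hB₀ ha₀ hb₀ hA₀C hB₀C haC hbC hΦ hgrad hhess him him0 hBC hbBC hcrit
  set U := closedBall (toComplex a₀) ρ₁ ×ˢ closedBall (toComplex b₀) ρ₁ with hU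
  have hUsub : U ⊆ A₀C ×ˢ B₀C := prod_mono hA₁ hB₁
  have hUc : IsCompact U := (isCompact_closedBall _ _).prod (isCompact_closedBall _ _)
  obtain ⟨M₀, C₀, hM₀, hC₀, hqb⟩ := hq.bound U hUc hUsub
  have hqU : ∀ k, AnalyticOnNhd ℂ (q k) U := fun k => (hq.holomorphic k).mono hUsub
  have hcl : closure (ball a₀ ρ₂) ⊆ closedBall a₀ ρ₂ := closure_ball_subset_closedBall
  refine ⟨ball a₀ ρ₂, isOpen_ball, mem_ball_self hρ₂,
    (isCompact_closedBall a₀ ρ₂).of_isClosed_subset isClosed_closure hcl, hcl.trans hA₂,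
    fun A hA haA hAA₁ A' hA' ha' hdist => ?_⟩
  have hA'A : A' ⊆ A := by
    obtain ⟨r, hr, hdist⟩ := hdist
    intro x hx
    by_contra hxA
    have := hdist x hx x hxA
    rw [dist_self] at this
    linarith
  have hvol : volume A < ⊤ := (measure_mono hAA₁).trans_lt measure_ball_lt_top
  obtain ⟨r₀, hr₀, hr₀A⟩ := Metric.isOpen_iff.1 hA' a₀ ha'
  -- The fixed cut-off must be supported inside `A'`, where all the Ehrenpreis cut-offs equal `1`.
  set ρ := min r₀ (min ρ₃ ρ₂) with hρdef
  have hρ : 0 < ρ := by positivity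
  have hρr₀ : ρ ≤ r₀ := min_le_left _ _
  have hρρ₃ : ρ ≤ ρ₃ := (min_le_right _ _).trans (min_le_left _ _)
  have hρρ₂ : ρ ≤ ρ₂ := (min_le_right _ _).trans (min_le_right _ _)
  obtain ⟨R₁, c, hR₁, hR₁ρ, hc, hR₁BC, hR₁B₀, H, hdef⟩ := hgeo ρ hρ hρρ₃
  set T := NormedSpace.exp (δ • L) with hT
  set J := flowJacobian L δ with hJ
  have hJ0 : J ≠ 0 := Complex.exp_ne_zero _
  set qs := stationaryAmplitude Φ acrit T ρ J q with hqs
  obtain ⟨M₁, C₁, hM₁, hC₁, hqsb, hexp⟩ := H.exists_expansion hM₀ hC₀ hqU hqb J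
  obtain ⟨ψ, hψ, hψc, hψn, hψ1, hψ0⟩ := exists_cutoff N hρ
  obtain ⟨hφ, hφc, hφ0⟩ := exists_centered_cutoff a₀ hψ hψ0
  have hφ1 : ∀ x, dist x a₀ < ρ / 8 → ψ (x - a₀) = 1 := fun x hx =>
    hψ1 _ (by rw [← dist_eq_norm]; exact hx.le)
  -- Needed so that multiplying by the exponential at the critical value does not amplify errors in
  -- the amplitude.
  have hphase : ∀ b ∈ closedBall b₀ R₁, 0 ≤ (Φ (acrit (toComplex b), toComplex b)).im := by
    intro b hb
    have hbC : toComplex b ∈ closedBall (toComplex b₀) R₁ := by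
      rwa [mem_closedBall, dist_toComplex]
    refine im_critical_value_nonneg H hδ hρρ₂ hc.le hbC
      ((hcrit.critical_iff _ (hcrit.mapsTo _ (hR₁BC hbC)) _ (hR₁BC hbC)).2 rfl) (hdef b hb).1
      (fun lam hlam => (hdef b hb).2 (fun _ => 1) 1 analyticOnNhd_const (by simp) lam hlam)
      fun x hx => him x (hA₂ hx.le) b (hR₁B₀ hb)
  have hell : ∀ᶠ b in 𝓝 (toComplex b₀), q 0 (toComplex a₀, toComplex b₀) ≠ 0 → q 0 (acrit b, b) ≠ 0 := by
    by_cases h0 : q 0 (toComplex a₀, toComplex b₀) = 0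
    · exact Eventually.of_forall fun _ h => (h h0).elim
    · have hc1 : ContinuousAt (fun b => q 0 (acrit b, b)) (toComplex b₀) := by
        refine ContinuousAt.comp (g := q 0) (f := fun b => (acrit b, b)) ?_
          ((hcrit.holomorphic _ hbBC).continuousAt.prodMk continuousAt_id)
        rw [hcrit.base]
        exact (hq.holomorphic 0 _ ⟨haC, hbC⟩).continuousAt
      filter_upwards [hc1.eventually_ne (by rw [hcrit.base]; exact h0)] with b hb _
      exact hb
  obtain ⟨R₂, hR₂, hell⟩ := Metric.eventually_nhds_iff.1 hell
  set R' := min R₁ R₂ with hR'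
  have hR'0 : 0 < R' := lt_min hR₁ hR₂
  have hΩ₁ : ball (toComplex b₀) R' ⊆ ball (toComplex b₀) R₁ := ball_subset_ball (min_le_left _ _)
  have hclB : closure (ball b₀ (R' / 2)) ⊆ closedBall b₀ (R' / 2) := closure_ball_subset_closedBall
  have hBR₁ : closedBall b₀ (R' / 2) ⊆ closedBall b₀ R₁ := closedBall_subset_closedBall (by
    have : R' ≤ R₁ := min_le_left _ _
    linarith)
  refine ⟨ball b₀ (R' / 2), ball (toComplex b₀) R', isOpen_ball, mem_ball_self (half_pos hR'0),
    (isCompact_closedBall b₀ _).of_isClosed_subset isClosed_closure hclB,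
    hclB.trans (hBR₁.trans hR₁B₀), isOpen_ball, ?_, hΩ₁.trans (ball_subset_closedBall.trans hR₁BC),
    fun C hC => ?_⟩
  · rintro _ ⟨b, hb, rfl⟩
    have h1 := mem_closedBall.1 (hclB hb)
    rw [mem_ball, dist_toComplex]
    linarith
  obtain ⟨s, k, K₁, hs, hk, hK₁, hcontour⟩ := exists_norm_contour_sub_cutoff_le L a₀ (ρ / 8) hδ hρ₂ hφ
    hφc (fun x => hψn _) hφ1 hAA₁ hA' hA'A (hφ0.trans ((ball_subset_ball hρr₀).trans hr₀A))
    ((ball_subset_ball (by linarith)).trans hr₀A) hC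
  -- This threshold gives `k τ(lam) ≤ c lam / 2`, so the transported cut-off grows at most half as
  -- fast as the integrand decays.
  refine ⟨c / (2 * k), by positivity, fun θ hθ hθ₀ τ hτ χ hχ => ⟨qs, ⟨fun m => ?_, fun K _ hKΩ =>
    ⟨M₁, C₁, hM₁, hC₁, fun m b hb => hqsb m b (ball_subset_closedBall (hΩ₁ (hKΩ hb)))⟩⟩, ?_, ?_⟩⟩
  · have hsum : AnalyticOnNhd ℂ (fun b => ∑ i ∈ Finset.range (m + 1),
        stationaryCoeff Φ acrit T ρ (m - i) (q i) b) (ball (toComplex b₀) R₁) :=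
      Finset.analyticOnNhd_fun_sum _ fun i _ => H.analyticOnNhd_stationaryCoeff (hqU i) (hqb i) (m - i)
    exact (analyticOnNhd_const.mul hsum).mono hΩ₁
  · intro K hK hKsub hABK R hR Ks hKs hKsΩ hBKs Rs hRs
    -- A common truncation parameter, valid for both amplitudes and large enough for the expansion;
    -- the given realizations are compared with it at exponentially small cost.
    set R₀ := max C₁ (max (Real.exp 1 * C₀ + 1) (Real.exp 1 * C₁ + 1)) with hR₀
    have hRU : IsRealizationParameter q U R₀ := ⟨M₀, C₀, hM₀, hC₀, hqb,
      lt_of_lt_of_le (lt_add_one _) ((le_max_left _ _).trans (le_max_right _ _))⟩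
    have hRP : IsRealizationParameter qs (closedBall (toComplex b₀) R₁) R₀ := ⟨M₁, C₁, hM₁, hC₁, hqsb,
      lt_of_lt_of_le (lt_add_one _) ((le_max_right _ _).trans (le_max_right _ _))⟩
    have hR₀0 : 0 < R₀ := hC₁.trans_le (le_max_left _ _)
    obtain ⟨Q, hQ, hQb⟩ := hRU.exists_bound
    obtain ⟨M₂, ε₂, hM₂, hε₂, hdiff⟩ := hR.exists_sub_le hRU
    obtain ⟨M₃, ε₃, hM₃, hε₃, hdiffs⟩ := hRs.exists_sub_le hRP
    obtain ⟨lam₁, hτ⟩ := eventually_atTop.1 hτ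
    -- The entries are the rates of the changes of realization, of the truncated expansion, of the
    -- Taylor remainder (from `τ ≥ θ lam / 2`) and of the decay outside the fixed cut-off.
    set ε := min (min ε₂ ε₃) (min (1 / R₀) (min (θ / 2) (s * c / 2))) with hε
    have hε0 : 0 < ε := by positivity
    refine ⟨ε, M₃ + M₁ + 2 * K₁ * Q + M₂ * volume.real A, max 1 lam₁, hε0,
      le_max_left _ _, fun lam hlam b hb => ?_⟩
    have hlam1 : 1 ≤ lam := (le_max_left _ _).trans hlam
    have hlam0 : 0 < lam := by linarith
    obtain ⟨hτ1, hτ2⟩ := hτ lam ((le_max_right _ _).trans hlam)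
    have hexpε : ∀ x, ε ≤ x → Real.exp (-x * lam) ≤ Real.exp (-ε * lam) := fun x hx =>
      Real.exp_le_exp.2 (by nlinarith)
    have hbR₁ : b ∈ closedBall b₀ R₁ := hBR₁ (ball_subset_closedBall hb)
    have hbC₁ : toComplex b ∈ closedBall (toComplex b₀) R₁ := by
      rwa [mem_closedBall, dist_toComplex]
    have hbU : toComplex b ∈ closedBall (toComplex b₀) ρ₁ := closedBall_subset_closedBall hR₁ρ hbC₁
    have hAU : ∀ x ∈ A, (toComplex x, toComplex b) ∈ U := fun x hx => ⟨hA₂U x (hAA₁ hx), hbU⟩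
    set u := finiteRealization q R₀ lam with hu
    set E := ((lam ^ (-(N : ℝ) / 2) : ℝ) : ℂ) *
      Complex.exp (Complex.I * (lam : ℂ) * Φ (acrit (toComplex b), toComplex b)) with hE
    have hE1 : ‖E‖ ≤ 1 := by
      rw [hE, norm_mul, norm_exp_phase]
      refine mul_le_one₀ (norm_rpow_neg_half_le_one N hlam1) (Real.exp_pos _).le
        (Real.exp_le_one_iff.2 ?_)
      have := mul_nonneg hlam0.le (hphase b hbR₁)
      linarith
    set h := lam ^ (-(1 : ℝ) / 2) with hh
    have hh0 : 0 < h := Real.rpow_pos_of_pos hlam0 _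
    have hhl : h ^ 2 = lam⁻¹ := by
      rw [hh, ← Real.rpow_natCast, ← Real.rpow_mul hlam0.le]
      norm_num
      exact Real.rpow_neg_one lam
    have hhN : h ^ N = lam ^ (-(N : ℝ) / 2) := by
      rw [hh, ← Real.rpow_natCast, ← Real.rpow_mul hlam0.le]
      congr 1
      ring
    set I := ∫ y, ψ (h • y) * scaledIntegrand Φ acrit T u (toComplex b) h y with hI
    have huan : AnalyticOnNhd ℂ u U := fun p hp =>
      analyticAt_finiteRealization (fun k => hqU k p hp) R₀ lam
    have e1 : ‖E * finiteRealization qs Rs lam (toComplex b) - E * finiteRealization qs R₀ lam (toComplex b)‖ ≤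
        M₃ * Real.exp (-ε * lam) := by
      rw [← mul_sub, norm_mul]
      refine (mul_le_of_le_one_left (norm_nonneg _) hE1).trans
        ((hdiffs lam hlam1 _ ⟨hBKs ⟨b, hb, rfl⟩, hbC₁⟩).trans ?_)
      exact mul_le_mul_of_nonneg_left (hexpε _ ((min_le_left _ _).trans (min_le_right _ _))) hM₃.le
    have e2 : ‖E * finiteRealization qs R₀ lam (toComplex b) - E * (J * I)‖ ≤
        M₁ * Real.exp (-ε * lam) := by
      rw [← mul_sub, norm_mul, norm_sub_rev]
      refine (mul_le_of_le_one_left (norm_nonneg _) hE1).trans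
        ((hexp R₀ (le_max_left _ _) ψ hψ.continuous hψn hψ1 hψ0 _ hbC₁ h hh0 lam hlam1 hhl).trans ?_)
      exact mul_le_mul_of_nonneg_left (hexpε _ ((min_le_right _ _).trans (min_le_left _ _))) hM₁.le
    have e3 : ‖E * (J * I) - oscIntegral Φ (χ (τ lam)) u lam b‖ ≤
        2 * K₁ * Q * Real.exp (-ε * lam) := by
      obtain ⟨m, hm⟩ : ∃ m, τ lam = m + 1 := by
        refine Nat.exists_eq_succ_of_ne_zero fun h0 => ?_
        rw [h0, Nat.cast_zero] at hτ1
        have : 0 < θ * lam / 2 := by positivity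
        linarith
      have hm' : ((τ lam : ℕ) : ℝ) = (m : ℝ) + 1 := by rw [hm]; push_cast; ring
      rw [hm'] at hτ1 hτ2
      have h1 := hcontour _ (hdef b hbR₁).1 _ _ _ (by positivity)
        ((hdef b hbR₁).2 u Q huan (hQb lam hlam1) lam hlam0.le) χ hχ m
      simp only [flow_add_sub_eq] at h1
      rw [integral_contour_eq Φ acrit T u (toComplex b) a₀ ψ hh0 hhl, hhN, ← hE, ← hI] at h1
      have h2 : oscIntegral Φ (χ (τ lam)) u lam b = ∫ x, Complex.exp (Complex.I * lam *
          Φ (toComplex x, toComplex b)) * u (toComplex x, toComplex b) * (χ (m + 1) x : ℂ) := by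
        rw [hm]
        refine integral_congr_ae (Eventually.of_forall fun x => ?_)
        simp only
        ring
      rw [h2, mul_left_comm]
      refine h1.trans ?_
      have h3 : Real.exp (-((m : ℝ) + 1)) ≤ Real.exp (-ε * lam) := by
        refine (Real.exp_le_exp.2 ?_).trans (hexpε (θ / 2)
          ((min_le_right _ _).trans ((min_le_right _ _).trans (min_le_left _ _))))
        linarith
      have h4 : Real.exp (s * (k * ((m : ℝ) + 1) - c * lam)) ≤ Real.exp (-ε * lam) := by
        refine (Real.exp_le_exp.2 ?_).trans (hexpε (s * c / 2)
          ((min_le_right _ _).trans ((min_le_right _ _).trans (min_le_right _ _))))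
        have h5 : k * ((m : ℝ) + 1) ≤ c * lam / 2 := by
          calc k * ((m : ℝ) + 1) ≤ k * (c / (2 * k) * lam) := by
                gcongr
                exact hτ2.trans (by gcongr)
            _ = c * lam / 2 := by field_simp
        calc s * (k * ((m : ℝ) + 1) - c * lam) ≤ s * (c * lam / 2 - c * lam) := by gcongr
          _ = -(s * c / 2) * lam := by ring
      calc K₁ * Q * (Real.exp (-((m : ℝ) + 1)) + Real.exp (s * (k * ((m : ℝ) + 1) - c * lam)))
          ≤ K₁ * Q * (Real.exp (-ε * lam) + Real.exp (-ε * lam)) := by gcongr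
        _ = _ := by ring
    have e4 : ‖oscIntegral Φ (χ (τ lam)) u lam b -
        oscIntegral Φ (χ (τ lam)) (finiteRealization q R lam) lam b‖ ≤
        M₂ * volume.real A * Real.exp (-ε * lam) := by
      have hint : ∀ R, Integrable fun x : Fin N → ℝ =>
          Complex.exp (Complex.I * (lam : ℂ) * Φ (toComplex x, toComplex b)) *
            (χ (τ lam) x : ℂ) * finiteRealization q R lam (toComplex x, toComplex b) := fun R =>
        integrable_oscillatory hA (hχ.smooth _).continuous (hχ.hasCompactSupport _)
          (hχ.tsupport_subset _) lam (fun x hx => (hΦ _ (hUsub (hAU x hx))).continuousAt)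
          fun x hx => (analyticAt_finiteRealization (fun k => hqU k _ (hAU x hx)) R lam).continuousAt
      rw [oscIntegral, oscIntegral, ← integral_sub (hint R₀) (hint R)]
      refine (norm_integral_le_of_norm_le_const_of_eq_zero (c := M₂ * Real.exp (-ε * lam)) hvol
        (fun x hx => ?_) fun x hx => ?_).trans_eq (by ring)
      · rw [← mul_sub, norm_mul, norm_mul, norm_exp_phase, norm_sub_rev]
        have h1 : Real.exp (-(lam * (Φ (toComplex x, toComplex b)).im)) ≤ 1 := by
          refine Real.exp_le_one_iff.2 ?_
          have := mul_nonneg hlam0.le (him x (hA₂ (ball_subset_closedBall (hAA₁ hx))) b (hR₁B₀ hbR₁))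
          linarith
        refine (mul_le_of_le_one_left (norm_nonneg _)
          (mul_le_one₀ h1 (norm_nonneg _) (hχ.norm_le_one _ x))).trans
          ((hdiff lam hlam1 _ ⟨hABK ⟨⟨x, hx, rfl⟩, ⟨b, hb, rfl⟩⟩, hAU x hx⟩).trans ?_)
        exact mul_le_mul_of_nonneg_left (hexpε _ ((min_le_left _ _).trans (min_le_left _ _))) hM₂.le
      · rw [hχ.eq_zero_of_notMem _ hx]
        simp
    calc _ ≤ ‖E * finiteRealization qs Rs lam (toComplex b) -
          E * finiteRealization qs R₀ lam (toComplex b)‖ +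
          (‖E * finiteRealization qs R₀ lam (toComplex b) - E * (J * I)‖ +
          (‖E * (J * I) - oscIntegral Φ (χ (τ lam)) u lam b‖ +
          ‖oscIntegral Φ (χ (τ lam)) u lam b -
            oscIntegral Φ (χ (τ lam)) (finiteRealization q R lam) lam b‖)) :=
          (norm_sub_le_norm_sub_add_norm_sub _ _ _).trans (add_le_add le_rfl
            ((norm_sub_le_norm_sub_add_norm_sub _ _ _).trans (add_le_add le_rfl
              (norm_sub_le_norm_sub_add_norm_sub _ _ _))))
      _ ≤ M₃ * Real.exp (-ε * lam) + (M₁ * Real.exp (-ε * lam) + (2 * K₁ * Q * Real.exp (-ε * lam) +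
          M₂ * volume.real A * Real.exp (-ε * lam))) :=
          add_le_add e1 (add_le_add e2 (add_le_add e3 e4))
      _ = _ := by ring
  · intro h0 b hb
    have hb₁ := ball_subset_closedBall (hΩ₁ hb)
    have h1 : qs 0 b = J * stationaryCoeff Φ acrit T ρ 0 (q 0) b := by
      simp [hqs, stationaryAmplitude]
    rw [h1, H.stationaryCoeff_zero (hqU 0) (hqb 0) hb₁]
    refine mul_ne_zero hJ0 (mul_ne_zero (hell ?_ h0) (H.stationaryCoeff_zero_one_ne_zero hb₁
      ((hcrit.critical_iff _ (hcrit.mapsTo _ (hR₁BC hb₁)) _ (hR₁BC hb₁)).2 rfl)))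
    exact (mem_ball.1 hb).trans_le (min_le_right _ _)

end StationaryPhase

theorem mainTheorem8 {N N' : ℕ}
    (A₀ : Set (Fin N → ℝ)) (B₀ : Set (Fin N' → ℝ)) (hA₀ : IsOpen A₀) (hB₀ : IsOpen B₀)
    (a₀ : Fin N → ℝ) (b₀ : Fin N' → ℝ) (ha₀ : a₀ ∈ A₀) (hb₀ : b₀ ∈ B₀)
    (A₀C : Set (Fin N → ℂ)) (B₀C : Set (Fin N' → ℂ)) (hA₀C : IsOpen A₀C) (hB₀C : IsOpen B₀C)
    (hAA : toComplex '' A₀ ⊆ A₀C) (hBB : toComplex '' B₀ ⊆ B₀C)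
    (q : ℕ → (Fin N → ℂ) × (Fin N' → ℂ) → ℂ)
    (hq : IsFormalAnalyticAmplitude (A₀C ×ˢ B₀C) q)
    (Φ : (Fin N → ℂ) × (Fin N' → ℂ) → ℂ)
    (hΦ : AnalyticOnNhd ℂ Φ (A₀C ×ˢ B₀C))
    (hgrad : phaseGrad Φ (toComplex a₀) (toComplex b₀) = 0)
    (hhess : (phaseHessian Φ (toComplex a₀) (toComplex b₀)).det ≠ 0)
    (him : ∀ a ∈ A₀, ∀ b ∈ B₀, 0 ≤ (Φ (toComplex a, toComplex b)).im) :
    -- the holomorphic critical point `acrit b` of `Φ(·, b)`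
    ∃ (AC : Set (Fin N → ℂ)) (BC : Set (Fin N' → ℂ)) (acrit : (Fin N' → ℂ) → (Fin N → ℂ)),
      IsOpen AC ∧ toComplex a₀ ∈ AC ∧ AC ⊆ A₀C ∧
      IsOpen BC ∧ toComplex b₀ ∈ BC ∧ BC ⊆ B₀C ∧
      IsCriticalPointMap Φ (toComplex a₀) (toComplex b₀) AC BC acrit ∧
    -- every sufficiently small open neighbourhood `A` of `a₀`, and every admissible `A'`
    ∃ A₁ : Set (Fin N → ℝ), IsOpen A₁ ∧ a₀ ∈ A₁ ∧ IsCompact (closure A₁) ∧ closure A₁ ⊆ A₀ ∧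
    ∀ A : Set (Fin N → ℝ), IsOpen A → a₀ ∈ A → A ⊆ A₁ →
    ∀ A' : Set (Fin N → ℝ), IsOpen A' → a₀ ∈ A' →
      (∃ r : ℝ, 0 < r ∧ ∀ x ∈ A', ∀ y ∉ A, r ≤ dist x y) →
    -- a real neighbourhood `B` of `b₀` and a complex neighbourhood `Ω` of its closure
    ∃ (B : Set (Fin N' → ℝ)) (Ω : Set (Fin N' → ℂ)),
      IsOpen B ∧ b₀ ∈ B ∧ IsCompact (closure B) ∧ closure B ⊆ B₀ ∧
      IsOpen Ω ∧ toComplex '' closure B ⊆ Ω ∧ Ω ⊆ BC ∧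
    ∀ C : ℝ, 0 < C → ∃ θ₀ : ℝ, 0 < θ₀ ∧ ∀ θ : ℝ, 0 < θ → θ < θ₀ →
    ∀ τ : ℝ → ℕ, (∀ᶠ lam : ℝ in atTop, θ * lam / 2 ≤ (τ lam : ℝ) ∧ (τ lam : ℝ) ≤ θ * lam) →
    ∀ χ : ℕ → (Fin N → ℝ) → ℝ, IsEhrenpreisCutoff A A' C χ →
    ∃ qs : ℕ → (Fin N' → ℂ) → ℂ, IsFormalAnalyticAmplitude Ω qs ∧
      (∀ K : Set ((Fin N → ℂ) × (Fin N' → ℂ)), IsCompact K → K ⊆ A₀C ×ˢ B₀C →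
        (toComplex '' A) ×ˢ (toComplex '' B) ⊆ K →
       ∀ R : ℝ, IsRealizationParameter q K R →
       ∀ Ks : Set (Fin N' → ℂ), IsCompact Ks → Ks ⊆ Ω → toComplex '' B ⊆ Ks →
       ∀ Rs : ℝ, IsRealizationParameter qs Ks Rs →
       ∃ ε M lam₀ : ℝ, 0 < ε ∧ 1 ≤ lam₀ ∧ ∀ lam : ℝ, lam₀ ≤ lam → ∀ b ∈ B,
        ‖((lam ^ (-(N : ℝ) / 2) : ℝ) : ℂ) *
            Complex.exp (Complex.I * (lam : ℂ) * Φ (acrit (toComplex b), toComplex b)) *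
            finiteRealization qs Rs lam (toComplex b)
          - oscIntegral Φ (χ (τ lam)) (finiteRealization q R lam) lam b‖
          ≤ M * Real.exp (-ε * lam)) ∧
      (q 0 (toComplex a₀, toComplex b₀) ≠ 0 → IsEllipticOn Ω qs) := by

  have haC := hAA ⟨a₀, ha₀, rfl⟩
  have hbC := hBB ⟨b₀, hb₀, rfl⟩
  obtain ⟨AC, BC, acrit, hAC, haAC, hACsub, hBC, hbBC, hBCsub, hcrit⟩ :=
    exists_isCriticalPointMap hA₀C hB₀C hΦ haC hbC hgrad hhess
  refine ⟨AC, BC, acrit, hAC, haAC, hACsub, hBC, hbBC, hBCsub, hcrit, ?_⟩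
  -- The contour argument normalizes `Im Φ` to vanish at the base point, hence the distinction.
  rcases (him a₀ ha₀ b₀ hb₀).eq_or_lt with him0 | hpos
  · exact hasStationaryPhase_of_im_eq_zero hA₀ hB₀ ha₀ hb₀ hA₀C hB₀C haC hbC hq hΦ hgrad hhess him
      him0.symm hBC hbBC hcrit
  · exact hasStationaryPhase_of_im_pos hA₀ hB₀ ha₀ hb₀ (hΦ _ ⟨haC, hbC⟩).continuousAt hpos hBC hbBC
      (hcrit.holomorphic _ hbBC).continuousAt hcrit.base
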